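/- **Setting.** Let $\Omega\subset\mathbb{R}^3$ be an open set with $\Omega^c\subset B_{r_0}$ for some $r_0>0$, where $B_{r_0}$ is the open ball of radius $r_0$ around $0$ (for instance a connected Lipschitz domain with compact complement), and let $H^1_0(\Omega)$ be the closure of $C_c^\infty(\Omega;\mathbb{C})$ in the norm $\|u\|_{H^1(\Omega)}^2=\|u\|_{L^2(\Omega)}^2+\|\nabla u\|_{L^2(\Omega)}^2$. Let $\varsigma\in\mathbb{R}^{3\times3}$ be symmetric positive definite with minimal and maximal eigenvalues $\varsigma_{\min},\varsigma_{\max}$. **First assumption on the profile.** Let $r_1>r_0$, $\gamma\in\mathbb{C}$ with $\operatorname{Re}\gamma\ge0$, $\operatorname{Im}\gamma>0$, and let $\tilde\alpha\colon[0,\infty)\to[0,\infty)$ be continuous and non-decreasing, with $\tilde\alpha(r)=0$ for $r\le r_1$ and $\tilde\alpha(r)>0$ for $r>r_1$, twice continuously differentiable on $(r_1,\infty)$ with continuous extensions of $\tilde\alpha'$ and $\tilde\alpha''$ to $[r_1,\infty)$, and such that $\tilde\alpha$ and $\alpha(r):=r\tilde\alpha'(r)+\tilde\alpha(r)$ (defined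 for $r\ne r_1$) are bounded. Put $$\tilde d:=1+\gamma\tilde\alpha,\qquad d:=1+\gamma\alpha,\qquad d_0:=\lim_{r\to\infty}\tilde d(r)/|\tilde d(r)|;$$ functions of $r$ are regarded as functions of $x\in\mathbb{R}^3$ through $r=|x|$. **Second assumption on the profile.** As $r\to\infty$, $\dfrac{\tilde d(r)|d(r)|}{|\tilde d(r)|d(r)}\to1$, $\ \partial_r(\tilde d/|\tilde d|)(r)\to0$ and $\partial_r(d/|d|)(r)\to0$. **Anisotropy condition.** With $\tau_*:=\sup_{r>r_1}|\arg(\tilde d(r)/d(r))|$, assume $\cos\tau_*>1-\varsigma_{\min}/\varsigma_{\max}$. **The form and the operator.** For $x\neq 0$ let $\hat x=x/|x|$, let $F=F(x)\in\mathbb{R}^{3\times3}$ be an orthogonal matrix with first column $\hat x$, let $M:=\operatorname{diag}(\tilde d^2,\tilde d d,\tilde d d)$ and $\tilde\varsigma:=(\tilde d^2d)^{-1}FMF^\top\varsigma FMF^\top$ (this does not depend on the choice of $F$). For $\omega\in\mathbb{C}$ and $u,u'\in H^1_0(\Omega)$ let $$a(\omega;u,u'):=\int_\Omega(\tilde\varsigma\nabla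 u)\cdot\overline{\nabla u'}\,dx-\omega^2\int_\Omega\tilde d^2d\,u\,\overline{u'}\,dx .$$ **The operator $T(\omega)$.** Let $\hat\alpha(r):=\lim_{\rho\to r_1+}\alpha(\rho)$ for $0\le r\le r_1$ and $\hat\alpha(r):=\alpha(r)$ for $r>r_1$, and let $\hat d:=1+\gamma\hat\alpha$, $\hat\tau:=\arg(\tilde d/\hat d)$ and $\hat\psi:=\arg\bigl(\varsigma_{\min}-(1-\cos\tau_*)\varsigma_{\max}-i\varsigma_{\max}\sin\hat\tau\bigr)$. Let $\Lambda_{d_0}:=\{z\in\mathbb{C}:\operatorname{Re}(izd_0)\ne0\}$. For $\omega\in\Lambda_{d_0}$ let $m_\omega$ be the radial function $$m_\omega:=\frac{|\tilde d|}{\overline{\tilde d}}\,e^{i\hat\psi}\ \text{ if }\arg(-\omega^2d_0^2)\le0,\qquad m_\omega:=\frac{|\tilde d|}{\overline{\tilde d}}\,e^{-i\hat\psi}\ \text{ if }\arg(-\omega^2d_0^2)>0 .$$ (For $\omega\in\Lambda_{d_0}$ the number $-\omega^2d_0^2$ is not a negative real number. All arguments are principal values.) **Theorem.** Under the two assumptions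 on the profile and the anisotropy condition, let $\omega\in\Lambda_{d_0}$. Then $|m_\omega|=1$, both integrals in $a(\omega;u,u')$ converge absolutely for all $u,u'\in H^1_0(\Omega)$, there is a (unique) bounded operator $A(\omega)$ on $H^1_0(\Omega)$ with $\langle A(\omega)u,u'\rangle_{H^1(\Omega)}=a(\omega;u,u')$ for all $u,u'\in H^1_0(\Omega)$, and $T(\omega)u:=m_\omega u$ defines a bounded bijective operator $T(\omega)$ on $H^1_0(\Omega)$. The operator $A(\omega)$ is weakly $T(\omega)$-coercive, that is, there is a compact operator $K(\omega)$ on $H^1_0(\Omega)$ such that $$\inf_{u\in H^1_0(\Omega)\setminus\{0\}}\frac{\bigl|\langle(T(\omega)^*A(\omega)+K(\omega))u,u\rangle_{H^1(\Omega)}\bigr|}{\|u\|_{H^1(\Omega)}^2}>0 .$$ Consequently $A(\omega)$ is a Fredholm operator of index zero. -/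

import Mathlib

open MeasureTheory Filter Topology
open scoped Matrix

noncomputable section

namespace AnisoPML

/-- Three-dimensional Euclidean space. -/
abbrev R3 : Type := EuclideanSpace ℝ (Fin 3)

/-- Complex vectors with three components and the Hermitian norm. -/
abbrev C3 : Type := EuclideanSpace ℂ (Fin 3)

section Sobolev

/-- The classical gradient of a complex-valued function. -/
def grad (φ : R3 → ℂ) (x : R3) : C3 :=
  WithLp.toLp 2 fun i => fderiv ℝ φ x (EuclideanSpace.single i 1)

/-- `φ` belongs to `C_c^∞(Ω)`. -/
structure IsTestFunction (Ω : Set R3) (φ : R3 → ℂ) : Prop where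
  smooth : ContDiff ℝ ((⊤ : ℕ∞) : WithTop ℕ∞) φ
  compact : HasCompactSupport φ
  support : tsupport φ ⊆ Ω

/-- `L²(Ω; ℂ) × L²(Ω; ℂ³)` with norm `(‖u‖² + ‖g‖²)^{1/2}`: the space of the pairs `(u, ∇u)`. -/
abbrev L2Pair (Ω : Set R3) : Type :=
  WithLp 2 (Lp ℂ 2 (volume.restrict Ω) × Lp C3 2 (volume.restrict Ω))

/-- `g` is the weak gradient of `u` in `Ω`. -/
def IsWeakGradient (Ω : Set R3) (u : R3 → ℂ) (g : R3 → C3) : Prop :=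
  ∀ φ : R3 → ℂ, IsTestFunction Ω φ → ∀ i : Fin 3,
    ∫ x in Ω, u x * grad φ x i = - ∫ x in Ω, g x i * φ x

/-- The pairs `(φ, ∇φ)` with `φ ∈ C_c^∞(Ω)`. -/
def testPairs (Ω : Set R3) : Submodule ℂ (L2Pair Ω) where
  carrier := {p | ∃ φ : R3 → ℂ, IsTestFunction Ω φ ∧
    p.fst =ᵐ[volume.restrict Ω] φ ∧ p.snd =ᵐ[volume.restrict Ω] grad φ}
  zero_mem' := by
    refine ⟨0, ⟨contDiff_const, HasCompactSupport.zero, by simp [tsupport]⟩, ?_, ?_⟩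
    · exact Lp.coeFn_zero ℂ 2 _
    · filter_upwards [Lp.coeFn_zero C3 2 (volume.restrict Ω)] with x hx
      change (0 : Lp C3 2 (volume.restrict Ω)) x = _
      rw [hx]
      ext i
      simp [grad]
  add_mem' := by
    rintro p q ⟨φ, hφ, hp1, hp2⟩ ⟨χ, hχ, hq1, hq2⟩
    refine ⟨φ + χ, ⟨hφ.smooth.add hχ.smooth, hφ.compact.add hχ.compact,
      (tsupport_add φ χ).trans (Set.union_subset hφ.support hχ.support)⟩, ?_, ?_⟩
    · filter_upwards [hp1, hq1, Lp.coeFn_add p.fst q.fst] with x h1 h2 h3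
      rw [WithLp.add_fst, h3, Pi.add_apply, h1, h2, Pi.add_apply]
    · filter_upwards [hp2, hq2, Lp.coeFn_add p.snd q.snd] with x h1 h2 h3
      rw [WithLp.add_snd, h3, Pi.add_apply, h1, h2]
      ext i
      simp [grad, fderiv_add ((hφ.smooth.differentiable (by simp)) x)
        ((hχ.smooth.differentiable (by simp)) x)]
  smul_mem' := by
    rintro c p ⟨φ, hφ, hp1, hp2⟩
    have hsub : tsupport (c • φ) ⊆ tsupport φ :=
      closure_mono (Function.support_const_smul_subset c φ)
    refine ⟨c • φ, ⟨hφ.smooth.const_smul c,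
      hφ.compact.of_isClosed_subset (isClosed_tsupport _) hsub, hsub.trans hφ.support⟩, ?_, ?_⟩
    · filter_upwards [hp1, Lp.coeFn_smul c p.fst] with x h1 h2
      rw [WithLp.smul_fst, h2, Pi.smul_apply, h1, Pi.smul_apply]
    · filter_upwards [hp2, Lp.coeFn_smul c p.snd] with x h1 h2
      rw [WithLp.smul_snd, h2, Pi.smul_apply, h1]
      ext i
      simp [grad, fderiv_const_smul ((hφ.smooth.differentiable (by simp)) x) c]

/-- The Sobolev space `H¹₀(Ω)`: the closure of `C_c^∞(Ω)` in the `H¹` norm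
`(‖u‖²_{L²} + ‖∇u‖²_{L²})^{1/2}`, its elements `u` being represented by the pairs `(u, ∇u)`. -/
def H10 (Ω : Set R3) : Submodule ℂ (L2Pair Ω) := (testPairs Ω).topologicalClosure

instance (Ω : Set R3) : CompleteSpace (H10 Ω) :=
  inferInstanceAs (CompleteSpace (testPairs Ω).topologicalClosure)

/-- The function in `L²(Ω)` that an element of `H¹₀(Ω)` is. -/
def valFn {Ω : Set R3} (u : H10 Ω) : R3 → ℂ := (u : L2Pair Ω).fst

/-- The weak gradient of an element of `H¹₀(Ω)`. -/
def gradFn {Ω : Set R3} (u : H10 Ω) : R3 → C3 := (u : L2Pair Ω).snd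

theorem IsTestFunction.continuous_grad {Ω : Set R3} {φ : R3 → ℂ} (h : IsTestFunction Ω φ) :
    Continuous (grad φ) := by
  have h1 : Continuous (fderiv ℝ φ) := h.smooth.continuous_fderiv (by simp)
  unfold grad
  fun_prop

theorem IsTestFunction.continuous_grad_apply {Ω : Set R3} {φ : R3 → ℂ} (h : IsTestFunction Ω φ)
    (i : Fin 3) : Continuous fun x => grad φ x i :=
  (EuclideanSpace.proj (𝕜 := ℂ) i).continuous.comp h.continuous_grad

theorem IsTestFunction.hasCompactSupport_grad_apply {Ω : Set R3} {φ : R3 → ℂ}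
    (h : IsTestFunction Ω φ) (i : Fin 3) : HasCompactSupport fun x => grad φ x i :=
  h.compact.fderiv_apply (𝕜 := ℝ) _

/-- Integration by parts for test functions. -/
theorem IsTestFunction.isWeakGradient {Ω : Set R3} {φ : R3 → ℂ} (h : IsTestFunction Ω φ) :
    IsWeakGradient Ω φ (grad φ) := by
  intro χ hχ i
  have hc : ∀ {χ : R3 → ℂ}, IsTestFunction Ω χ → Continuous fun x => grad χ x i := fun h =>
    h.continuous_grad_apply i
  have hz : ∀ {χ : R3 → ℂ}, IsTestFunction Ω χ → ∀ x, x ∉ Ω → χ x = 0 := fun h x hx =>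
    image_eq_zero_of_notMem_tsupport fun hx' => hx (h.support hx')
  have e1 : ∫ x in Ω, φ x * grad χ x i = ∫ x, φ x * grad χ x i :=
    setIntegral_eq_integral_of_forall_compl_eq_zero fun x hx => by rw [hz h x hx, zero_mul]
  have e2 : ∫ x in Ω, grad φ x i * χ x = ∫ x, grad φ x i * χ x :=
    setIntegral_eq_integral_of_forall_compl_eq_zero fun x hx => by rw [hz hχ x hx, mul_zero]
  rw [e1, e2]
  exact integral_mul_fderiv_eq_neg_fderiv_mul_of_integrable
    (((hc h).mul hχ.smooth.continuous).integrable_of_hasCompactSupport hχ.compact.mul_left)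
    ((h.smooth.continuous.mul (hc hχ)).integrable_of_hasCompactSupport h.compact.mul_right)
    ((h.smooth.continuous.mul hχ.smooth.continuous).integrable_of_hasCompactSupport
      h.compact.mul_right)
    (fun x _ => (h.smooth.differentiable (by simp)) x)
    (fun x _ => (hχ.smooth.differentiable (by simp)) x)

/-- The two components of an element of `H¹₀(Ω)` are a function and its weak gradient. -/
theorem isWeakGradient_gradFn {Ω : Set R3} (u : H10 Ω) :
    IsWeakGradient Ω (valFn u) (gradFn u) := by
  intro χ hχ i
  have m1 : MemLp (fun x => (starRingEnd ℂ) (grad χ x i)) 2 (volume.restrict Ω) := by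
    have hc : Continuous fun x => (starRingEnd ℂ) (grad χ x i) :=
      Complex.continuous_conj.comp (hχ.continuous_grad_apply i)
    exact (hc.memLp_of_hasCompactSupport
      ((hχ.hasCompactSupport_grad_apply i).comp_left (map_zero _))).restrict Ω
  have m2 : MemLp (fun x => EuclideanSpace.single i ((starRingEnd ℂ) (χ x))) 2
      (volume.restrict Ω) := by
    have hc : Continuous fun x => (EuclideanSpace.single i ((starRingEnd ℂ) (χ x)) : C3) := by
      have h0 := Complex.continuous_conj.comp hχ.smooth.continuous
      have : Continuous fun z : ℂ => (EuclideanSpace.single i z : C3) := by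
        refine (PiLp.continuous_toLp 2 _).comp ?_
        exact continuous_pi fun j => by
          by_cases hj : j = i
          · subst hj; simpa using continuous_id'
          · simpa [Pi.single_apply, hj] using continuous_const
      exact this.comp h0
    exact (hc.memLp_of_hasCompactSupport
      (hχ.compact.comp_left (g := fun z : ℂ => (EuclideanSpace.single i ((starRingEnd ℂ) z) : C3))
        (by ext j; simp))).restrict Ω
  have key : ∀ p : L2Pair Ω, inner ℂ (m1.toLp _) p.fst + inner ℂ (m2.toLp _) p.snd
      = (∫ x in Ω, p.fst x * grad χ x i) + ∫ x in Ω, p.snd x i * χ x := by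
    intro p
    rw [L2.inner_def, L2.inner_def]
    congr 1
    · refine integral_congr_ae ?_
      filter_upwards [m1.coeFn_toLp] with x hx
      simp [hx]
    · refine integral_congr_ae ?_
      filter_upwards [m2.coeFn_toLp] with x hx
      simp [hx, EuclideanSpace.inner_single_left, mul_comm]
  have hcl : IsClosed {p : L2Pair Ω |
      inner ℂ (m1.toLp _) p.fst + inner ℂ (m2.toLp _) p.snd = (0 : ℂ)} := by
    refine isClosed_eq ?_ continuous_const
    exact (Continuous.inner continuous_const (WithLp.prod_continuous_ofLp 2 _ _).fst).add
      (Continuous.inner continuous_const (WithLp.prod_continuous_ofLp 2 _ _).snd)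
  have hsub : (testPairs Ω : Set (L2Pair Ω)) ⊆ {p : L2Pair Ω |
      inner ℂ (m1.toLp _) p.fst + inner ℂ (m2.toLp _) p.snd = (0 : ℂ)} := by
    rintro p ⟨φ, hφ, h1, h2⟩
    have := hφ.isWeakGradient χ hχ i
    rw [Set.mem_ofPred_eq, key, ← add_neg_cancel (∫ x in Ω, φ x * grad χ x i)]
    rw [this, neg_neg]
    congr 1
    · rw [← this]
      refine integral_congr_ae ?_
      filter_upwards [h1] with x hx
      rw [hx]
    · refine integral_congr_ae ?_
      filter_upwards [h2] with x hx
      rw [hx]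
  have hu := closure_minimal hsub hcl u.2
  rw [Set.mem_ofPred_eq, key] at hu
  exact eq_neg_of_add_eq_zero_left hu

end Sobolev

section Scaling

/-- `d̃(r) = 1 + γ α̃(r)`. -/
def dTilde (γ : ℂ) (a : ℝ → ℝ) (r : ℝ) : ℂ := 1 + γ * (a r : ℂ)

/-- `α(r) = r α̃'(r) + α̃(r)` (used at `r ≠ r₁` only). -/
def alpha (a : ℝ → ℝ) (r : ℝ) : ℝ := r * deriv a r + a r

/-- `d(r) = 1 + γ α(r)`. -/
def dFun (γ : ℂ) (a : ℝ → ℝ) (r : ℝ) : ℂ := 1 + γ * (alpha a r : ℂ)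

/-- `d₀ = lim_{r → ∞} d̃(r) / |d̃(r)|`. -/
def d0 (γ : ℂ) (a : ℝ → ℝ) : ℂ := limUnder atTop fun r : ℝ => dTilde γ a r / (‖dTilde γ a r‖ : ℂ)

/-- The first assumption on the profile `α̃ : [0,∞) → [0,∞)`, here `a` restricted to `[0,∞)`,
and on the constant `γ`. -/
structure ProfileAssumption (r₀ r₁ : ℝ) (γ : ℂ) (a : ℝ → ℝ) : Prop where
  r₀_lt : r₀ < r₁
  γ_re : 0 ≤ γ.re
  γ_im : 0 < γ.im
  nonneg : ∀ r, 0 ≤ r → 0 ≤ a r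
  eq_zero : ∀ r, 0 ≤ r → r ≤ r₁ → a r = 0
  continuous : ContinuousOn a (Set.Ici 0)
  pos : ∀ r, r₁ < r → 0 < a r
  monotone : MonotoneOn a (Set.Ici 0)
  contDiff : ContDiffOn ℝ 2 a (Set.Ioi r₁)
  deriv_extends : ∃ l : ℝ, Tendsto (deriv a) (𝓝[>] r₁) (𝓝 l)
  deriv2_extends : ∃ l : ℝ, Tendsto (deriv (deriv a)) (𝓝[>] r₁) (𝓝 l)
  bounded : ∃ C : ℝ, ∀ r, 0 ≤ r → |a r| ≤ C
  alpha_bounded : ∃ C : ℝ, ∀ r, 0 ≤ r → r ≠ r₁ → |alpha a r| ≤ C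

/-- The limit that defines `d₀` exists. -/
theorem ProfileAssumption.tendsto_d0 {r₀ r₁ : ℝ} {γ : ℂ} {a : ℝ → ℝ}
    (h : ProfileAssumption r₀ r₁ γ a) :
    Tendsto (fun r : ℝ => dTilde γ a r / (‖dTilde γ a r‖ : ℂ)) atTop (𝓝 (d0 γ a)) := by
  refine tendsto_nhds_limUnder ?_
  obtain ⟨C, hC⟩ := h.bounded
  have hmono : Monotone fun r => a (max r 0) := fun x y hxy =>
    h.monotone (Set.mem_Ici.2 (le_max_right _ _)) (Set.mem_Ici.2 (le_max_right _ _)) (max_le_max_right 0 hxy)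
  have hbdd : BddAbove (Set.range fun r => a (max r 0)) :=
    ⟨C, by rintro _ ⟨r, rfl⟩; exact (le_abs_self _).trans (hC _ (le_max_right _ _))⟩
  have hlim := tendsto_atTop_ciSup hmono hbdd
  set l := ⨆ r, a (max r 0)
  have hl : 0 ≤ l := (h.nonneg _ (le_max_right 0 0)).trans (le_ciSup hbdd 0)
  have ha : Tendsto a atTop (𝓝 l) := hlim.congr' (by
    filter_upwards [eventually_ge_atTop 0] with r hr
    rw [max_eq_left hr])
  have hd : Tendsto (dTilde γ a) atTop (𝓝 (1 + γ * (l : ℂ))) :=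
    tendsto_const_nhds.add (tendsto_const_nhds.mul
      ((Complex.continuous_ofReal.tendsto l).comp ha))
  have hne : 1 + γ * (l : ℂ) ≠ 0 := by
    intro h0
    have := congrArg Complex.re h0
    simp at this
    nlinarith [mul_nonneg h.γ_re hl]
  exact ⟨_, hd.div ((Complex.continuous_ofReal.tendsto _).comp hd.norm) (by simpa using hne)⟩

/-- The second assumption on the profile: behaviour of the phases of `d̃` and `d` at infinity. -/
structure PhaseAssumption (γ : ℂ) (a : ℝ → ℝ) : Prop where
  ratio : Tendsto (fun r : ℝ =>
      dTilde γ a r * (‖dFun γ a r‖ : ℂ) / ((‖dTilde γ a r‖ : ℂ) * dFun γ a r)) atTop (𝓝 1)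
  deriv_dTilde : Tendsto (deriv fun r : ℝ => dTilde γ a r / (‖dTilde γ a r‖ : ℂ)) atTop (𝓝 0)
  deriv_dFun : Tendsto (deriv fun r : ℝ => dFun γ a r / (‖dFun γ a r‖ : ℂ)) atTop (𝓝 0)

/-- `Λ_{d₀}`. -/
def Lam (γ : ℂ) (a : ℝ → ℝ) : Set ℂ := {z | (Complex.I * z * d0 γ a).re ≠ 0}

/-- Minimal eigenvalue of the symmetric matrix `ς`. -/
def sMin (ς : Matrix (Fin 3) (Fin 3) ℝ) : ℝ := sInf (spectrum ℝ ς)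

/-- Maximal eigenvalue of the symmetric matrix `ς`. -/
def sMax (ς : Matrix (Fin 3) (Fin 3) ℝ) : ℝ := sSup (spectrum ℝ ς)

/-- `τ_* = sup_{r > r₁} |arg (d̃(r)/d(r))|`. -/
def tauStar (r₁ : ℝ) (γ : ℂ) (a : ℝ → ℝ) : ℝ :=
  ⨆ r : Set.Ioi r₁, |(dTilde γ a r / dFun γ a r).arg|

/-- `α̂`: equal to `α` on `(r₁, ∞)`, and to the right limit `α(r₁+)` on `[0, r₁]`. -/
def alphaHat (r₁ : ℝ) (a : ℝ → ℝ) (r : ℝ) : ℝ :=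
  if r ≤ r₁ then limUnder (𝓝[>] r₁) (alpha a) else alpha a r

/-- The one-sided limit in the definition of `α̂` exists. -/
theorem ProfileAssumption.tendsto_alpha {r₀ r₁ : ℝ} {γ : ℂ} {a : ℝ → ℝ} (hr₀ : 0 < r₀)
    (h : ProfileAssumption r₀ r₁ γ a) :
    Tendsto (alpha a) (𝓝[>] r₁) (𝓝 (limUnder (𝓝[>] r₁) (alpha a))) := by
  refine tendsto_nhds_limUnder ?_
  obtain ⟨l, hl⟩ := h.deriv_extends
  have hr₁ : 0 < r₁ := hr₀.trans h.r₀_lt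
  have hc : Tendsto a (𝓝[>] r₁) (𝓝 (a r₁)) :=
    (h.continuous r₁ hr₁.le).mono_left (nhdsWithin_mono _ fun x hx => (hr₁.trans hx).le)
  exact ⟨_, ((tendsto_id.mono_left nhdsWithin_le_nhds).mul hl).add hc⟩

/-- `d̂(r) = 1 + γ α̂(r)`. -/
def dHat (r₁ : ℝ) (γ : ℂ) (a : ℝ → ℝ) (r : ℝ) : ℂ := 1 + γ * (alphaHat r₁ a r : ℂ)

/-- `τ̂(r) = arg (d̃(r) / d̂(r))`. -/
def tauHat (r₁ : ℝ) (γ : ℂ) (a : ℝ → ℝ) (r : ℝ) : ℝ := (dTilde γ a r / dHat r₁ γ a r).arg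

/-- `ψ̂(r) = arg (ς_min - (1 - cos τ_*) ς_max - i ς_max sin τ̂(r))`. -/
def psiHat (ς : Matrix (Fin 3) (Fin 3) ℝ) (r₁ : ℝ) (γ : ℂ) (a : ℝ → ℝ) (r : ℝ) : ℝ :=
  (((sMin ς - (1 - Real.cos (tauStar r₁ γ a)) * sMax ς : ℝ) : ℂ)
    - Complex.I * ((sMax ς * Real.sin (tauHat r₁ γ a r) : ℝ) : ℂ)).arg

/-- The symbol of the multiplication operator `T(ω)`. For `ω ∈ Λ_{d₀}` the number `-ω² d₀²` is not a
negative real, so that it does not matter whether the argument takes values in `[-π, π)` or in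
`(-π, π]`. -/
def symbolT (ς : Matrix (Fin 3) (Fin 3) ℝ) (r₁ : ℝ) (γ : ℂ) (a : ℝ → ℝ) (ω : ℂ) (r : ℝ) : ℂ :=
  (‖dTilde γ a r‖ : ℂ) / (starRingEnd ℂ) (dTilde γ a r) *
    if (-ω ^ 2 * d0 γ a ^ 2).arg ≤ 0 then Complex.exp (Complex.I * (psiHat ς r₁ γ a r : ℂ))
    else Complex.exp (-Complex.I * (psiHat ς r₁ γ a r : ℂ))

/-- The orthogonal projection `x̂ x̂ᵀ` onto the radial direction `x̂ = x / |x|`. -/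
def radialProj (x : R3) : Matrix (Fin 3) (Fin 3) ℂ :=
  Matrix.of fun i j => ((x i / ‖x‖ * (x j / ‖x‖) : ℝ) : ℂ)

/-- The matrix `F M Fᵀ` with `M = diag (d̃², d̃ d, d̃ d)` and `F` the orthonormal frame of
spherical coordinates: `d̃²` in the radial direction and `d̃ d` in the tangential ones. -/
def frameMatrix (γ : ℂ) (a : ℝ → ℝ) (x : R3) : Matrix (Fin 3) (Fin 3) ℂ :=
  dTilde γ a ‖x‖ ^ 2 • radialProj x
    + (dTilde γ a ‖x‖ * dFun γ a ‖x‖) • (1 - radialProj x)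

/-- `frameMatrix` is `F M Fᵀ` for every orthogonal `F` whose first column is `x̂`. -/
theorem frameMatrix_eq (γ : ℂ) (a : ℝ → ℝ) (x : R3) (F : Matrix (Fin 3) (Fin 3) ℝ)
    (hF : F * Fᵀ = 1) (hx : ∀ i, F i 0 = x i / ‖x‖) :
    frameMatrix γ a x = F.map (algebraMap ℝ ℂ) *
      Matrix.diagonal ![dTilde γ a ‖x‖ ^ 2, dTilde γ a ‖x‖ * dFun γ a ‖x‖,
        dTilde γ a ‖x‖ * dFun γ a ‖x‖] * (F.map (algebraMap ℝ ℂ))ᵀ := by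
  have h1 : ∀ i j, (F i 0 * F j 0 + F i 1 * F j 1 + F i 2 * F j 2 : ℂ)
      = (1 : Matrix (Fin 3) (Fin 3) ℂ) i j := by
    intro i j
    have := congrFun (congrFun hF i) j
    simp only [Matrix.mul_apply, Matrix.transpose_apply, Fin.sum_univ_three] at this
    rw [Matrix.one_apply] at this ⊢
    exact_mod_cast congrArg (algebraMap ℝ ℂ) this |>.trans (by split_ifs <;> simp)
  ext i j
  simp only [frameMatrix, radialProj, ← hx, Matrix.add_apply, Matrix.smul_apply, Matrix.sub_apply,
    ← h1, Matrix.of_apply, Matrix.mul_apply, Matrix.transpose_apply,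
    Matrix.map_apply, Fin.sum_univ_three, smul_eq_mul]
  simp
  ring

/-- `ς̃ = (d̃² d)⁻¹ F M Fᵀ ς F M Fᵀ`. -/
def sigmaTilde (ς : Matrix (Fin 3) (Fin 3) ℝ) (γ : ℂ) (a : ℝ → ℝ) (x : R3) :
    Matrix (Fin 3) (Fin 3) ℂ :=
  (dTilde γ a ‖x‖ ^ 2 * dFun γ a ‖x‖)⁻¹ •
    (frameMatrix γ a x * ς.map (algebraMap ℝ ℂ) * frameMatrix γ a x)

end Scaling

section Operators

/-- The integrand `(ς̃ ∇u) · conj ∇u'` (`inner` is conjugate linear in its first argument). -/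
def stiffness {Ω : Set R3} (ς : Matrix (Fin 3) (Fin 3) ℝ) (γ : ℂ) (a : ℝ → ℝ) (u u' : H10 Ω)
    (x : R3) : ℂ :=
  inner ℂ (gradFn u' x) (Matrix.toEuclideanLin (sigmaTilde ς γ a x) (gradFn u x))

/-- The integrand `d̃² d u conj u'`. -/
def massTerm {Ω : Set R3} (γ : ℂ) (a : ℝ → ℝ) (u u' : H10 Ω) (x : R3) : ℂ :=
  dTilde γ a ‖x‖ ^ 2 * dFun γ a ‖x‖ * valFn u x * (starRingEnd ℂ) (valFn u' x)

/-- The sesquilinear form `a(ω; u, u') = ⟨ς̃ ∇u, ∇u'⟩ - ω² ⟨d̃² d u, u'⟩`. -/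
def form {Ω : Set R3} (ς : Matrix (Fin 3) (Fin 3) ℝ) (γ : ℂ) (a : ℝ → ℝ) (ω : ℂ)
    (u u' : H10 Ω) : ℂ :=
  (∫ x in Ω, stiffness ς γ a u u' x) - ω ^ 2 * ∫ x in Ω, massTerm γ a u u' x

/-- `A` is the operator `A(ω)`: the form `a(ω; ·, ·)` is well defined on `H¹₀(Ω)` and
`⟨A u, u'⟩_{H¹} = a(ω; u, u')` for all `u, u'`. This determines `A`. -/
def IsOperatorA {Ω : Set R3} (ς : Matrix (Fin 3) (Fin 3) ℝ) (γ : ℂ) (a : ℝ → ℝ) (ω : ℂ)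
    (A : H10 Ω →L[ℂ] H10 Ω) : Prop :=
  ∀ u u' : H10 Ω, IntegrableOn (stiffness ς γ a u u') Ω ∧ IntegrableOn (massTerm γ a u u') Ω ∧
    inner ℂ u' (A u) = form ς γ a ω u u'

/-- `T` is the operator of multiplication by the radial function `x ↦ m(|x|)`. -/
def IsRadialMultiplication {Ω : Set R3} (m : ℝ → ℂ) (T : H10 Ω →L[ℂ] H10 Ω) : Prop :=
  ∀ u : H10 Ω, valFn (T u) =ᵐ[volume.restrict Ω] fun x => m ‖x‖ * valFn u x

variable {H : Type*} [NormedAddCommGroup H] [InnerProductSpace ℂ H] [CompleteSpace H]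

/-- `A` is weakly `T`-coercive, for a bounded bijective `T`: there is a compact operator `K` with
`inf_{u ≠ 0} |⟨(T^* A + K) u, u⟩| / ‖u‖² > 0`. -/
def IsWeaklyCoercive (T A : H →L[ℂ] H) : Prop :=
  Function.Bijective T ∧ ∃ K : H →L[ℂ] H, IsCompactOperator K ∧
    ∃ c : ℝ, 0 < c ∧ ∀ u : H,
      c * ‖u‖ ^ 2 ≤ ‖inner ℂ u ((ContinuousLinearMap.adjoint T ∘L A + K) u)‖

/-- `A` is a Fredholm operator with index zero. -/
def IsFredholmIndexZero (A : H →L[ℂ] H) : Prop :=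
  A.IsFredholm ∧ Module.finrank ℂ A.ker = Module.finrank ℂ (H ⧸ A.range)

end Operators

end AnisoPML

end

/-!
The operator `A(ω)` is shown to be Fredholm of index zero by a Gårding inequality for the form
`a(ω; u, T(ω) u)`, rotated by one complex constant.

*The principal part.* Split `∇u` into its radial and tangential parts. After multiplication by
`conj d̃ / |d̃|`, the quadratic form of `ς̃` is the real form of `ς` at the rescaled vector
`|d̃| radial + |d| tangential`, up to errors that are governed by the angle `τ` between `d̃` and `d`.
The real part of the result is at least `ς_min - (1 - cos τ) ς_max` times the squared norm, its
imaginary part is at most `ς_max |sin τ|` times it, so that it lies in a sector; the factor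
`exp (∓ i ψ̂)` turns this sector so that one of its sides becomes the real axis. After
multiplication by `κ ± i` with a small `κ > 0` the real part is coercive (`le_re_rotation_mul_form`,
`le_re_mul_inner_sigmaOp`).

*The mass term.* Near infinity the phases of `d̃`, of `d` and of the symbol of `T(ω)` all tend to
`d₀`, so that the mass term is, up to positive factors and small errors, `-ω² d₀² |u|²`. This number
is not a negative real, and the sign of its imaginary part decides on the sign of `ψ̂`: for
small `κ` the same rotation `κ ± i` moves it into the right half plane (`exists_rotation`,
`eventually_le_re_mass`).

*The cross term.* The gradient of the symbol of `T(ω)` is bounded and tends to zero at infinity, since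
the derivatives of the phases of `d̃` and `d` do. Young's inequality therefore absorbs the term that
contains it, up to a multiple of the `L²` norm of `u` on a ball
(`exists_pointwise_garding`, `exists_garding`).

*Compactness.* The `L²` norm on a ball is controlled by a small multiple of the `H¹` norm and finitely
many continuous linear functionals, namely averages over small balls (`exists_finiteRank_control`).
Hence the operator `e T(ω)^* A(ω) + C G^* G` is coercive for some `G` of finite rank. By Lax–Milgram it
is invertible, and a finite rank perturbation of an invertible operator is Fredholm of index zero
(`isWeaklyCoercive_and_isFredholmIndexZero`).

*The operator `T(ω)`.* The symbol is Lipschitz, being constant in the ball of radius `r₁` and continuously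
differentiable with bounded derivative outside. Multiplication by a bounded Lipschitz function that is
strictly differentiable almost everywhere preserves `H¹₀(Ω)`, as one sees by mollifying the function
(`IsMultiplier.op`), and the conjugate symbol gives the inverse because `|m_ω| = 1`.
-/

open MeasureTheory Filter Topology
open scoped Matrix

noncomputable section

namespace AnisoPML

/-! ### Weak coercivity modulo finite rank and the Fredholm index -/

section Fredholm

/-- The index of `1 - F` vanishes for every linear `F` of finite rank: with `V = range F`, both the
kernel and the cokernel of `1 - F` are those of its restriction to the finite-dimensional `V`. -/
theorem finrank_ker_eq_finrank_quotient_range_one_sub {V : Type*} [AddCommGroup V] [Module ℂ V]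
    (F : V →ₗ[ℂ] V) [FiniteDimensional ℂ (LinearMap.range F)] :
    Module.finrank ℂ (LinearMap.ker (1 - F)) =
      Module.finrank ℂ (V ⧸ LinearMap.range (1 - F)) := by
  set W := LinearMap.range F
  have hmaps : ∀ x ∈ W, (1 - F) x ∈ W := fun x hx => W.sub_mem hx ⟨x, rfl⟩
  set g : W →ₗ[ℂ] W := (1 - F).restrict hmaps
  have hker : Module.finrank ℂ (LinearMap.ker (1 - F)) = Module.finrank ℂ (LinearMap.ker g) := by
    have hle : LinearMap.ker (1 - F) ≤ W := by
      intro x hx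
      have : x - F x = 0 := hx
      exact ⟨x, (sub_eq_zero.1 this).symm⟩
    have : LinearMap.ker g = (LinearMap.ker (1 - F)).comap W.subtype := by
      ext x
      simp [g, LinearMap.restrict_apply, Subtype.ext_iff]
    rw [this]
    exact (Submodule.comapSubtypeEquivOfLe hle).finrank_eq.symm
  have hcok : Module.finrank ℂ (V ⧸ LinearMap.range (1 - F)) =
      Module.finrank ℂ (W ⧸ LinearMap.range g) := by
    set q : W →ₗ[ℂ] V ⧸ LinearMap.range (1 - F) :=
      (LinearMap.range (1 - F)).mkQ ∘ₗ W.subtype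
    have hq : LinearMap.ker q = LinearMap.range g := by
      ext x
      simp only [q, LinearMap.mem_ker, LinearMap.comp_apply, Submodule.mkQ_apply,
        Submodule.Quotient.mk_eq_zero, Submodule.subtype_apply, LinearMap.mem_range]
      constructor
      · rintro ⟨y, hy⟩
        have hyW : y ∈ W := by
          have : y = (1 - F) y + F y := by simp
          rw [this, hy]
          exact W.add_mem x.2 ⟨y, rfl⟩
        exact ⟨⟨y, hyW⟩, Subtype.ext hy⟩
      · rintro ⟨y, rfl⟩
        exact ⟨y, rfl⟩
    have hsurj : LinearMap.range q = ⊤ := by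
      refine LinearMap.range_eq_top.2 fun z => ?_
      obtain ⟨x, rfl⟩ := Submodule.mkQ_surjective _ z
      refine ⟨⟨F x, x, rfl⟩, ?_⟩
      simp only [q, LinearMap.comp_apply, Submodule.subtype_apply]
      rw [← sub_eq_zero, ← map_sub, Submodule.mkQ_apply, Submodule.Quotient.mk_eq_zero]
      exact ⟨-x, by simp [sub_eq_add_neg, add_comm]⟩
    rw [← hq]
    exact ((q.quotKerEquivRange).trans (LinearEquiv.ofTop _ hsurj)).finrank_eq.symm
  rw [hker, hcok]
  have h1 := g.finrank_range_add_finrank_ker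
  have h2 := (LinearMap.range g).finrank_quotient_add_finrank
  omega

variable {H : Type*} [NormedAddCommGroup H] [InnerProductSpace ℂ H]

/-- An invertible operator times `1 - F` with `F` of finite rank is Fredholm of index zero. -/
theorem isFredholmIndexZero_mul_one_sub (J F : H →L[ℂ] H) (hJ : IsUnit J)
    [FiniteDimensional ℂ (LinearMap.range (F : H →ₗ[ℂ] H))] :
    IsFredholmIndexZero (J * (1 - F)) := by
  obtain ⟨J, rfl⟩ := hJ
  have hF : (F : H →ₗ[ℂ] H).HasNoetherianRange :=
    (inferInstance : IsNoetherian ℂ (LinearMap.range (F : H →ₗ[ℂ] H)))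
  have e1 : ∀ x, (↑J⁻¹ : H →L[ℂ] H) ((J : H →L[ℂ] H) x) = x := fun x => by
    rw [← mul_apply_eq_comp]; simp
  have e2 : ∀ x, (J : H →L[ℂ] H) ((↑J⁻¹ : H →L[ℂ] H) x) = x := fun x => by
    rw [← mul_apply_eq_comp]; simp
  constructor
  · refine ContinuousLinearMap.IsFredholm.of_isQuasiInverse (v := (↑J⁻¹ : H →L[ℂ] H)) ?_
    constructor
    · refine LinearMap.FiniteRangeSetoid.equiv_iff_hasNoetherianRange.2 ?_
      have h : ((↑J⁻¹ : H →L[ℂ] H) : H →ₗ[ℂ] H) ∘ₗ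
          (((J : H →L[ℂ] H) * (1 - F) : H →L[ℂ] H) : H →ₗ[ℂ] H) - LinearMap.id
          = -(F : H →ₗ[ℂ] H) := by
        ext x
        simp [e1]
      exact h ▸ hF.neg
    · refine LinearMap.FiniteRangeSetoid.equiv_iff_hasNoetherianRange.2 ?_
      have h : (((J : H →L[ℂ] H) * (1 - F) : H →L[ℂ] H) : H →ₗ[ℂ] H) ∘ₗ
          ((↑J⁻¹ : H →L[ℂ] H) : H →ₗ[ℂ] H) - LinearMap.id
          = -(((J : H →L[ℂ] H) : H →ₗ[ℂ] H) ∘ₗ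
            ((F : H →ₗ[ℂ] H) ∘ₗ ((↑J⁻¹ : H →L[ℂ] H) : H →ₗ[ℂ] H))) := by
        ext x
        simp [e2]
      exact h ▸ ((hF.comp_right ((↑J⁻¹ : H →L[ℂ] H) : H →ₗ[ℂ] H)).comp_left
        ((J : H →L[ℂ] H) : H →ₗ[ℂ] H)).neg
  · have key := finrank_ker_eq_finrank_quotient_range_one_sub (F : H →ₗ[ℂ] H)
    let E : H ≃ₗ[ℂ] H := LinearEquiv.ofLinearMap ((J : H →L[ℂ] H) : H →ₗ[ℂ] H)
      ((↑J⁻¹ : H →L[ℂ] H) : H →ₗ[ℂ] H) (by ext x; simp [e2]) (by ext x; simp [e1])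
    have hcomp : (((J : H →L[ℂ] H) * (1 - F) : H →L[ℂ] H) : H →ₗ[ℂ] H)
        = (E : H →ₗ[ℂ] H) ∘ₗ (1 - (F : H →ₗ[ℂ] H)) := by
      ext x; simp [E]
    change Module.finrank ℂ (LinearMap.ker (((J : H →L[ℂ] H) * (1 - F) : H →L[ℂ] H) : H →ₗ[ℂ] H))
      = Module.finrank ℂ
        (H ⧸ LinearMap.range (((J : H →L[ℂ] H) * (1 - F) : H →L[ℂ] H) : H →ₗ[ℂ] H))
    rw [hcomp, LinearEquiv.ker_comp, LinearMap.range_comp, key]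
    exact (Submodule.Quotient.equiv _ _ E rfl).finrank_eq

variable [CompleteSpace H]

/-- A Gårding inequality for the rotated form `e ⟨A u, T u⟩`, with an error controlled by a map `G`
into a finite-dimensional space, makes `A` weakly `T`-coercive and Fredholm of index zero. -/
theorem isWeaklyCoercive_and_isFredholmIndexZero {E : Type*} [NormedAddCommGroup E]
    [InnerProductSpace ℂ E] [FiniteDimensional ℂ E] (T A : H →L[ℂ] H) (G : H →L[ℂ] E)
    (hT : IsUnit T) {e : ℂ} (he : e ≠ 0) {c C : ℝ} (hc : 0 < c)
    (h : ∀ u, c * ‖u‖ ^ 2 - C * ‖G u‖ ^ 2 ≤ (e * inner ℂ (T u) (A u)).re) :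
    IsWeaklyCoercive T A ∧ IsFredholmIndexZero A := by
  have : CompleteSpace E := FiniteDimensional.complete ℂ E
  have : ProperSpace E := FiniteDimensional.proper ℂ E
  set K : H →L[ℂ] H := ((C : ℂ) / e) • (ContinuousLinearMap.adjoint G ∘L G) with hK
  set S : H →L[ℂ] H := ContinuousLinearMap.adjoint T ∘L A + K with hS
  have hinner : ∀ u, e * inner ℂ u (S u)
      = e * inner ℂ (T u) (A u) + ((C * ‖G u‖ ^ 2 : ℝ) : ℂ) := by
    intro u
    simp only [hS, hK, add_apply, ContinuousLinearMap.comp_apply,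
      smul_apply, inner_add_right, inner_smul_right,
      ContinuousLinearMap.adjoint_inner_right, inner_self_eq_norm_sq_to_K]
    push_cast
    simp only [Complex.coe_algebraMap]
    field_simp
  have hbound : ∀ u, c / ‖e‖ * ‖u‖ ^ 2 ≤ ‖inner ℂ u (S u)‖ := by
    intro u
    have h1 : c * ‖u‖ ^ 2 ≤ ‖e * inner ℂ u (S u)‖ := by
      refine le_trans ?_ (Complex.re_le_norm _)
      rw [hinner, Complex.add_re, Complex.ofReal_re]
      linarith [h u]
    rw [norm_mul] at h1
    rw [div_mul_eq_mul_div, div_le_iff₀ (norm_pos_iff.2 he)]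
    linarith
  have hc' : 0 < c / ‖e‖ := div_pos hc (norm_pos_iff.2 he)
  constructor
  · refine ⟨(ContinuousLinearMap.isUnit_iff_bijective).1 hT, K, ?_, c / ‖e‖, hc', hbound⟩
    have : IsCompactOperator (ContinuousLinearMap.adjoint G) :=
      isCompactOperator_of_locallyCompactSpace_rng _
    exact (this.comp_clm G).smul _
  · have hSu : IsUnit S := by
      refine ContinuousLinearMap.isUnit_of_forall_le_norm_inner_map S (c := ⟨_, hc'.le⟩) hc' fun u => ?_
      rw [norm_inner_symm, mul_comm]
      exact hbound u
    have hTa : IsUnit (ContinuousLinearMap.adjoint T) := by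
      simpa [ContinuousLinearMap.star_eq_adjoint] using hT.star
    obtain ⟨S', hS'⟩ := hSu
    obtain ⟨T', hT'⟩ := hTa
    have hfin : FiniteDimensional ℂ
        (LinearMap.range (((↑S'⁻¹ : H →L[ℂ] H) * K : H →L[ℂ] H) : H →ₗ[ℂ] H)) := by
      have hG : (G : H →ₗ[ℂ] E).HasNoetherianRange :=
        LinearMap.HasNoetherianRange.of_isNoetherian_rng
      have h2 := ((hG.comp_left ((ContinuousLinearMap.adjoint G : E →L[ℂ] H) : E →ₗ[ℂ] H)).smul
        ((C : ℂ) / e)).comp_left ((↑S'⁻¹ : H →L[ℂ] H) : H →ₗ[ℂ] H)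
      exact @Module.IsNoetherian.finite ℂ _ _ _ _ h2
    have hA : A = ((↑T'⁻¹ : H →L[ℂ] H) * S) * (1 - (↑S'⁻¹ : H →L[ℂ] H) * K) := by
      have h3 : S = ↑T' * A + K := by rw [hS, hT']; rfl
      rw [mul_sub, mul_one, mul_assoc, ← mul_assoc S, ← hS', Units.mul_inv, one_mul, hS', h3,
        mul_add, ← mul_assoc, Units.inv_mul, one_mul, add_sub_cancel_right]
    rw [hA]
    exact isFredholmIndexZero_mul_one_sub _ _ ((Units.isUnit _).mul (hS' ▸ S'.isUnit))

end Fredholm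

/-! ### Multiplication operators on `L²` -/

section MultiplicationOperators

variable {X : Type*} [MeasurableSpace X] {μ : Measure X}
  {E F : Type*} [NormedAddCommGroup E] [NormedAddCommGroup F]

theorem norm_sq_eq_integral (u : Lp E 2 μ) : ‖u‖ ^ 2 = ∫ x, ‖u x‖ ^ 2 ∂μ := by
  have h := (Lp.memLp u).eLpNorm_eq_integral_rpow_norm (by norm_num) (by norm_num)
  rw [Lp.norm_def, h, ENNReal.toReal_ofReal (by positivity)]
  simp only [ENNReal.toReal_ofNat, Real.rpow_ofNat]
  rw [← Real.rpow_natCast, ← Real.rpow_mul (integral_nonneg fun _ => by positivity)]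
  norm_num

theorem enorm_sq_eq_lintegral (u : Lp E 2 μ) : ‖u‖ₑ ^ 2 = ∫⁻ x, ‖u x‖ₑ ^ 2 ∂μ := by
  rw [Lp.enorm_def, eLpNorm_eq_lintegral_rpow_enorm_toReal (by norm_num) (by norm_num)]
  simp only [ENNReal.toReal_ofNat, ENNReal.rpow_ofNat]
  rw [← ENNReal.rpow_natCast, ← ENNReal.rpow_mul]
  norm_num

variable [NormedSpace ℂ E] [NormedSpace ℂ F]

theorem memLp_clm_apply {Φ : X → E →L[ℂ] F} (hΦ : AEStronglyMeasurable Φ μ) {C : ℝ}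
    (hC : ∀ x, ‖Φ x‖ ≤ C) {u : X → E} (hu : MemLp u 2 μ) : MemLp (fun x => Φ x (u x)) 2 μ := by
  refine MemLp.of_le_mul (c := C) hu ?_ (Eventually.of_forall fun x => ?_)
  · exact isBoundedBilinearMap_apply.continuous.comp_aestronglyMeasurable
      (hΦ.prodMk hu.aestronglyMeasurable)
  · exact ((Φ x).le_opNorm _).trans (mul_le_mul_of_nonneg_right (hC x) (norm_nonneg _))

/-- The operator `u ↦ Φ u` on `L²`, for a bounded measurable operator-valued function `Φ`. -/
def mulLp (Φ : X → E →L[ℂ] F) (hΦ : AEStronglyMeasurable Φ μ) (C : ℝ) (hC : ∀ x, ‖Φ x‖ ≤ C) :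
    Lp E 2 μ →L[ℂ] Lp F 2 μ :=
  LinearMap.mkContinuous
    { toFun := fun u => (memLp_clm_apply hΦ hC (Lp.memLp u)).toLp _
      map_add' := fun u v => by
        refine Lp.ext ?_
        filter_upwards [(memLp_clm_apply hΦ hC (Lp.memLp (u + v))).coeFn_toLp,
          (memLp_clm_apply hΦ hC (Lp.memLp u)).coeFn_toLp,
          (memLp_clm_apply hΦ hC (Lp.memLp v)).coeFn_toLp, Lp.coeFn_add u v,
          Lp.coeFn_add ((memLp_clm_apply hΦ hC (Lp.memLp u)).toLp _)
            ((memLp_clm_apply hΦ hC (Lp.memLp v)).toLp _)] with x h1 h2 h3 h4 h5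
        rw [h1, h5, Pi.add_apply, h2, h3, h4, Pi.add_apply, map_add]
      map_smul' := fun c u => by
        refine Lp.ext ?_
        filter_upwards [(memLp_clm_apply hΦ hC (Lp.memLp (c • u))).coeFn_toLp,
          (memLp_clm_apply hΦ hC (Lp.memLp u)).coeFn_toLp, Lp.coeFn_smul c u,
          Lp.coeFn_smul c ((memLp_clm_apply hΦ hC (Lp.memLp u)).toLp _)] with x h1 h2 h4 h5
        rw [h1, RingHom.id_apply, h5, Pi.smul_apply, h2, h4, Pi.smul_apply, map_smul] }
    C (fun u => Lp.norm_le_mul_norm_of_ae_le_mul (by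
      filter_upwards [(memLp_clm_apply hΦ hC (Lp.memLp u)).coeFn_toLp] with x h1
      rw [LinearMap.coe_mk, AddHom.coe_mk, h1]
      exact ((Φ x).le_opNorm _).trans (mul_le_mul_of_nonneg_right (hC x) (norm_nonneg _))))

theorem coeFn_mulLp (Φ : X → E →L[ℂ] F) (hΦ : AEStronglyMeasurable Φ μ) (C : ℝ)
    (hC : ∀ x, ‖Φ x‖ ≤ C) (u : Lp E 2 μ) : mulLp Φ hΦ C hC u =ᵐ[μ] fun x => Φ x (u x) :=
  (memLp_clm_apply hΦ hC (Lp.memLp u)).coeFn_toLp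

/-- The Cauchy–Schwarz inequality against the constant function `1`. -/
theorem sq_lintegral_le (f : X → ENNReal) (hf : AEMeasurable f μ) :
    (∫⁻ x, f x ∂μ) ^ 2 ≤ μ Set.univ * ∫⁻ x, f x ^ 2 ∂μ := by
  have h := ENNReal.lintegral_mul_le_Lp_mul_Lq μ Real.HolderConjugate.two_two hf
    (aemeasurable_const (b := (1 : ENNReal)))
  simp only [Pi.mul_apply, mul_one, ENNReal.rpow_ofNat, one_pow, lintegral_const, one_mul] at h
  refine (pow_le_pow_left' h 2).trans_eq ?_
  rw [mul_pow, ← ENNReal.rpow_natCast, ← ENNReal.rpow_mul, ← ENNReal.rpow_natCast,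
    ← ENNReal.rpow_mul]
  norm_num [mul_comm]

end MultiplicationOperators

variable {Ω : Set R3}

/-- The operator `(u, g) ↦ (b u, S g + N u)` on `L² × L²`. -/
def diagOp (b : Lp ℂ 2 (volume.restrict Ω) →L[ℂ] Lp ℂ 2 (volume.restrict Ω))
    (S : Lp C3 2 (volume.restrict Ω) →L[ℂ] Lp C3 2 (volume.restrict Ω))
    (N : Lp ℂ 2 (volume.restrict Ω) →L[ℂ] Lp C3 2 (volume.restrict Ω)) : L2Pair Ω →L[ℂ] L2Pair Ω :=
  (WithLp.prodContinuousLinearEquiv 2 ℂ _ _).symm.toContinuousLinearMap ∘L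
    ((b ∘L WithLp.fstL 2 ℂ _ _).prod (S ∘L WithLp.sndL 2 ℂ _ _ + N ∘L WithLp.fstL 2 ℂ _ _))

/-! ### A finite-rank form of the Rellich compactness theorem -/

section Rellich

variable {Ω : Set R3}

theorem norm_fderiv_apply_le (φ : R3 → ℂ) (x t : R3) :
    ‖fderiv ℝ φ x t‖ ≤ ‖t‖ * ‖grad φ x‖ := by
  set T : C3 := WithLp.toLp 2 fun i => ((t i : ℝ) : ℂ) with hT
  have h1 : fderiv ℝ φ x t = inner ℂ T (grad φ x) := by
    have ht : t = ∑ i, t i • EuclideanSpace.single i (1 : ℝ) := by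
      ext j
      simp [Fin.sum_univ_three]
      fin_cases j <;> simp
    conv_lhs => rw [ht]
    simp [hT, grad, PiLp.inner_apply, mul_comm]
  have h2 : ‖T‖ = ‖t‖ := by
    simp [hT, EuclideanSpace.norm_eq]
  rw [h1, ← h2]
  exact norm_inner_le_norm _ _

theorem IsTestFunction.enorm_sub_sq_le {φ : R3 → ℂ} (h : IsTestFunction Ω φ) (x t : R3) :
    ‖φ (x + t) - φ x‖ₑ ^ 2 ≤
      ‖t‖ₑ ^ 2 * ∫⁻ s in Set.Ioc (0 : ℝ) 1, ‖grad φ (x + s • t)‖ₑ ^ 2 := by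
  have hd : ∀ s : ℝ, HasDerivAt (fun s : ℝ => φ (x + s • t)) (fderiv ℝ φ (x + s • t) t) s := by
    intro s
    have h1 : HasDerivAt (fun s : ℝ => x + s • t) t s := by
      simpa using ((hasDerivAt_id s).smul_const t).const_add x
    exact ((h.smooth.differentiable (by simp)) _).hasFDerivAt.comp_hasDerivAt s h1
  have hc : Continuous fun s : ℝ => fderiv ℝ φ (x + s • t) t := by
    have h1 : Continuous (fderiv ℝ φ) := h.smooth.continuous_fderiv (by simp)
    fun_prop
  have hg : Continuous fun s : ℝ => grad φ (x + s • t) := by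
    have h1 := h.continuous_grad
    fun_prop
  have hftc := intervalIntegral.integral_eq_sub_of_hasDerivAt (a := 0) (b := 1)
    (fun s _ => hd s) (hc.intervalIntegrable 0 1)
  simp only [one_smul, zero_smul, add_zero] at hftc
  rw [← hftc, intervalIntegral.integral_of_le zero_le_one]
  calc ‖∫ s in Set.Ioc (0 : ℝ) 1, fderiv ℝ φ (x + s • t) t‖ₑ ^ 2
      ≤ (∫⁻ s in Set.Ioc (0 : ℝ) 1, ‖t‖ₑ * ‖grad φ (x + s • t)‖ₑ) ^ 2 := by
        refine pow_le_pow_left' ((enorm_integral_le_lintegral_enorm _).trans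
          (lintegral_mono fun s => ?_)) 2
        rw [← ofReal_norm, ← ofReal_norm, ← ofReal_norm, ← ENNReal.ofReal_mul (norm_nonneg _)]
        exact ENNReal.ofReal_le_ofReal (norm_fderiv_apply_le _ _ _)
    _ ≤ _ := by
        refine (sq_lintegral_le _ (hg.enorm.measurable.const_mul _).aemeasurable).trans_eq ?_
        simp only [mul_pow]
        rw [lintegral_const_mul _ (hg.enorm.measurable.pow_const 2)]
        simp

/-- Translations are continuous in `L²` with modulus `|t| ‖∇φ‖`. -/
theorem IsTestFunction.lintegral_enorm_sub_sq_le {φ : R3 → ℂ} (h : IsTestFunction Ω φ) (t : R3) :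
    ∫⁻ x, ‖φ (x + t) - φ x‖ₑ ^ 2 ≤ ‖t‖ₑ ^ 2 * ∫⁻ x, ‖grad φ x‖ₑ ^ 2 := by
  have hg := h.continuous_grad
  calc ∫⁻ x, ‖φ (x + t) - φ x‖ₑ ^ 2
      ≤ ∫⁻ x, ‖t‖ₑ ^ 2 * ∫⁻ s in Set.Ioc (0 : ℝ) 1, ‖grad φ (x + s • t)‖ₑ ^ 2 :=
        lintegral_mono fun x => h.enorm_sub_sq_le x t
    _ = ‖t‖ₑ ^ 2 * ∫⁻ s in Set.Ioc (0 : ℝ) 1, ∫⁻ x, ‖grad φ (x + s • t)‖ₑ ^ 2 := by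
        rw [lintegral_const_mul' _ _ (by finiteness), lintegral_lintegral_swap]
        exact Continuous.aemeasurable (by fun_prop)
    _ = _ := by
        simp [lintegral_add_right_eq_self (fun x => ‖grad φ x‖ₑ ^ 2)]

/-- The mean oscillation of a continuous function over a ball, bounded by its translations. -/
theorem enorm_sub_average_sq_le {φ : R3 → ℂ} (hφ : Continuous φ) (hi : Integrable φ) {δ : ℝ}
    (hδ : 0 < δ) {c x : R3} (hx : x ∈ Metric.ball c δ) :
    ‖φ x - ⨍ s in Metric.ball c δ, φ s‖ₑ ^ 2 ≤ (volume (Metric.ball (0 : R3) δ))⁻¹ *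
      ∫⁻ t in Metric.ball (0 : R3) (2 * δ), ‖φ (x + t) - φ x‖ₑ ^ 2 := by
  have hv0 : volume (Metric.ball c δ) ≠ 0 := (Metric.measure_ball_pos _ _ hδ).ne'
  have hvt : volume (Metric.ball c δ) ≠ ⊤ := measure_ball_lt_top.ne
  set ν : Measure R3 := (volume (Metric.ball c δ))⁻¹ • volume.restrict (Metric.ball c δ) with hν
  have hν1 : ν Set.univ = 1 := by
    rw [hν, Measure.smul_apply, Measure.restrict_apply_univ, smul_eq_mul,
      ENNReal.inv_mul_cancel hv0 hvt]
  have : IsProbabilityMeasure ν := ⟨hν1⟩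
  have hint : Integrable φ ν := hi.restrict.smul_measure (ENNReal.inv_ne_top.2 hv0)
  have havg : φ x - ⨍ s in Metric.ball c δ, φ s = ∫ s, (φ x - φ s) ∂ν := by
    rw [integral_sub (integrable_const _) hint, integral_const]
    rw [Measure.real, hν1, ENNReal.toReal_one, one_smul, average, Measure.restrict_apply_univ]
  rw [havg]
  calc ‖∫ s, (φ x - φ s) ∂ν‖ₑ ^ 2
      ≤ (∫⁻ s, ‖φ x - φ s‖ₑ ∂ν) ^ 2 :=
        pow_le_pow_left' (enorm_integral_le_lintegral_enorm _) 2
    _ ≤ ∫⁻ s, ‖φ x - φ s‖ₑ ^ 2 ∂ν := by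
        have := sq_lintegral_le (μ := ν) (fun s => ‖φ x - φ s‖ₑ)
          (Continuous.measurable (by fun_prop)).aemeasurable
        rwa [hν1, one_mul] at this
    _ = (volume (Metric.ball (0 : R3) δ))⁻¹ * ∫⁻ s in Metric.ball c δ, ‖φ x - φ s‖ₑ ^ 2 := by
        rw [hν, lintegral_smul_measure, Measure.addHaar_ball_center, smul_eq_mul]
    _ ≤ (volume (Metric.ball (0 : R3) δ))⁻¹ *
          ∫⁻ s in Metric.ball x (2 * δ), ‖φ x - φ s‖ₑ ^ 2 := by
        gcongr
        intro s hs
        rw [Metric.mem_ball] at *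
        calc dist s x ≤ dist s c + dist x c := dist_triangle_right _ _ _
          _ < 2 * δ := by linarith
    _ = _ := by
        congr 1
        rw [← lintegral_indicator Metric.isOpen_ball.measurableSet,
          ← lintegral_indicator Metric.isOpen_ball.measurableSet,
          ← lintegral_add_left_eq_self _ x]
        refine lintegral_congr fun t => ?_
        simp only [Set.indicator, Metric.mem_ball, dist_self_add_left, dist_zero_right]
        rw [← enorm_neg, neg_sub]

/-- A function with gradient in `L²` is, on a ball, determined up to a small multiple of its gradient
by finitely many of its local averages. -/
theorem exists_averages_control (R : ℝ) {δ : ℝ} (hδ : 0 < δ) :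
    ∃ (N : ℕ) (z : Fin N → R3) (w : Fin N → NNReal), ∀ φ : R3 → ℂ, IsTestFunction Ω φ →
      ∫⁻ x in Metric.ball (0 : R3) R, ‖φ x‖ₑ ^ 2 ≤
        ENNReal.ofReal (64 * δ ^ 2) * (∫⁻ x, ‖grad φ x‖ₑ ^ 2) +
          ∑ j, w j * ‖∫ s in Metric.ball (z j) δ, φ s‖ₑ ^ 2 := by
  obtain ⟨t, -, htf, ht⟩ := (isCompact_closedBall (0 : R3) R).finite_cover_balls hδ
  obtain ⟨N, z, -, hz⟩ := htf.fin_param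
  set E : Fin N → Set R3 := disjointed fun j => Metric.ball (z j) δ with hE
  have hEm : ∀ j, MeasurableSet (E j) := fun j =>
    disjointedRec (fun _ _ h => h.diff Metric.isOpen_ball.measurableSet)
      Metric.isOpen_ball.measurableSet
  have hEs : ∀ j, E j ⊆ Metric.ball (z j) δ := fun j => disjointed_subset _ j
  have hEd : Pairwise (Function.onFun Disjoint E) := disjoint_disjointed _
  have hEu : Metric.ball (0 : R3) R ⊆ ⋃ j, E j := by
    rw [hE, iUnion_disjointed]
    intro x hx
    have := ht (Metric.ball_subset_closedBall hx)
    rw [← hz] at this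
    simpa [Set.mem_iUnion] using this
  set v := volume (Metric.ball (0 : R3) δ) with hv
  have hv0 : v ≠ 0 := (Metric.measure_ball_pos _ _ hδ).ne'
  have hvt : v ≠ ⊤ := measure_ball_lt_top.ne
  have hEt : ∀ j, volume (E j) ≠ ⊤ := fun j =>
    ((measure_mono (hEs j)).trans_lt measure_ball_lt_top).ne
  refine ⟨N, z, fun j => (2 * volume (E j) * (v⁻¹) ^ 2).toNNReal, fun φ hφ => ?_⟩
  have hc := hφ.smooth.continuous
  have hi : Integrable φ := hc.integrable_of_hasCompactSupport hφ.compact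
  set Hf : R3 → ENNReal := fun x =>
    v⁻¹ * ∫⁻ t in Metric.ball (0 : R3) (2 * δ), ‖φ (x + t) - φ x‖ₑ ^ 2 with hHf
  have hm : Measurable fun p : R3 × R3 => ‖φ (p.1 + p.2) - φ p.1‖ₑ ^ 2 :=
    Measurable.pow_const (Continuous.measurable (by fun_prop)) 2
  have hHm : Measurable Hf := (hm.lintegral_prod_right').const_mul _
  have hHi : ∫⁻ x, Hf x ≤ ENNReal.ofReal (32 * δ ^ 2) * ∫⁻ x, ‖grad φ x‖ₑ ^ 2 := by
    simp only [hHf]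
    rw [lintegral_const_mul _ hm.lintegral_prod_right',
      lintegral_lintegral_swap (f := fun x t => ‖φ (x + t) - φ x‖ₑ ^ 2) hm.aemeasurable]
    calc v⁻¹ * ∫⁻ t in Metric.ball (0 : R3) (2 * δ), ∫⁻ x, ‖φ (x + t) - φ x‖ₑ ^ 2
        ≤ v⁻¹ * ∫⁻ t in Metric.ball (0 : R3) (2 * δ),
            ENNReal.ofReal (4 * δ ^ 2) * ∫⁻ x, ‖grad φ x‖ₑ ^ 2 := by
          gcongr 1
          refine setLIntegral_mono' Metric.isOpen_ball.measurableSet fun t ht => ?_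
          refine (hφ.lintegral_enorm_sub_sq_le t).trans ?_
          gcongr
          rw [← ofReal_norm, ← ENNReal.ofReal_pow (norm_nonneg _)]
          refine ENNReal.ofReal_le_ofReal ?_
          rw [mem_ball_zero_iff] at ht
          nlinarith [norm_nonneg t]
      _ = _ := by
          rw [setLIntegral_const, Measure.addHaar_ball_mul _ _ (by norm_num : (0:ℝ) ≤ 2), ← hv]
          rw [show Module.finrank ℝ R3 = 3 by simp]
          rw [show (32 * δ ^ 2) = 2 ^ 3 * (4 * δ ^ 2) by ring,
            ENNReal.ofReal_mul (p := 2 ^ 3) (q := 4 * δ ^ 2) (by norm_num)]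
          rw [mul_comm (ENNReal.ofReal (2 ^ 3)) v]
          rw [show v⁻¹ * (ENNReal.ofReal (4 * δ ^ 2) * (∫⁻ x, ‖grad φ x‖ₑ ^ 2) *
              (v * ENNReal.ofReal (2 ^ 3))) = (v⁻¹ * v) * (ENNReal.ofReal (2 ^ 3) *
              ENNReal.ofReal (4 * δ ^ 2) * (∫⁻ x, ‖grad φ x‖ₑ ^ 2)) by ring,
            ENNReal.inv_mul_cancel hv0 hvt, one_mul]
  set A : Fin N → ℂ := fun j => ⨍ s in Metric.ball (z j) δ, φ s with hA
  calc ∫⁻ x in Metric.ball (0 : R3) R, ‖φ x‖ₑ ^ 2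
      ≤ ∫⁻ x in ⋃ j, E j, ‖φ x‖ₑ ^ 2 := lintegral_mono_set hEu
    _ = ∑ j, ∫⁻ x in E j, ‖φ x‖ₑ ^ 2 := by
        rw [lintegral_iUnion hEm hEd, tsum_fintype]
    _ ≤ ∑ j, ∫⁻ x in E j, (2 * Hf x + 2 * ‖A j‖ₑ ^ 2) := by
        refine Finset.sum_le_sum fun j _ => setLIntegral_mono' (hEm j) fun x hx => ?_
        have h1 := enorm_sub_average_sq_le hc hi hδ (hEs j hx)
        have h2 : ‖φ x‖ₑ ^ 2 ≤ 2 * ‖φ x - A j‖ₑ ^ 2 + 2 * ‖A j‖ₑ ^ 2 := by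
          have h3 : ‖φ x‖ ^ 2 ≤ 2 * ‖φ x - A j‖ ^ 2 + 2 * ‖A j‖ ^ 2 := by
            have h4 : ‖φ x‖ ≤ ‖φ x - A j‖ + ‖A j‖ := by
              simpa using norm_add_le (φ x - A j) (A j)
            nlinarith [norm_nonneg (φ x), sq_nonneg (‖φ x - A j‖ - ‖A j‖)]
          have h5 := ENNReal.ofReal_le_ofReal h3
          rwa [ENNReal.ofReal_add (by positivity) (by positivity),
            ENNReal.ofReal_mul (by norm_num), ENNReal.ofReal_mul (by norm_num),
            ENNReal.ofReal_pow (norm_nonneg _), ENNReal.ofReal_pow (norm_nonneg _),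
            ENNReal.ofReal_pow (norm_nonneg _), ofReal_norm, ofReal_norm, ofReal_norm,
            ENNReal.ofReal_ofNat] at h5
        refine h2.trans ?_
        gcongr
    _ = 2 * (∑ j, ∫⁻ x in E j, Hf x) + ∑ j, 2 * volume (E j) * ‖A j‖ₑ ^ 2 := by
        rw [Finset.mul_sum, ← Finset.sum_add_distrib]
        refine Finset.sum_congr rfl fun j _ => ?_
        rw [lintegral_add_left (hHm.const_mul _), lintegral_const_mul _ hHm, setLIntegral_const]
        ring
    _ ≤ _ := by
        gcongr ?_ + ?_
        · rw [← tsum_fintype (L := .unconditional _) (fun j => ∫⁻ x in E j, Hf x), ← lintegral_iUnion hEm hEd]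
          calc 2 * ∫⁻ x in ⋃ j, E j, Hf x ≤ 2 * ∫⁻ x, Hf x := by
                exact mul_le_mul_right (setLIntegral_le_lintegral _ _) _
            _ ≤ 2 * (ENNReal.ofReal (32 * δ ^ 2) * ∫⁻ x, ‖grad φ x‖ₑ ^ 2) := by gcongr
            _ = _ := by
                rw [show 64 * δ ^ 2 = 2 * (32 * δ ^ 2) by ring,
                  ENNReal.ofReal_mul (by norm_num : (0:ℝ) ≤ 2), ENNReal.ofReal_ofNat, mul_assoc]
        · refine Finset.sum_le_sum fun j _ => le_of_eq ?_
          rw [ENNReal.coe_toNNReal (ENNReal.mul_ne_top (ENNReal.mul_ne_top (by simp) (hEt j))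
            (ENNReal.pow_ne_top (ENNReal.inv_ne_top.2 hv0)))]
          simp only [hA]
          rw [setAverage_eq, enorm_smul, mul_pow, mul_assoc (2 * volume (E j))]
          congr 3
          rw [Real.enorm_of_nonneg (by positivity), Measure.real, Measure.addHaar_ball_center,
            ENNReal.ofReal_inv_of_pos (ENNReal.toReal_pos hv0 hvt), ENNReal.ofReal_toReal hvt]

theorem IsTestFunction.grad_eq_zero {φ : R3 → ℂ} (h : IsTestFunction Ω φ) {x : R3} (hx : x ∉ Ω) :
    grad φ x = 0 := by
  have h1 : fderiv ℝ φ x = 0 :=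
    image_eq_zero_of_notMem_tsupport fun hx' => hx (h.support (tsupport_fderiv_subset ℝ hx'))
  ext i
  simp [grad, h1]

theorem IsTestFunction.eq_zero {φ : R3 → ℂ} (h : IsTestFunction Ω φ) {x : R3} (hx : x ∉ Ω) :
    φ x = 0 :=
  image_eq_zero_of_notMem_tsupport fun hx' => hx (h.support hx')

/-- The `L²` norm over a ball is controlled on `H¹₀(Ω)` by a small multiple of the `H¹` norm and a
map of finite rank: a quantitative form of the compactness of `H¹₀(Ω) → L²(Ω ∩ B_R)`. -/
theorem exists_finiteRank_control (hΩ : MeasurableSet Ω) (R : ℝ) {ε : ℝ} (hε : 0 < ε) :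
    ∃ (N : ℕ) (G : Lp ℂ 2 (volume.restrict Ω) →L[ℂ] EuclideanSpace ℂ (Fin N)), ∀ u : H10 Ω,
      ∫ x in Ω, (Metric.ball (0 : R3) R).indicator (fun x => ‖valFn u x‖ ^ 2) x ≤
        ε * ‖u‖ ^ 2 + ‖G (u : L2Pair Ω).fst‖ ^ 2 := by
  obtain ⟨δ, hδ, hδε⟩ : ∃ δ : ℝ, 0 < δ ∧ 64 * δ ^ 2 = ε :=
    ⟨Real.sqrt (ε / 64), by positivity, by rw [Real.sq_sqrt (by positivity)]; ring⟩
  obtain ⟨N, z, w, hw⟩ := exists_averages_control (Ω := Ω) R hδ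
  have hb : MeasurableSet (Metric.ball (0 : R3) R) := Metric.isOpen_ball.measurableSet
  have hbj : ∀ j, MeasurableSet (Metric.ball (z j) δ) := fun j => Metric.isOpen_ball.measurableSet
  have hfin : ∀ j, (volume.restrict Ω) (Metric.ball (z j) δ) ≠ ⊤ := fun j =>
    ((Measure.restrict_le_self _).trans_lt measure_ball_lt_top).ne
  set Φ : R3 → ℂ →L[ℂ] ℂ := (Metric.ball (0 : R3) R).indicator fun _ => ContinuousLinearMap.id ℂ ℂ
    with hΦ
  have hΦm : AEStronglyMeasurable Φ (volume.restrict Ω) :=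
    (stronglyMeasurable_const.indicator hb).aestronglyMeasurable
  have hΦ1 : ∀ x, ‖Φ x‖ ≤ 1 := fun x =>
    (norm_indicator_le_norm_self _ _).trans ContinuousLinearMap.norm_id_le
  set P := mulLp Φ hΦm 1 hΦ1 with hP
  have hΦa : ∀ x c, Φ x c = (Metric.ball (0 : R3) R).indicator (fun _ => c) x := by
    intro x c
    by_cases hx : x ∈ Metric.ball (0 : R3) R
    · rw [hΦ, Set.indicator_of_mem hx, Set.indicator_of_mem hx]; rfl
    · rw [hΦ, Set.indicator_of_notMem hx, Set.indicator_of_notMem hx]; rfl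
  set G : Lp ℂ 2 (volume.restrict Ω) →L[ℂ] EuclideanSpace ℂ (Fin N) :=
    (EuclideanSpace.equiv (Fin N) ℂ).symm.toContinuousLinearMap ∘L
      ContinuousLinearMap.pi fun j => ((Real.sqrt (w j) : ℝ) : ℂ) •
        innerSL ℂ (indicatorConstLp 2 (hbj j) (hfin j) (1 : ℂ)) with hG
  have hGn : ∀ v, ‖G v‖ ^ 2 =
      ∑ j, (w j : ℝ) * ‖∫ s in Metric.ball (z j) δ, v s ∂(volume.restrict Ω)‖ ^ 2 := by
    intro v
    rw [EuclideanSpace.norm_sq_eq]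
    refine Finset.sum_congr rfl fun j _ => ?_
    have : (G v) j = ((Real.sqrt (w j) : ℝ) : ℂ) *
        inner ℂ (indicatorConstLp 2 (hbj j) (hfin j) (1 : ℂ)) v := rfl
    rw [this, L2.inner_indicatorConstLp_one, norm_mul, mul_pow, Complex.norm_real, Real.norm_eq_abs,
      sq_abs, Real.sq_sqrt (NNReal.coe_nonneg _)]
  have hcl : IsClosed {p : L2Pair Ω | ‖P p.fst‖ ^ 2 ≤ ε * ‖p.snd‖ ^ 2 + ‖G p.fst‖ ^ 2} := by
    have h1 : Continuous fun p : L2Pair Ω => p.fst := (WithLp.fstL 2 ℂ _ _).continuous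
    have h2 : Continuous fun p : L2Pair Ω => p.snd := (WithLp.sndL 2 ℂ _ _).continuous
    exact isClosed_le (by fun_prop) (by fun_prop)
  have hsub : (testPairs Ω : Set (L2Pair Ω)) ⊆
      {p : L2Pair Ω | ‖P p.fst‖ ^ 2 ≤ ε * ‖p.snd‖ ^ 2 + ‖G p.fst‖ ^ 2} := by
    rintro p ⟨φ, hφ, h1, h2⟩
    have hj : ∀ j, ∫ s in Metric.ball (z j) δ, p.fst s ∂(volume.restrict Ω)
        = ∫ s in Metric.ball (z j) δ, φ s := by
      intro j
      rw [integral_congr_ae (ae_restrict_of_ae h1), Measure.restrict_restrict (hbj j),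
        Set.inter_comm, ← Measure.restrict_restrict hΩ]
      exact setIntegral_eq_integral_of_forall_compl_eq_zero fun x hx => hφ.eq_zero hx
    have hsnd : ∫⁻ x, ‖grad φ x‖ₑ ^ 2 = ‖p.snd‖ₑ ^ 2 := by
      have h3 : ∫⁻ x in Ω, ‖p.snd x‖ₑ ^ 2 = ∫⁻ x in Ω, ‖grad φ x‖ₑ ^ 2 :=
        lintegral_congr_ae (h2.mono fun x hx => by simp only [hx])
      rw [enorm_sq_eq_lintegral, h3]
      refine (setLIntegral_eq_of_support_subset fun x hx => ?_).symm
      by_contra hxΩ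
      exact hx (by simp [hφ.grad_eq_zero hxΩ])
    have hfst : ‖P p.fst‖ₑ ^ 2 ≤ ∫⁻ x in Metric.ball (0 : R3) R, ‖φ x‖ₑ ^ 2 := by
      rw [enorm_sq_eq_lintegral, ← lintegral_indicator hb]
      refine le_trans (lintegral_mono_ae ?_) (lintegral_mono' Measure.restrict_le_self le_rfl)
      filter_upwards [coeFn_mulLp Φ hΦm 1 hΦ1 p.fst, h1] with x h3 h4
      rw [h3, hΦa, h4]
      by_cases hx : x ∈ Metric.ball (0 : R3) R
      · simp only [Set.indicator_of_mem hx, le_refl]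
      · simp [Set.indicator_of_notMem hx]
    have h5 := hfst.trans (hw φ hφ)
    rw [hsnd, hδε] at h5
    have h6 : ENNReal.ofReal (‖P p.fst‖ ^ 2) ≤
        ENNReal.ofReal (ε * ‖p.snd‖ ^ 2 + ‖G p.fst‖ ^ 2) := by
      rw [ENNReal.ofReal_add (by positivity) (by positivity), ENNReal.ofReal_mul hε.le, hGn,
        ENNReal.ofReal_sum_of_nonneg fun _ _ => by positivity]
      simp only [ENNReal.ofReal_pow (norm_nonneg _), ofReal_norm,
        ENNReal.ofReal_mul (NNReal.coe_nonneg _), ENNReal.ofReal_coe_nnreal, hj]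
      exact h5
    exact (ENNReal.ofReal_le_ofReal_iff (by positivity)).1 h6
  refine ⟨N, G, fun u => ?_⟩
  have hu : ‖P (u : L2Pair Ω).fst‖ ^ 2 ≤
      ε * ‖(u : L2Pair Ω).snd‖ ^ 2 + ‖G (u : L2Pair Ω).fst‖ ^ 2 := closure_minimal hsub hcl u.2
  have h7 : ‖P (u : L2Pair Ω).fst‖ ^ 2 =
      ∫ x in Ω, (Metric.ball (0 : R3) R).indicator (fun x => ‖valFn u x‖ ^ 2) x := by
    rw [norm_sq_eq_integral]
    refine integral_congr_ae ?_
    filter_upwards [coeFn_mulLp Φ hΦm 1 hΦ1 (u : L2Pair Ω).fst] with x h3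
    rw [h3, hΦa]
    by_cases hx : x ∈ Metric.ball (0 : R3) R
    · simp only [Set.indicator_of_mem hx, valFn]
    · simp [Set.indicator_of_notMem hx]
  have h8 : ‖u‖ ^ 2 = ‖(u : L2Pair Ω).fst‖ ^ 2 + ‖(u : L2Pair Ω).snd‖ ^ 2 :=
    WithLp.prod_norm_sq_eq_of_L2 (u : L2Pair Ω)
  rw [← h7, h8]
  nlinarith [sq_nonneg ‖(u : L2Pair Ω).fst‖]

end Rellich

/-! ### Lipschitz multipliers of `H¹₀` -/

section Mollification

/-- The smooth bump of integral one, supported in the ball of radius `1 / (n + 1)`. -/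
def bump (n : ℕ) : ContDiffBump (0 : R3) where
  rIn := 1 / (2 * (n + 1))
  rOut := 1 / (n + 1)
  rIn_pos := by positivity
  rIn_lt_rOut := by
    refine one_div_lt_one_div_of_lt (by positivity) ?_
    have : (0 : ℝ) < n + 1 := by positivity
    linarith

theorem bump_rOut_tendsto : Tendsto (fun n => (bump n).rOut) atTop (𝓝 0) :=
  tendsto_one_div_add_atTop_nhds_zero_nat

/-- The mollification of `f` at scale `1 / (n + 1)`. -/
def mollify (n : ℕ) (f : R3 → ℂ) (x : R3) : ℂ := ∫ t, (bump n).normed volume t • f (x - t)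

variable {f : R3 → ℂ} {K : NNReal}

theorem contDiff_mollify (hf : Continuous f) (n : ℕ) :
    ContDiff ℝ ((⊤ : ℕ∞) : WithTop ℕ∞) (mollify n f) :=
  (bump n).hasCompactSupport_normed.contDiff_convolution_left (ContinuousLinearMap.lsmul ℝ ℝ)
    (bump n).contDiff_normed hf.locallyIntegrable

theorem integrable_bump_smul (hf : Continuous f) (n : ℕ) (x : R3) :
    Integrable fun t => (bump n).normed volume t • f (x - t) :=
  Continuous.integrable_of_hasCompactSupport
    ((bump n).continuous_normed.smul (hf.comp (continuous_const.sub continuous_id)))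
    (bump n).hasCompactSupport_normed.smul_right

theorem norm_mollify_sub_le_of_affine (hf : Continuous f) (n : ℕ) (c : ℂ) (x y : R3) {η : ℝ}
    (h : ∀ t ∈ Metric.ball (0 : R3) (bump n).rOut, ‖f (y - t) - f (x - t) - c‖ ≤ η) :
    ‖mollify n f y - mollify n f x - c‖ ≤ η := by
  have hc : Integrable fun t => (bump n).normed volume t • c :=
    (bump n).integrable_normed.smul_const c
  have h1 : mollify n f y - mollify n f x - c =
      ∫ t, (bump n).normed volume t • (f (y - t) - f (x - t) - c) := by
    simp only [smul_sub]
    have hyx : Integrable fun t =>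
        (bump n).normed volume t • f (y - t) - (bump n).normed volume t • f (x - t) :=
      (integrable_bump_smul hf n y).sub (integrable_bump_smul hf n x)
    rw [integral_sub hyx hc,
      integral_sub (integrable_bump_smul hf n y) (integrable_bump_smul hf n x),
      ContDiffBump.integral_normed_smul]
    rfl
  rw [h1]
  calc _ ≤ ∫ t, (bump n).normed volume t * η := by
        refine norm_integral_le_of_norm_le ((bump n).integrable_normed.mul_const η)
          (Eventually.of_forall fun t => ?_)
        rw [norm_smul, Real.norm_of_nonneg ((bump n).nonneg_normed t)]
        by_cases ht : t ∈ Metric.ball (0 : R3) (bump n).rOut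
        · exact mul_le_mul_of_nonneg_left (h t ht) ((bump n).nonneg_normed t)
        · rw [← (bump n).support_normed_eq (μ := volume), Function.notMem_support] at ht
          simp [ht]
    _ = η := by rw [integral_mul_const, (bump n).integral_normed, one_mul]

theorem norm_mollify_sub_le (hf : LipschitzWith K f) (n : ℕ) (x : R3) :
    ‖mollify n f x - f x‖ ≤ K * (bump n).rOut := by
  rw [← dist_eq_norm]
  refine (bump n).dist_normed_convolution_le hf.continuous.aestronglyMeasurable fun y hy => ?_
  refine (hf.dist_le_mul y x).trans ?_
  gcongr
  exact (Metric.mem_ball.1 hy).le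

theorem norm_fderiv_mollify_le (hf : LipschitzWith K f) (n : ℕ) (x : R3) :
    ‖fderiv ℝ (mollify n f) x‖ ≤ K := by
  have hd := ((contDiff_mollify hf.continuous n).differentiable (by simp) x).hasFDerivAt
  refine hd.le_of_lip' K.2 (Eventually.of_forall fun y => ?_)
  have := norm_mollify_sub_le_of_affine hf.continuous n 0 x y (η := K * ‖y - x‖) fun t _ => by
    rw [sub_zero, ← dist_eq_norm]
    refine (hf.dist_le_mul _ _).trans_eq ?_
    rw [dist_eq_norm, sub_sub_sub_cancel_right]
  simpa using this

/-- The derivatives of the mollifications converge at the points of strict differentiability. -/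
theorem tendsto_fderiv_mollify (hf : Continuous f) {x : R3} {L : R3 →L[ℝ] ℂ}
    (hL : HasStrictFDerivAt f L x) :
    Tendsto (fun n => fderiv ℝ (mollify n f) x) atTop (𝓝 L) := by
  rw [Metric.tendsto_nhds]
  intro η hη
  have h1 := hL.isLittleO.def (half_pos hη)
  rw [nhds_prod_eq] at h1
  obtain ⟨δ, hδ, hδ'⟩ : ∃ δ > 0, ∀ y ∈ Metric.ball x δ, ∀ z ∈ Metric.ball x δ,
      ‖f y - f z - L (y - z)‖ ≤ η / 2 * ‖y - z‖ := by
    obtain ⟨δ, hδ, h⟩ := Metric.eventually_nhds_iff.1 (nhds_prod_eq (x := x) (y := x) ▸ h1)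
    exact ⟨δ, hδ, fun y hy z hz => h (y := (y, z)) (by
      rw [Prod.dist_eq]; exact max_lt hy hz)⟩
  filter_upwards [bump_rOut_tendsto.eventually_lt_const (half_pos hδ)] with n hn
  rw [dist_eq_norm]
  refine lt_of_le_of_lt ?_ (half_lt_self hη)
  have hd := ((contDiff_mollify hf n).differentiable (by simp) x).hasFDerivAt.sub L.hasFDerivAt
  refine hd.le_of_lip' (half_pos hη).le ?_
  filter_upwards [Metric.ball_mem_nhds x (half_pos hδ)] with y hy
  have := norm_mollify_sub_le_of_affine hf n (L (y - x)) x y (η := η / 2 * ‖y - x‖) fun t ht => by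
    have ht' : ‖t‖ < δ / 2 := (mem_ball_zero_iff.1 ht).trans hn
    have hy' : ‖y - x‖ < δ / 2 := by rwa [← dist_eq_norm]
    have := hδ' (y - t) (by
      rw [Metric.mem_ball, dist_eq_norm, sub_right_comm]
      exact (norm_sub_le _ _).trans_lt (by linarith)) (x - t) (by
      rw [Metric.mem_ball, dist_eq_norm, sub_sub_cancel_left, norm_neg]
      linarith)
    rwa [sub_sub_sub_cancel_right] at this
  have h2 : (mollify n f - ⇑L) y - (mollify n f - ⇑L) x
      = mollify n f y - mollify n f x - L (y - x) := by
    rw [map_sub, Pi.sub_apply, Pi.sub_apply]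
    ring
  rwa [h2]

end Mollification

section Multiplier

variable {Ω : Set R3}

/-- The complex vector `(L e₁, L e₂, L e₃)` that represents a real-linear functional `L`. -/
def vecOf (L : R3 →L[ℝ] ℂ) : C3 := WithLp.toLp 2 fun i => L (EuclideanSpace.single i 1)

theorem grad_eq_vecOf (f : R3 → ℂ) (x : R3) : grad f x = vecOf (fderiv ℝ f x) := rfl

theorem vecOf_sub (L M : R3 →L[ℝ] ℂ) : vecOf (L - M) = vecOf L - vecOf M := by
  ext i; simp [vecOf]

theorem norm_vecOf_le (L : R3 →L[ℝ] ℂ) : ‖vecOf L‖ ≤ 2 * ‖L‖ := by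
  have h : ∀ i, ‖L (EuclideanSpace.single i 1)‖ ≤ ‖L‖ := fun i => by
    simpa using L.le_opNorm (EuclideanSpace.single i (1 : ℝ))
  rw [EuclideanSpace.norm_eq]
  refine Real.sqrt_le_iff.2 ⟨by positivity, ?_⟩
  calc ∑ i, ‖vecOf L i‖ ^ 2 ≤ ∑ _i : Fin 3, ‖L‖ ^ 2 :=
        Finset.sum_le_sum fun i _ => pow_le_pow_left₀ (norm_nonneg _) (h i) 2
    _ ≤ _ := by simp; nlinarith [sq_nonneg ‖L‖]

theorem grad_mul {f g : R3 → ℂ} {x : R3} (hf : DifferentiableAt ℝ f x)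
    (hg : DifferentiableAt ℝ g x) :
    grad (fun x => f x * g x) x = g x • grad f x + f x • grad g x := by
  ext i
  simp [grad, fderiv_fun_mul hf hg]
  ring

theorem IsTestFunction.exists_pair {φ : R3 → ℂ} (h : IsTestFunction Ω φ) :
    ∃ p ∈ testPairs Ω, p.fst =ᵐ[volume.restrict Ω] φ ∧ p.snd =ᵐ[volume.restrict Ω] grad φ := by
  have h1 : MemLp φ 2 (volume.restrict Ω) :=
    (h.smooth.continuous.memLp_of_hasCompactSupport h.compact).restrict Ω
  have h2 : MemLp (grad φ) 2 (volume.restrict Ω) := by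
    refine (h.continuous_grad.memLp_of_hasCompactSupport ?_).restrict Ω
    refine (h.compact.fderiv (𝕜 := ℝ)).comp_left (g := vecOf) ?_
    ext i; simp [vecOf]
  exact ⟨WithLp.toLp 2 (h1.toLp φ, h2.toLp _), ⟨φ, h, h1.coeFn_toLp, h2.coeFn_toLp⟩,
    h1.coeFn_toLp, h2.coeFn_toLp⟩

/-- Dominated convergence in `L²`. -/
theorem tendsto_Lp_of_dominated {X E : Type*} [MeasurableSpace X] {μ : Measure X}
    [NormedAddCommGroup E] {v : ℕ → Lp E 2 μ} {w : Lp E 2 μ} (g : X → ℝ)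
    (hg : Integrable (fun x => g x ^ 2) μ) (hb : ∀ n, ∀ᵐ x ∂μ, ‖v n x - w x‖ ≤ g x)
    (hlim : ∀ᵐ x ∂μ, Tendsto (fun n => v n x) atTop (𝓝 (w x))) :
    Tendsto v atTop (𝓝 w) := by
  rw [tendsto_iff_norm_sub_tendsto_zero]
  have h1 : Tendsto (fun n => ‖v n - w‖ ^ 2) atTop (𝓝 0) := by
    have h2 : ∀ n, ‖v n - w‖ ^ 2 = ∫ x, ‖v n x - w x‖ ^ 2 ∂μ := fun n => by
      rw [norm_sq_eq_integral]
      refine integral_congr_ae ?_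
      filter_upwards [Lp.coeFn_sub (v n) w] with x hx
      rw [hx, Pi.sub_apply]
    simp only [h2]
    rw [← integral_zero X ℝ (μ := μ)]
    refine tendsto_integral_of_dominated_convergence (fun x => g x ^ 2) (fun n => ?_) hg
      (fun n => ?_) ?_
    · exact (((Lp.aestronglyMeasurable (v n)).sub (Lp.aestronglyMeasurable w)).norm).pow 2
    · filter_upwards [hb n] with x hx
      rw [Real.norm_of_nonneg (by positivity)]
      exact pow_le_pow_left₀ (norm_nonneg _) hx 2
    · filter_upwards [hlim] with x hx
      simpa using ((tendsto_iff_norm_sub_tendsto_zero.1 hx).pow 2)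
  simpa using h1.sqrt

theorem measurable_grad (f : R3 → ℂ) : Measurable (grad f) := by
  have h : Measurable fun x => fun i : Fin 3 => fderiv ℝ f x (EuclideanSpace.single i 1) :=
    measurable_pi_lambda _ fun i => measurable_fderiv_apply_const ℝ f _
  exact (PiLp.continuous_toLp 2 _).measurable.comp h

/-- A bounded Lipschitz function that is strictly differentiable almost everywhere. -/
structure IsMultiplier (f : R3 → ℂ) (K : NNReal) (B : ℝ) : Prop where
  lipschitz : LipschitzWith K f
  bound : ∀ x, ‖f x‖ ≤ B
  strict : ∀ᵐ x, HasStrictFDerivAt f (fderiv ℝ f x) x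

namespace IsMultiplier

variable {f : R3 → ℂ} {K : NNReal} {B : ℝ}

theorem norm_grad_le (hf : IsMultiplier f K B) (x : R3) : ‖grad f x‖ ≤ 2 * K :=
  (norm_vecOf_le _).trans (by gcongr; exact norm_fderiv_le_of_lipschitz ℝ hf.lipschitz)

/-- Multiplication by the bounded function `f` on `L²`. -/
def scalarOp {E : Type*} [NormedAddCommGroup E] [NormedSpace ℂ E] (hf : IsMultiplier f K B)
    (μ : Measure R3) : Lp E 2 μ →L[ℂ] Lp E 2 μ :=
  mulLp (fun x => f x • ContinuousLinearMap.id ℂ E)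
    (hf.lipschitz.continuous.smul continuous_const).aestronglyMeasurable B fun x => by
      refine ContinuousLinearMap.opNorm_le_bound _ ((norm_nonneg _).trans (hf.bound x)) fun v => ?_
      rw [smul_apply, ContinuousLinearMap.id_apply, norm_smul]
      exact mul_le_mul_of_nonneg_right (hf.bound x) (norm_nonneg _)

theorem coeFn_scalarOp {E : Type*} [NormedAddCommGroup E] [NormedSpace ℂ E]
    (hf : IsMultiplier f K B) (μ : Measure R3) (u : Lp E 2 μ) :
    hf.scalarOp μ u =ᵐ[μ] fun x => f x • u x :=
  coeFn_mulLp _ _ _ _ u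

/-- The operator `u ↦ u ∇f` on `L²`. -/
def gradOp (hf : IsMultiplier f K B) (μ : Measure R3) : Lp ℂ 2 μ →L[ℂ] Lp C3 2 μ :=
  mulLp (fun x => (ContinuousLinearMap.lsmul ℂ ℂ).flip (grad f x))
    ((ContinuousLinearMap.continuous _).comp_aestronglyMeasurable
      (measurable_grad f).aestronglyMeasurable) (2 * K) fun x => by
      refine ContinuousLinearMap.opNorm_le_bound _ (by positivity) fun v => ?_
      rw [ContinuousLinearMap.flip_apply, ContinuousLinearMap.lsmul_apply, norm_smul, mul_comm]
      exact mul_le_mul_of_nonneg_right (hf.norm_grad_le x) (norm_nonneg _)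

theorem coeFn_gradOp (hf : IsMultiplier f K B) (μ : Measure R3) (u : Lp ℂ 2 μ) :
    hf.gradOp μ u =ᵐ[μ] fun x => u x • grad f x :=
  coeFn_mulLp _ _ _ _ u

/-- Multiplication by `f` on the pairs `(u, ∇u)`: `(u, g) ↦ (f u, f g + u ∇f)`. -/
def pairOp (hf : IsMultiplier f K B) : L2Pair Ω →L[ℂ] L2Pair Ω :=
  diagOp (hf.scalarOp _) (hf.scalarOp _) (hf.gradOp _)

theorem pairOp_fst (hf : IsMultiplier f K B) (p : L2Pair Ω) :
    (hf.pairOp p).fst =ᵐ[volume.restrict Ω] fun x => f x * p.fst x :=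
  hf.coeFn_scalarOp _ p.fst

theorem pairOp_snd (hf : IsMultiplier f K B) (p : L2Pair Ω) :
    (hf.pairOp p).snd =ᵐ[volume.restrict Ω] fun x => f x • p.snd x + p.fst x • grad f x := by
  have h : (hf.pairOp p).snd = hf.scalarOp _ p.snd + hf.gradOp _ p.fst := rfl
  rw [h]
  filter_upwards [Lp.coeFn_add (hf.scalarOp _ p.snd) (hf.gradOp _ p.fst),
    hf.coeFn_scalarOp _ p.snd, hf.coeFn_gradOp _ p.fst] with x h1 h2 h3
  rw [h1, Pi.add_apply, h2, h3]

/-- The product of a test function with a multiplier `f` belongs to `H¹₀`: it is the limit of the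
products with the mollifications of `f`. -/
theorem pairOp_mem_of_testPairs (hf : IsMultiplier f K B) {p : L2Pair Ω} (hp : p ∈ testPairs Ω) :
    hf.pairOp p ∈ H10 Ω := by
  obtain ⟨φ, hφ, hp1, hp2⟩ := hp
  have hcd := fun n => contDiff_mollify hf.lipschitz.continuous n
  have htest : ∀ n, IsTestFunction Ω fun x => φ x * mollify n f x := fun n =>
    ⟨hφ.smooth.mul (hcd n), hφ.compact.mul_right, (tsupport_mul_subset_left).trans hφ.support⟩
  choose q hq hq1 hq2 using fun n => (htest n).exists_pair
  have hgrad : ∀ n x, grad (fun x => φ x * mollify n f x) x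
      = mollify n f x • grad φ x + φ x • grad (mollify n f) x := fun n x =>
    grad_mul (hφ.smooth.differentiable (by simp) x) ((hcd n).differentiable (by simp) x)
  have hr1 : ∀ n, (bump n).rOut ≤ 1 := fun n => by
    change 1 / ((n : ℝ) + 1) ≤ 1
    rw [div_le_one (by positivity)]
    linarith [n.cast_nonneg (α := ℝ)]
  have hd : ∀ n x, ‖mollify n f x - f x‖ ≤ K := fun n x =>
    (norm_mollify_sub_le hf.lipschitz n x).trans (mul_le_of_le_one_right K.2 (hr1 n))
  have hdlim : ∀ x, Tendsto (fun n => mollify n f x) atTop (𝓝 (f x)) := fun x => by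
    rw [tendsto_iff_norm_sub_tendsto_zero]
    refine squeeze_zero (fun _ => norm_nonneg _) (fun n => norm_mollify_sub_le hf.lipschitz n x) ?_
    simpa using bump_rOut_tendsto.const_mul (K : ℝ)
  have hgn : ∀ n x, ‖grad (mollify n f) x‖ ≤ 2 * K := fun n x =>
    (norm_vecOf_le _).trans (by gcongr; exact norm_fderiv_mollify_le hf.lipschitz n x)
  have hi1 : MemLp φ 2 (volume.restrict Ω) := (memLp_congr_ae hp1).1 (Lp.memLp _)
  have hi2 : MemLp (grad φ) 2 (volume.restrict Ω) := (memLp_congr_ae hp2).1 (Lp.memLp _)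
  have hfst : Tendsto (fun n => (q n).fst) atTop (𝓝 (hf.pairOp p).fst) := by
    refine tendsto_Lp_of_dominated (fun x => K * ‖φ x‖) ?_ (fun n => ?_) ?_
    · exact (hi1.norm.const_smul (K : ℝ)).integrable_sq
    · filter_upwards [hq1 n, hf.pairOp_fst p, hp1] with x h1 h2 h3
      rw [h1, h2, h3, mul_comm (f x), ← mul_sub, norm_mul, mul_comm]
      exact mul_le_mul_of_nonneg_right (hd n x) (norm_nonneg _)
    · filter_upwards [ae_all_iff.2 hq1, hf.pairOp_fst p, hp1] with x h1 h2 h3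
      simp only [h1, h2, h3, mul_comm (f x)]
      exact (hdlim x).const_mul _
  have hsnd : Tendsto (fun n => (q n).snd) atTop (𝓝 (hf.pairOp p).snd) := by
    refine tendsto_Lp_of_dominated (fun x => K * ‖grad φ x‖ + 4 * K * ‖φ x‖) ?_ (fun n => ?_) ?_
    · exact
        ((hi2.norm.const_smul (K : ℝ)).add (hi1.norm.const_smul (4 * K : ℝ))).integrable_sq
    · filter_upwards [hq2 n, hf.pairOp_snd p, hp1, hp2] with x h1 h2 h3 h4
      rw [h1, h2, h3, h4, hgrad, add_sub_add_comm, ← sub_smul, ← smul_sub]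
      refine (norm_add_le _ _).trans ?_
      rw [norm_smul, norm_smul, mul_comm (4 * (K : ℝ))]
      have h5 := norm_sub_le (grad (mollify n f) x) (grad f x)
      have h6 := hgn n x
      have h7 := hf.norm_grad_le x
      gcongr
      · exact hd n x
      · linarith
    · filter_upwards [ae_all_iff.2 hq2, hf.pairOp_snd p, hp1, hp2,
        ae_restrict_of_ae hf.strict] with x h1 h2 h3 h4 h5
      simp only [h1, h2, h3, h4, hgrad]
      refine ((hdlim x).smul_const _).add (Tendsto.const_smul ?_ _)
      rw [tendsto_iff_norm_sub_tendsto_zero]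
      refine squeeze_zero (fun _ => norm_nonneg _) (g := fun n =>
        2 * ‖fderiv ℝ (mollify n f) x - fderiv ℝ f x‖) (fun n => ?_) ?_
      · rw [grad_eq_vecOf, grad_eq_vecOf, ← vecOf_sub]
        exact norm_vecOf_le _
      · simpa using (tendsto_iff_norm_sub_tendsto_zero.1
          (tendsto_fderiv_mollify hf.lipschitz.continuous h5)).const_mul 2
  have hlim : Tendsto q atTop (𝓝 (hf.pairOp p)) := by
    have := ((WithLp.prod_continuous_toLp 2 _ _).tendsto
      ((hf.pairOp p).fst, (hf.pairOp p).snd)).comp (hfst.prodMk_nhds hsnd)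
    exact this
  exact mem_closure_of_tendsto hlim (Eventually.of_forall hq)

theorem pairOp_mem (hf : IsMultiplier f K B) {p : L2Pair Ω} (hp : p ∈ H10 Ω) :
    hf.pairOp p ∈ H10 Ω :=
  closure_minimal (s := (testPairs Ω : Set (L2Pair Ω))) (t := hf.pairOp ⁻¹' (H10 Ω))
    (fun _ h => hf.pairOp_mem_of_testPairs h)
    ((Submodule.isClosed_topologicalClosure _).preimage hf.pairOp.continuous) hp

/-- Multiplication by `f` on `H¹₀(Ω)`. -/
def op (hf : IsMultiplier f K B) : H10 Ω →L[ℂ] H10 Ω :=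
  hf.pairOp.restrict fun _ hp => hf.pairOp_mem hp

theorem valFn_op (hf : IsMultiplier f K B) (u : H10 Ω) :
    valFn (hf.op u) =ᵐ[volume.restrict Ω] fun x => f x * valFn u x :=
  hf.pairOp_fst (u : L2Pair Ω)

theorem gradFn_op (hf : IsMultiplier f K B) (u : H10 Ω) :
    gradFn (hf.op u) =ᵐ[volume.restrict Ω] fun x => f x • gradFn u x + valFn u x • grad f x :=
  hf.pairOp_snd (u : L2Pair Ω)

theorem op_op_of_mul_eq_one (hf : IsMultiplier f K B) {g : R3 → ℂ} {K' : NNReal} {B' : ℝ}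
    (hg : IsMultiplier g K' B') (hfg : ∀ x, f x * g x = 1) (u : H10 Ω) : hf.op (hg.op u) = u := by
  have h1 : valFn (hf.op (hg.op u)) =ᵐ[volume.restrict Ω] valFn u := by
    filter_upwards [hf.valFn_op (hg.op u), hg.valFn_op u] with x h1 h2
    rw [h1, h2, ← mul_assoc, hfg, one_mul]
  have h2 : gradFn (hf.op (hg.op u)) =ᵐ[volume.restrict Ω] gradFn u := by
    filter_upwards [hf.gradFn_op (hg.op u), hg.gradFn_op u, hg.valFn_op u,
      ae_restrict_of_ae hf.strict, ae_restrict_of_ae hg.strict] with x h1 h2 h3 h4 h5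
    have h6 : g x • grad f x + f x • grad g x = 0 := by
      rw [← grad_mul h4.differentiableAt h5.differentiableAt]
      simp only [hfg]
      ext i
      simp [grad]
    rw [h1, h2, h3, smul_add, smul_smul, hfg, one_smul, add_assoc, smul_smul, mul_comm (f x),
      mul_comm (g x), ← smul_smul, ← smul_smul, ← smul_add, add_comm (f x • _), h6, smul_zero,
      add_zero]
  refine Subtype.ext ?_
  have h3 : ((hf.op (hg.op u) : H10 Ω) : L2Pair Ω).fst = (u : L2Pair Ω).fst := Lp.ext h1
  have h4 : ((hf.op (hg.op u) : H10 Ω) : L2Pair Ω).snd = (u : L2Pair Ω).snd := Lp.ext h2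
  exact (WithLp.ofLp_injective 2) (Prod.ext h3 h4)

theorem isUnit_op (hf : IsMultiplier f K B) {g : R3 → ℂ} {K' : NNReal} {B' : ℝ}
    (hg : IsMultiplier g K' B') (hfg : ∀ x, f x * g x = 1) :
    IsUnit (hf.op : H10 Ω →L[ℂ] H10 Ω) :=
  ⟨⟨hf.op, hg.op, ContinuousLinearMap.ext fun u => hf.op_op_of_mul_eq_one hg hfg u,
    ContinuousLinearMap.ext fun u =>
      hg.op_op_of_mul_eq_one hf (fun x => by rw [mul_comm, hfg]) u⟩, rfl⟩

end IsMultiplier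

end Multiplier

/-! ### The coefficient matrix -/

section Matrices

open Matrix hiding add_apply sub_apply smul_apply

variable {ς : Matrix (Fin 3) (Fin 3) ℝ}

/-- The complexification of a real matrix, as an operator on `ℂ³`. -/
def complexify (B : Matrix (Fin 3) (Fin 3) ℝ) : C3 →L[ℂ] C3 :=
  toEuclideanCLM (n := Fin 3) (𝕜 := ℂ) (B.map (algebraMap ℝ ℂ))

theorem inner_complexify (B : Matrix (Fin 3) (Fin 3) ℝ) (u v : C3) :
    inner ℂ u (complexify B v) = ∑ i, ∑ j, (starRingEnd ℂ) (u i) * ((B i j : ℂ) * v j) := by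
  simp only [complexify, PiLp.inner_apply, ofLp_toEuclideanCLM, mulVec, dotProduct, RCLike.inner_apply,
    Finset.sum_mul, Matrix.map_apply, Complex.coe_algebraMap]
  exact Finset.sum_congr rfl fun i _ => Finset.sum_congr rfl fun j _ => by ring

theorem inner_complexify_left (hB : B.IsHermitian) (u v : C3) :
    inner ℂ (complexify B u) v = inner ℂ u (complexify B v) := by
  rw [← inner_conj_symm, inner_complexify, inner_complexify]
  simp only [map_sum, map_mul, Complex.conj_conj, Complex.conj_ofReal]
  rw [Finset.sum_comm]
  refine Finset.sum_congr rfl fun i _ => Finset.sum_congr rfl fun j _ => ?_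
  have : B j i = B i j := by simpa using congrFun (congrFun hB i) j
  rw [this]
  ring

theorem re_inner_complexify_nonneg {B : Matrix (Fin 3) (Fin 3) ℝ} (hB : B.PosSemidef) (v : C3) :
    0 ≤ (inner ℂ v (complexify B v)).re := by
  have h1 := hB.dotProduct_mulVec_nonneg fun i => (v i).re
  have h2 := hB.dotProduct_mulVec_nonneg fun i => (v i).im
  rw [inner_complexify]
  simp only [dotProduct, mulVec, Finset.mul_sum, Pi.star_apply, star_trivial] at h1 h2
  refine (add_nonneg h1 h2).trans_eq ?_
  rw [← Finset.sum_add_distrib, Complex.re_sum]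
  refine Finset.sum_congr rfl fun i _ => ?_
  rw [← Finset.sum_add_distrib, Complex.re_sum]
  refine Finset.sum_congr rfl fun j _ => ?_
  simp

theorem sMin_le {x : ℝ} (hx : x ∈ spectrum ℝ ς) : sMin ς ≤ x :=
  csInf_le ς.finite_real_spectrum.bddBelow hx

theorem le_sMax {x : ℝ} (hx : x ∈ spectrum ℝ ς) : x ≤ sMax ς :=
  le_csSup ς.finite_real_spectrum.bddAbove hx

theorem sMax_pos (hς : ς.PosDef) : 0 < sMax ς := by
  have h : hς.isHermitian.eigenvalues 0 ∈ spectrum ℝ ς := by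
    rw [hς.isHermitian.spectrum_real_eq_range_eigenvalues]
    exact ⟨0, rfl⟩
  exact (hς.eigenvalues_pos 0).trans_le (le_sMax h)

theorem posSemidef_sub_sMin (hς : ς.PosDef) :
    (ς - algebraMap ℝ (Matrix (Fin 3) (Fin 3) ℝ) (sMin ς)).PosSemidef := by
  rw [posSemidef_iff_isHermitian_and_spectrum_nonneg]
  refine ⟨hς.isHermitian.sub ?_, ?_⟩
  · rw [Algebra.algebraMap_eq_smul_one]
    exact (isHermitian_one.smul (IsSelfAdjoint.all _))
  · rw [← spectrum.sub_singleton_eq]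
    rintro _ ⟨x, hx, _, rfl, rfl⟩
    exact sub_nonneg.2 (sMin_le hx)

theorem posSemidef_sMax_sub (hς : ς.PosDef) :
    (algebraMap ℝ (Matrix (Fin 3) (Fin 3) ℝ) (sMax ς) - ς).PosSemidef := by
  rw [posSemidef_iff_isHermitian_and_spectrum_nonneg]
  refine ⟨Matrix.IsHermitian.sub ?_ hς.isHermitian, ?_⟩
  · rw [Algebra.algebraMap_eq_smul_one]
    exact (isHermitian_one.smul (IsSelfAdjoint.all _))
  · rw [← spectrum.singleton_sub_eq]
    rintro _ ⟨_, rfl, x, hx, rfl⟩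
    exact sub_nonneg.2 (le_sMax hx)

theorem complexify_sub (B C : Matrix (Fin 3) (Fin 3) ℝ) :
    complexify (B - C) = complexify B - complexify C := by
  rw [complexify, Matrix.map_sub _ (map_sub _), map_sub]; rfl

theorem complexify_algebraMap (c : ℝ) :
    complexify (algebraMap ℝ (Matrix (Fin 3) (Fin 3) ℝ) c) = (c : ℂ) • 1 := by
  rw [complexify, Algebra.algebraMap_eq_smul_one,
    show (c • (1 : Matrix (Fin 3) (Fin 3) ℝ)).map (algebraMap ℝ ℂ) =
      (c : ℂ) • (1 : Matrix (Fin 3) (Fin 3) ℂ) by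
        ext i j; by_cases h : i = j <;> simp [h], map_smul, map_one]

theorem re_inner_smul_self (c : ℝ) (v : C3) : (inner ℂ v ((c : ℂ) • v)).re = c * ‖v‖ ^ 2 := by
  rw [inner_smul_right, Complex.re_ofReal_mul]
  exact congrArg (c * ·) (inner_self_eq_norm_sq (𝕜 := ℂ) v)

theorem sMin_mul_le_re_inner (hς : ς.PosDef) (v : C3) :
    sMin ς * ‖v‖ ^ 2 ≤ (inner ℂ v (complexify ς v)).re := by
  have h := re_inner_complexify_nonneg (posSemidef_sub_sMin hς) v
  rw [complexify_sub, complexify_algebraMap, sub_apply, inner_sub_right, Complex.sub_re,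
    smul_apply, one_apply_eq_self, re_inner_smul_self] at h
  linarith

theorem re_inner_le_sMax_mul (hς : ς.PosDef) (v : C3) :
    (inner ℂ v (complexify ς v)).re ≤ sMax ς * ‖v‖ ^ 2 := by
  have h := re_inner_complexify_nonneg (posSemidef_sMax_sub hς) v
  rw [complexify_sub, complexify_algebraMap, sub_apply, inner_sub_right, Complex.sub_re,
    smul_apply, one_apply_eq_self, re_inner_smul_self] at h
  linarith

/-- The radial projection as a real matrix. -/
def realRadialProj (x : R3) : Matrix (Fin 3) (Fin 3) ℝ :=
  Matrix.of fun i j => x i / ‖x‖ * (x j / ‖x‖)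

theorem realRadialProj_isHermitian (x : R3) : (realRadialProj x).IsHermitian := by
  ext i j
  simp [realRadialProj, mul_comm]

/-- The case `x = 0` is included: then `realRadialProj x = 0`. -/
theorem realRadialProj_mul_self (x : R3) : realRadialProj x * realRadialProj x = realRadialProj x := by
  by_cases hx : x = 0
  · ext i j; simp [realRadialProj, hx, Matrix.mul_apply]
  have h : ∑ j, (x j / ‖x‖) * (x j / ‖x‖) = 1 := by
    have h1 := EuclideanSpace.real_norm_sq_eq x
    have h2 : ‖x‖ ^ 2 ≠ 0 := by positivity
    simp only [← pow_two, div_pow]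
    rw [← Finset.sum_div, ← h1, div_self h2]
  ext i j
  simp only [realRadialProj, Matrix.mul_apply, Matrix.of_apply]
  calc _ = x i / ‖x‖ * (∑ k, (x k / ‖x‖) * (x k / ‖x‖)) * (x j / ‖x‖) := by
        rw [Finset.mul_sum, Finset.sum_mul]
        exact Finset.sum_congr rfl fun k _ => by ring
    _ = _ := by rw [h, mul_one]

/-- The radial component of a vector at the point `x`. -/
def radial (x : R3) : C3 →L[ℂ] C3 := complexify (realRadialProj x)

theorem radial_radial (x : R3) (v : C3) : radial x (radial x v) = radial x v := by
  have h : radial x * radial x = radial x := by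
    rw [radial, complexify, ← map_mul, ← Matrix.map_mul, realRadialProj_mul_self]
  exact congrArg (fun T => T v) h

theorem inner_radial_left (x : R3) (u v : C3) :
    inner ℂ (radial x u) v = inner ℂ u (radial x v) :=
  inner_complexify_left (realRadialProj_isHermitian x) u v

theorem inner_radial_sub_radial (x : R3) (v : C3) :
    inner ℂ (radial x v) (v - radial x v) = (0 : ℂ) := by
  rw [inner_radial_left, map_sub, radial_radial, sub_self, inner_zero_right]

theorem norm_sq_radial_add (x : R3) (v : C3) :
    ‖radial x v‖ ^ 2 + ‖v - radial x v‖ ^ 2 = ‖v‖ ^ 2 := by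
  have h := norm_add_sq_eq_norm_sq_add_norm_sq_of_inner_eq_zero (𝕜 := ℂ) _ _
    (inner_radial_sub_radial x v)
  rw [add_sub_cancel] at h
  nlinarith

theorem norm_radial_le (x : R3) : ‖radial x‖ ≤ 1 := by
  refine ContinuousLinearMap.opNorm_le_bound _ zero_le_one fun v => ?_
  rw [one_mul]
  refine le_of_sq_le_sq ?_ (norm_nonneg _)
  nlinarith [norm_sq_radial_add x v, sq_nonneg ‖v - radial x v‖]

/-- `ς̃` as an operator on `ℂ³`. -/
def sigmaOp (ς : Matrix (Fin 3) (Fin 3) ℝ) (γ : ℂ) (a : ℝ → ℝ) (x : R3) : C3 →L[ℂ] C3 :=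
  toEuclideanCLM (n := Fin 3) (𝕜 := ℂ) (sigmaTilde ς γ a x)

variable {γ : ℂ} {a : ℝ → ℝ}

theorem toEuclideanCLM_frameMatrix (x : R3) :
    toEuclideanCLM (n := Fin 3) (𝕜 := ℂ) (frameMatrix γ a x) =
      dTilde γ a ‖x‖ ^ 2 • radial x + (dTilde γ a ‖x‖ * dFun γ a ‖x‖) • (1 - radial x) := by
  have h : radial x = toEuclideanCLM (n := Fin 3) (𝕜 := ℂ) (radialProj x) := rfl
  rw [frameMatrix, map_add, map_smul, map_smul, map_sub, map_one, h]

theorem sigmaOp_eq (x : R3) :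
    sigmaOp ς γ a x = (dTilde γ a ‖x‖ ^ 2 * dFun γ a ‖x‖)⁻¹ •
      (toEuclideanCLM (n := Fin 3) (𝕜 := ℂ) (frameMatrix γ a x) * complexify ς *
        toEuclideanCLM (n := Fin 3) (𝕜 := ℂ) (frameMatrix γ a x)) := by
  rw [sigmaOp, sigmaTilde, map_smul, map_mul, map_mul]; rfl

/-- The quadratic form of `ς̃` in terms of the radial and tangential parts of the vector. -/
theorem inner_sigmaOp (x : R3) (hD : dTilde γ a ‖x‖ ≠ 0) (hd : dFun γ a ‖x‖ ≠ 0) (ξ : C3) :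
    inner ℂ ξ (sigmaOp ς γ a x ξ) =
      dTilde γ a ‖x‖ ^ 2 / dFun γ a ‖x‖ * inner ℂ (radial x ξ) (complexify ς (radial x ξ)) +
      dTilde γ a ‖x‖ *
        (inner ℂ (radial x ξ) (complexify ς (ξ - radial x ξ)) +
          inner ℂ (ξ - radial x ξ) (complexify ς (radial x ξ))) +
      dFun γ a ‖x‖ *
        inner ℂ (ξ - radial x ξ) (complexify ς (ξ - radial x ξ)) := by
  set D := dTilde γ a ‖x‖
  set d := dFun γ a ‖x‖
  set p := radial x ξ with hp
  set q := ξ - radial x ξ with hq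
  have hN : toEuclideanCLM (n := Fin 3) (𝕜 := ℂ) (frameMatrix γ a x) ξ = D • (D • p + d • q) := by
    rw [toEuclideanCLM_frameMatrix, add_apply, smul_apply, smul_apply, sub_apply, one_apply_eq_self,
      smul_add, smul_smul, smul_smul, pow_two]
  have hL : ∀ v, inner ℂ ξ (toEuclideanCLM (n := Fin 3) (𝕜 := ℂ) (frameMatrix γ a x) v) =
      D * (D * inner ℂ p v + d * inner ℂ q v) := by
    intro v
    rw [toEuclideanCLM_frameMatrix, add_apply, smul_apply, smul_apply, sub_apply, one_apply_eq_self,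
      inner_add_right, inner_smul_right, inner_smul_right, inner_sub_right, ← inner_radial_left,
      hq, inner_sub_left]
    ring
  rw [sigmaOp_eq, smul_apply, mul_apply_eq_comp, mul_apply_eq_comp, inner_smul_right, hL, hN,
    map_smul, map_add, map_smul, map_smul]
  simp only [inner_smul_right, inner_add_right]
  rw [show dTilde γ a ‖x‖ = D from rfl, show dFun γ a ‖x‖ = d from rfl]
  field_simp
  ring

/-- The quadratic form of `ς̃`, in real quantities: `pp`, `qq` and `2 h` are the radial, tangential
and mixed parts of the quadratic form of `ς`, and `A`, `B` the squared norms of the two parts. -/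
theorem exists_inner_sigmaOp_eq (hς : ς.PosDef) (x : R3) (hD : dTilde γ a ‖x‖ ≠ 0)
    (hd : dFun γ a ‖x‖ ≠ 0) (ξ : C3) :
    ∃ pp qq h A B : ℝ, 0 ≤ A ∧ 0 ≤ B ∧ A + B = ‖ξ‖ ^ 2 ∧ 0 ≤ pp ∧ 0 ≤ qq ∧ pp ≤ sMax ς * A ∧
      qq ≤ sMax ς * B ∧
      (∀ s t : ℝ, sMin ς * (s ^ 2 * A + t ^ 2 * B) ≤ s ^ 2 * pp + 2 * s * t * h + t ^ 2 * qq) ∧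
      inner ℂ ξ (sigmaOp ς γ a x ξ) = dTilde γ a ‖x‖ ^ 2 / dFun γ a ‖x‖ * pp +
        2 * dTilde γ a ‖x‖ * h + dFun γ a ‖x‖ * qq := by
  set S := complexify ς with hS
  set p := radial x ξ with hp
  set q := ξ - radial x ξ with hq
  have hreal : ∀ v, inner ℂ v (S v) = (((inner ℂ v (S v)).re : ℝ) : ℂ) := fun v => by
    rw [eq_comm, ← Complex.conj_eq_iff_re, inner_conj_symm, hS,
      inner_complexify_left hς.isHermitian]
  have hmix : inner ℂ q (S p) = (starRingEnd ℂ) (inner ℂ p (S q)) := by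
    rw [inner_conj_symm, hS, inner_complexify_left hς.isHermitian]
  have hmixed : inner ℂ p (S q) + inner ℂ q (S p) = ((2 * (inner ℂ p (S q)).re : ℝ) : ℂ) := by
    rw [hmix, Complex.add_conj]
  have horth : inner ℂ p q = (0 : ℂ) := inner_radial_sub_radial x ξ
  have hpos : ∀ v, 0 ≤ (inner ℂ v (S v)).re := fun v =>
    re_inner_complexify_nonneg hς.posSemidef v
  refine ⟨(inner ℂ p (S p)).re, (inner ℂ q (S q)).re, (inner ℂ p (S q)).re, ‖p‖ ^ 2, ‖q‖ ^ 2,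
    by positivity, by positivity, norm_sq_radial_add x ξ, hpos p, hpos q,
    re_inner_le_sMax_mul hς p, re_inner_le_sMax_mul hς q, fun s t => ?_, ?_⟩
  · have h1 := sMin_mul_le_re_inner hς ((s : ℂ) • p + (t : ℂ) • q)
    have h2 : ‖(s : ℂ) • p + (t : ℂ) • q‖ ^ 2 = s ^ 2 * ‖p‖ ^ 2 + t ^ 2 * ‖q‖ ^ 2 := by
      have h3 := norm_add_sq_eq_norm_sq_add_norm_sq_of_inner_eq_zero (𝕜 := ℂ) ((s : ℂ) • p)
        ((t : ℂ) • q) (by rw [inner_smul_left, inner_smul_right, horth, mul_zero, mul_zero])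
      rw [← pow_two, ← pow_two, ← pow_two, norm_smul, norm_smul, mul_pow, mul_pow] at h3
      simpa using h3
    rw [h2] at h1
    refine h1.trans_eq ?_
    simp only [map_add, map_smul, inner_add_left, inner_add_right, inner_smul_left,
      inner_smul_right, Complex.conj_ofReal, Complex.add_re, ← hS, hmix, Complex.re_ofReal_mul,
      Complex.conj_re]
    ring
  · rw [inner_sigmaOp x hD hd, ← hS, ← hp, ← hq, hmixed, hreal p, hreal q]
    simp only [Complex.ofReal_re]
    push_cast
    ring

theorem norm_sigmaOp_le (x : R3) {C : ℝ} (hD : 1 ≤ ‖dTilde γ a ‖x‖‖) (hd : 1 ≤ ‖dFun γ a ‖x‖‖)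
    (hDC : ‖dTilde γ a ‖x‖‖ ≤ C) (hdC : ‖dFun γ a ‖x‖‖ ≤ C) :
    ‖sigmaOp ς γ a x‖ ≤ (3 * C ^ 2) ^ 2 * ‖complexify ς‖ := by
  have hF : ‖toEuclideanCLM (n := Fin 3) (𝕜 := ℂ) (frameMatrix γ a x)‖ ≤ 3 * C ^ 2 := by
    rw [toEuclideanCLM_frameMatrix]
    have h1 : ‖(1 : C3 →L[ℂ] C3) - radial x‖ ≤ 2 :=
      (norm_sub_le _ _).trans (by
        have : ‖(1 : C3 →L[ℂ] C3)‖ ≤ 1 := ContinuousLinearMap.norm_id_le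
        linarith [norm_radial_le x])
    refine (norm_add_le _ _).trans ?_
    rw [norm_smul, norm_smul, norm_pow, norm_mul]
    have h2 : ‖dTilde γ a ‖x‖‖ ^ 2 * ‖radial x‖ ≤ C ^ 2 * 1 := by
      gcongr
      exact norm_radial_le x
    have h3 : ‖dTilde γ a ‖x‖‖ * ‖dFun γ a ‖x‖‖ * ‖(1 : C3 →L[ℂ] C3) - radial x‖ ≤ C * C * 2 := by
      have : 0 ≤ C := (norm_nonneg _).trans hDC
      gcongr
    nlinarith
  have h4 : ‖(dTilde γ a ‖x‖ ^ 2 * dFun γ a ‖x‖)⁻¹‖ ≤ 1 := by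
    rw [norm_inv, norm_mul, norm_pow]
    exact inv_le_one_of_one_le₀ (one_le_mul_of_one_le_of_one_le (one_le_pow₀ hD) hd)
  rw [sigmaOp_eq, norm_smul]
  calc _ ≤ 1 * (3 * C ^ 2 * ‖complexify ς‖ * (3 * C ^ 2)) := by
        refine mul_le_mul h4 ?_ (norm_nonneg _) zero_le_one
        refine (norm_mul_le _ _).trans (mul_le_mul ((norm_mul_le _ _).trans ?_) hF
          (norm_nonneg _) (by positivity))
        gcongr
    _ = _ := by ring

end Matrices

/-! ### Phases of complex functions -/

section Phases

open Complex (I)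

/-- The phase `z / |z|` of a complex number (with value `0` at `z = 0`). -/
def phase (z : ℂ) : ℂ := z / (‖z‖ : ℂ)

theorem norm_phase {z : ℂ} (hz : z ≠ 0) : ‖phase z‖ = 1 := by
  rw [phase, norm_div, Complex.norm_real, norm_norm, div_self (norm_ne_zero_iff.2 hz)]

theorem norm_phase_le (z : ℂ) : ‖phase z‖ ≤ 1 := by
  by_cases hz : z = 0
  · simp [phase, hz]
  · exact (norm_phase hz).le

theorem norm_mul_phase (z : ℂ) : (‖z‖ : ℂ) * phase z = z := by
  by_cases hz : z = 0
  · simp [hz]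
  · rw [phase, mul_div_cancel₀]
    exact_mod_cast norm_ne_zero_iff.2 hz

theorem phase_mul_conj {z : ℂ} (hz : z ≠ 0) : phase z * (starRingEnd ℂ) (phase z) = 1 := by
  rw [Complex.mul_conj, Complex.normSq_eq_norm_sq, norm_phase hz]
  simp

theorem phase_conj (z : ℂ) : phase ((starRingEnd ℂ) z) = (starRingEnd ℂ) (phase z) := by
  simp [phase]

theorem phase_div (z w : ℂ) : phase (z / w) = phase z * (starRingEnd ℂ) (phase w) := by
  by_cases hw : w = 0
  · simp [phase, hw]
  have h : (starRingEnd ℂ) (phase w) = (phase w)⁻¹ :=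
    eq_inv_of_mul_eq_one_right (phase_mul_conj hw)
  rw [h]
  have h2 : (‖w‖ : ℂ) ≠ 0 := by exact_mod_cast norm_ne_zero_iff.2 hw
  by_cases hz : z = 0
  · simp [phase, hz]
  have h3 : (‖z‖ : ℂ) ≠ 0 := by exact_mod_cast norm_ne_zero_iff.2 hz
  simp only [phase, norm_div, Complex.ofReal_div, inv_div]
  field_simp

theorem exp_arg_mul_I {z : ℂ} (hz : z ≠ 0) : Complex.exp (I * (z.arg : ℂ)) = phase z := by
  have h := Complex.norm_mul_exp_arg_mul_I z
  rw [phase, eq_div_iff (by exact_mod_cast norm_ne_zero_iff.2 hz), mul_comm, mul_comm I]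
  exact h

theorem exp_neg_arg_mul_I {z : ℂ} (hz : z ≠ 0) :
    Complex.exp (-I * (z.arg : ℂ)) = (starRingEnd ℂ) (phase z) := by
  rw [← exp_arg_mul_I hz, ← Complex.exp_conj]
  simp

theorem norm_div_conj (z : ℂ) : (‖z‖ : ℂ) / (starRingEnd ℂ) z = phase z := by
  by_cases hz : z = 0
  · simp [phase, hz]
  have h1 : (starRingEnd ℂ) z ≠ 0 := by simpa using hz
  have h2 : (‖z‖ : ℂ) ≠ 0 := by exact_mod_cast norm_ne_zero_iff.2 hz
  rw [phase, div_eq_div_iff h1 h2, Complex.mul_conj, Complex.normSq_eq_norm_sq]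
  push_cast
  ring

theorem sin_arg_eq_im_phase (z : ℂ) : Real.sin z.arg = (phase z).im := by
  rw [Complex.sin_arg, phase, Complex.div_ofReal_im]

theorem cos_arg_eq_re_phase {z : ℂ} (hz : z ≠ 0) : Real.cos z.arg = (phase z).re := by
  rw [Complex.cos_arg hz, phase, Complex.div_ofReal_re]

theorem norm_phase_sub_le {z : ℂ} (hz : z ≠ 0) (w : ℂ) :
    ‖phase w - phase z‖ ≤ 2 / ‖z‖ * ‖w - z‖ := by
  have hz' : 0 < ‖z‖ := norm_pos_iff.2 hz
  have h1 : (phase w - phase z) * (‖z‖ : ℂ) = (w - z) + phase w * ((‖z‖ - ‖w‖ : ℝ) : ℂ) := by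
    have h2 := norm_mul_phase z
    have h3 := norm_mul_phase w
    push_cast
    linear_combination -h2 + h3
  have h4 : ‖phase w - phase z‖ * ‖z‖ ≤ ‖w - z‖ + 1 * ‖w - z‖ := by
    calc ‖phase w - phase z‖ * ‖z‖ = ‖(phase w - phase z) * (‖z‖ : ℂ)‖ := by
          rw [norm_mul, Complex.norm_real, norm_norm]
      _ ≤ ‖w - z‖ + ‖phase w‖ * ‖((‖z‖ - ‖w‖ : ℝ) : ℂ)‖ := by
          rw [h1, ← norm_mul]
          exact norm_add_le _ _
      _ ≤ _ := by
          gcongr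
          · exact norm_phase_le w
          · rw [Complex.norm_real, norm_sub_rev w z]
            exact abs_norm_sub_norm_le z w
  rw [div_mul_eq_mul_div, le_div_iff₀ hz']
  linarith

theorem contDiffAt_phase {z : ℂ} (hz : z ≠ 0) {n : WithTop ℕ∞} : ContDiffAt ℝ n phase z := by
  have h : ContDiffAt ℝ n (fun z : ℂ => ((‖z‖ : ℝ) : ℂ)) z :=
    Complex.ofRealCLM.contDiff.contDiffAt.comp z (contDiffAt_norm ℝ hz)
  have h2 := contDiffAt_id.mul (h.inv (by exact_mod_cast norm_ne_zero_iff.2 hz))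
  have h3 : phase = fun z : ℂ => id z * (fun z : ℂ => ((‖z‖ : ℝ) : ℂ))⁻¹ z :=
    funext fun z => div_eq_mul_inv _ _
  rw [h3]
  exact h2

theorem continuousAt_phase {z : ℂ} (hz : z ≠ 0) : ContinuousAt phase z :=
  (contDiffAt_phase hz (n := 0)).continuousAt

theorem exists_hasDerivAt_phase {g : ℝ → ℂ} {g' : ℂ} {r : ℝ} (hg : HasDerivAt g g' r)
    (h0 : g r ≠ 0) :
    ∃ u', HasDerivAt (fun r => phase (g r)) u' r ∧ ‖u'‖ ≤ 2 / ‖g r‖ * ‖g'‖ := by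
  have h1 : HasFDerivAt phase (fderiv ℝ phase (g r)) (g r) :=
    ((contDiffAt_phase h0 (n := 1)).differentiableAt (by simp)).hasFDerivAt
  have h2 : ‖fderiv ℝ phase (g r)‖ ≤ 2 / ‖g r‖ :=
    h1.le_of_lip' (by positivity) (Eventually.of_forall (norm_phase_sub_le h0))
  exact ⟨_, h1.comp_hasDerivAt r hg, ((fderiv ℝ phase (g r)).le_opNorm _).trans (by gcongr)⟩

/-- The function `u · e^{iθ}` with `θ = arg (c - i s Im (u v̄))`, built from two phases `u` and `v`. -/
def twist (c s : ℝ) (u v : ℂ) : ℂ :=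
  u * phase ((c : ℂ) - I * ((s * (u * (starRingEnd ℂ) v).im : ℝ) : ℂ))

variable {c s : ℝ}

theorem le_norm_sub_I_mul (c t : ℝ) : c ≤ ‖(c : ℂ) - I * (t : ℂ)‖ := by
  refine le_trans ?_ (Complex.re_le_norm _)
  simp

theorem sub_I_mul_ne_zero (hc : 0 < c) (t : ℝ) : (c : ℂ) - I * (t : ℂ) ≠ 0 :=
  norm_pos_iff.1 (hc.trans_le (le_norm_sub_I_mul c t))

theorem contDiffAt_twist (hc : 0 < c) {u v : ℝ → ℂ} {r : ℝ} {n : WithTop ℕ∞}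
    (hu : ContDiffAt ℝ n u r) (hv : ContDiffAt ℝ n v r) :
    ContDiffAt ℝ n (fun r => twist c s (u r) (v r)) r := by
  have h1 : ContDiffAt ℝ n (fun r => (u r * (starRingEnd ℂ) (v r)).im) r :=
    Complex.imCLM.contDiff.contDiffAt.comp r
      (hu.mul (Complex.conjCLE.contDiff.contDiffAt.comp r hv))
  have h2 : ContDiffAt ℝ n (fun r => ((s * (u r * (starRingEnd ℂ) (v r)).im : ℝ) : ℂ)) r :=
    Complex.ofRealCLM.contDiff.contDiffAt.comp r (contDiffAt_const.mul h1)
  refine hu.mul ?_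
  exact (contDiffAt_phase (sub_I_mul_ne_zero hc _)).comp r
    (contDiffAt_const.sub (contDiffAt_const.mul h2))

theorem continuousAt_twist (hc : 0 < c) (p : ℂ × ℂ) :
    ContinuousAt (fun p : ℂ × ℂ => twist c s p.1 p.2) p := by
  refine continuous_fst.continuousAt.mul ?_
  refine (continuousAt_phase (sub_I_mul_ne_zero hc _)).comp (f := fun p : ℂ × ℂ =>
    (c : ℂ) - I * ((s * (p.1 * (starRingEnd ℂ) p.2).im : ℝ) : ℂ)) ?_
  have h1 : Continuous fun p : ℂ × ℂ => (p.1 * (starRingEnd ℂ) p.2).im :=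
    Complex.continuous_im.comp (continuous_fst.mul (Complex.continuous_conj.comp continuous_snd))
  have h2 : Continuous fun p : ℂ × ℂ => ((s * (p.1 * (starRingEnd ℂ) p.2).im : ℝ) : ℂ) :=
    Complex.continuous_ofReal.comp (continuous_const.mul h1)
  exact (continuous_const.sub (continuous_const.mul h2)).continuousAt

theorem norm_deriv_twist_le (hc : 0 < c) {u v : ℝ → ℂ} {u' v' : ℂ} {r : ℝ}
    (hu : HasDerivAt u u' r) (hv : HasDerivAt v v' r) (hu1 : ‖u r‖ ≤ 1) (hv1 : ‖v r‖ ≤ 1) :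
    ‖deriv (fun r => twist c s (u r) (v r)) r‖ ≤ (1 + 2 / c * |s|) * (‖u'‖ + ‖v'‖) := by
  have h1 : HasDerivAt (fun r => u r * (starRingEnd ℂ) (v r))
      (u' * (starRingEnd ℂ) (v r) + u r * (starRingEnd ℂ) v') r :=
    hu.mul (Complex.conjCLE.toContinuousLinearMap.hasFDerivAt.comp_hasDerivAt r hv)
  set w' := u' * (starRingEnd ℂ) (v r) + u r * (starRingEnd ℂ) v' with hw'
  have hw : ‖w'‖ ≤ ‖u'‖ + ‖v'‖ := by
    refine (norm_add_le _ _).trans ?_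
    rw [norm_mul, norm_mul, Complex.norm_conj, Complex.norm_conj]
    have := norm_nonneg u'
    have := norm_nonneg v'
    nlinarith
  have h2 : HasDerivAt (fun r => (c : ℂ) - I * ((s * (u r * (starRingEnd ℂ) (v r)).im : ℝ) : ℂ))
      (-(I * ((s * w'.im : ℝ) : ℂ))) r := by
    have h3 : HasDerivAt (fun r => (u r * (starRingEnd ℂ) (v r)).im) w'.im r :=
      Complex.imCLM.hasFDerivAt.comp_hasDerivAt r h1
    exact (((h3.const_mul s).ofReal_comp).const_mul I).const_sub _
  obtain ⟨p', hp, hp'⟩ := exists_hasDerivAt_phase h2 (sub_I_mul_ne_zero hc _)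
  have h4 : HasDerivAt (fun r => twist c s (u r) (v r)) (u' * phase ((c : ℂ) -
      I * ((s * (u r * (starRingEnd ℂ) (v r)).im : ℝ) : ℂ)) + u r * p') r := hu.mul hp
  rw [h4.deriv]
  have hp2 : ‖p'‖ ≤ 2 / c * |s| * (‖u'‖ + ‖v'‖) := by
    refine hp'.trans ?_
    rw [norm_neg, norm_mul, Complex.norm_I, one_mul, Complex.norm_real, Real.norm_eq_abs, abs_mul,
      mul_assoc]
    gcongr
    · exact le_norm_sub_I_mul c _
    · exact (Complex.abs_im_le_norm _).trans hw
  refine (norm_add_le _ _).trans ?_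
  rw [norm_mul, norm_mul]
  have h5 : ‖u'‖ * ‖phase ((c : ℂ) - I * ((s * (u r * (starRingEnd ℂ) (v r)).im : ℝ) : ℂ))‖
      ≤ ‖u'‖ * 1 := by gcongr; exact norm_phase_le _
  have h6 : ‖u r‖ * ‖p'‖ ≤ 1 * ‖p'‖ := by gcongr
  have := norm_nonneg v'
  linarith

theorem norm_twist (hc : 0 < c) {u v : ℂ} (hu : ‖u‖ = 1) : ‖twist c s u v‖ = 1 := by
  rw [twist, norm_mul, hu, norm_phase (sub_I_mul_ne_zero hc _), mul_one]

theorem sector_inequality {c T κ σ X Y N : ℝ} (hc : 0 < c) (hT : 0 ≤ -T) (hσ : σ ^ 2 = 1)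
    (hκ : 0 ≤ κ) (hκT : 0 ≤ c + κ * T) (hX : c * N ≤ X) (hY : |Y| ≤ -T * N) :
    κ * (c ^ 2 + T ^ 2) * N ≤ (κ * c - T) * X - σ * (c + κ * T) * Y := by
  have hσ1 : |σ| = 1 := by
    rw [← sq_eq_sq₀ (abs_nonneg _) zero_le_one, sq_abs, hσ, one_pow]
  have h1 : σ * (c + κ * T) * Y ≤ (c + κ * T) * (-T * N) := by
    calc σ * (c + κ * T) * Y ≤ |σ * (c + κ * T) * Y| := le_abs_self _
      _ = (c + κ * T) * |Y| := by rw [abs_mul, abs_mul, hσ1, one_mul, abs_of_nonneg hκT]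
      _ ≤ _ := mul_le_mul_of_nonneg_left hY hκT
  have h2 : (κ * c - T) * (c * N) ≤ (κ * c - T) * X :=
    mul_le_mul_of_nonneg_left hX (by linarith [mul_nonneg hκ hc.le])
  linarith

/-- The rotation of the quadratic form of `ς̃` by the conjugate of the symbol. With `w` the phase of
`d̃ / d`, the value `X + i Y` of the form lies in the sector `|Y| / X ≤ s |Im w| / c`; the
conjugate of the symbol turns this sector to one side of the real axis, and `κ + iσ`, for small `κ`,
turns the result into the right half plane. -/
theorem le_re_rotation_mul_form {smin smax cs pp qq h A B κ σ t : ℝ} {D d : ℂ} (hD : D ≠ 0)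
    (hd : d ≠ 0) (hA : 0 ≤ A) (hB : 0 ≤ B) (hpp : 0 ≤ pp) (hqq : 0 ≤ qq) (hsmax : 0 ≤ smax)
    (hppA : pp ≤ smax * A) (hqqB : qq ≤ smax * B)
    (hform : ∀ s t : ℝ, smin * (s ^ 2 * A + t ^ 2 * B) ≤ s ^ 2 * pp + 2 * s * t * h + t ^ 2 * qq)
    (hc : c = smin - (1 - cs) * smax) (hc0 : 0 < c) (hσ : σ ^ 2 = 1) (hκ : 0 ≤ κ)
    (hcs : cs ≤ (phase D * (starRingEnd ℂ) (phase d)).re)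
    (ht : |(phase D * (starRingEnd ℂ) (phase d)).im| ≤ -t) (hκt : κ * (smax * -t) ≤ c) :
    κ * c * (‖D‖ ^ 2 * A + ‖d‖ ^ 2 * B) / ‖d‖ ≤
      (((κ : ℂ) + I * σ) * (starRingEnd ℂ) (phase D *
        phase ((c : ℂ) - I * ((σ * smax * t : ℝ) : ℂ))) *
          (D ^ 2 / d * pp + 2 * D * h + d * qq)).re := by
  have hD' : 0 < ‖D‖ := norm_pos_iff.2 hD
  have hd' : 0 < ‖d‖ := norm_pos_iff.2 hd
  set w := phase D * (starRingEnd ℂ) (phase d) with hw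
  set N := ‖D‖ ^ 2 * A + ‖d‖ ^ 2 * B with hN
  set Z := ‖D‖ ^ 2 * pp + ‖d‖ ^ 2 * qq with hZ
  set X := Z * w.re + 2 * ‖D‖ * ‖d‖ * h with hX
  set Y := (‖D‖ ^ 2 * pp - ‖d‖ ^ 2 * qq) * w.im with hY
  set T := smax * t with hT
  set q := (c : ℂ) - I * ((σ * smax * t : ℝ) : ℂ) with hq
  have hn : c ≤ ‖q‖ := le_norm_sub_I_mul _ _
  have hn0 : 0 < ‖q‖ := hc0.trans_le hn
  have hn2 : ‖q‖ ^ 2 = c ^ 2 + T ^ 2 := by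
    rw [← Complex.normSq_eq_norm_sq, hq, Complex.normSq_apply]
    simp
    rw [hT]
    linear_combination (smax * t) ^ 2 * hσ
  have ht0 : t ≤ 0 := by linarith [abs_nonneg w.im]
  have hT0 : 0 ≤ -T := by rw [hT]; nlinarith
  -- the form, up to the phase of `D` and the factor `‖d‖`, equals `X + i Y`
  have hform' : (starRingEnd ℂ) (phase D) * (D ^ 2 / d * pp + 2 * D * h + d * qq) * (‖d‖ : ℂ) =
      (X : ℂ) + I * (Y : ℂ) := by
    have e1 := phase_mul_conj hD
    have e2 := phase_mul_conj hd
    have e3 : (d : ℂ)⁻¹ * (‖d‖ : ℂ) = (starRingEnd ℂ) (phase d) := by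
      rw [inv_mul_eq_div, div_eq_iff hd]
      linear_combination -(‖d‖ : ℂ) * e2 + (starRingEnd ℂ) (phase d) * norm_mul_phase d
    have e4 : w = (w.re : ℂ) + w.im * I := (Complex.re_add_im w).symm
    have e5 : (starRingEnd ℂ) w = (w.re : ℂ) - w.im * I := by
      apply Complex.ext <;> simp
    have e6 : (starRingEnd ℂ) w = (starRingEnd ℂ) (phase D) * phase d := by simp [hw]
    calc _ = (starRingEnd ℂ) (phase D) * (D ^ 2 * (d⁻¹ * (‖d‖ : ℂ)) * pp + 2 * D * h * ‖d‖
          + d * qq * ‖d‖) := by ring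
      _ = (‖D‖ : ℂ) ^ 2 * w * pp + 2 * ‖D‖ * ‖d‖ * h + (‖d‖ : ℂ) ^ 2 * (starRingEnd ℂ) w * qq := by
          rw [e3, e6]
          rw [hw]
          linear_combination -((starRingEnd ℂ) (phase D) * (starRingEnd ℂ) (phase d) * pp *
            (D + ‖D‖ * phase D) + 2 * h * ‖d‖ * (starRingEnd ℂ) (phase D)) * norm_mul_phase D
            - (starRingEnd ℂ) (phase D) * qq * ‖d‖ * norm_mul_phase d
            + ((‖D‖ : ℂ) ^ 2 * phase D * (starRingEnd ℂ) (phase d) * pp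
              + 2 * h * ‖d‖ * ‖D‖) * e1
      _ = _ := by
          rw [e5]
          conv_lhs => rw [e4]
          rw [hX, hY, hZ]
          push_cast
          simp only [Complex.add_re, Complex.ofReal_re, Complex.re_ofReal_mul, Complex.I_re,
            Complex.add_im, Complex.ofReal_im, Complex.im_ofReal_mul, Complex.I_im, mul_zero,
            mul_one, add_zero, zero_add]
          ring
  have hA' : 0 ≤ ‖D‖ ^ 2 * A := by positivity
  have hB' : 0 ≤ ‖d‖ ^ 2 * B := by positivity
  have hZ0 : 0 ≤ Z := by positivity
  have hZN : Z ≤ smax * N := by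
    rw [hZ, hN]
    nlinarith [mul_le_mul_of_nonneg_left hppA (sq_nonneg ‖D‖),
      mul_le_mul_of_nonneg_left hqqB (sq_nonneg ‖d‖)]
  have hw1 : w.re ≤ 1 := by
    refine (Complex.re_le_norm _).trans ?_
    rw [hw, norm_mul, Complex.norm_conj, norm_phase hD, norm_phase hd, one_mul]
  have hXN : c * N ≤ X := by
    have h1 := hform ‖D‖ ‖d‖
    have h2 : (1 - w.re) * Z ≤ (1 - cs) * (smax * N) :=
      (mul_le_mul_of_nonneg_right (by linarith) hZ0).trans
        (mul_le_mul_of_nonneg_left hZN (by linarith))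
    rw [hc, hX]
    nlinarith
  have hYN : |Y| ≤ -T * N := by
    have h1 : |‖D‖ ^ 2 * pp - ‖d‖ ^ 2 * qq| ≤ Z := by
      rw [abs_le, hZ]
      have := mul_nonneg (sq_nonneg ‖D‖) hpp
      have := mul_nonneg (sq_nonneg ‖d‖) hqq
      constructor <;> linarith
    calc |Y| = |‖D‖ ^ 2 * pp - ‖d‖ ^ 2 * qq| * |w.im| := by rw [hY, abs_mul]
      _ ≤ (smax * N) * -t := mul_le_mul (h1.trans hZN) ht (abs_nonneg _) (hZ0.trans hZN)
      _ = _ := by rw [hT]; ring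
  have hre : (((κ : ℂ) + I * σ) * (starRingEnd ℂ) (phase D * phase q) *
      (D ^ 2 / d * pp + 2 * D * h + d * qq)).re * (‖q‖ * ‖d‖) =
        (κ * c - T) * X - σ * (c + κ * T) * Y := by
    have e1 : (starRingEnd ℂ) (phase q) * (‖q‖ : ℂ) = (c : ℂ) + I * (σ * T : ℝ) := by
      have : (starRingEnd ℂ) (phase q) * (‖q‖ : ℂ) = (starRingEnd ℂ) q := by
        conv_rhs => rw [← norm_mul_phase q]
        rw [map_mul, Complex.conj_ofReal, mul_comm]
      rw [this, hq, hT]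
      simp
      ring
    have e2 : (((κ : ℂ) + I * σ) * (starRingEnd ℂ) (phase D * phase q) *
        (D ^ 2 / d * pp + 2 * D * h + d * qq)) * ((‖q‖ * ‖d‖ : ℝ) : ℂ) =
        ((κ : ℂ) + I * σ) * ((c : ℂ) + I * (σ * T : ℝ)) * ((X : ℂ) + I * (Y : ℂ)) := by
      rw [← hform', ← e1, map_mul]
      push_cast
      ring
    have e3 := congrArg Complex.re e2
    rw [Complex.re_mul_ofReal] at e3
    rw [e3]
    simp
    linear_combination (-T * X) * hσ
  have hfin := sector_inequality (N := N) hc0 hT0 hσ hκ (by rw [hT]; linarith) hXN hYN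
  rw [← hn2] at hfin
  rw [div_le_iff₀ hd', ← mul_le_mul_iff_left₀ hn0]
  calc κ * c * N * ‖q‖ ≤ κ * ‖q‖ * N * ‖q‖ := by gcongr
    _ = κ * ‖q‖ ^ 2 * N := by ring
    _ ≤ _ := by
        refine hfin.trans_eq ?_
        rw [← hre]
        ring

end Phases

/-! ### The radial profile and its phases -/

section Profile

open Complex (I)

variable {r₀ r₁ : ℝ} {γ : ℂ} {a : ℝ → ℝ}

namespace ProfileAssumption

theorem r₁_pos (hr₀ : 0 < r₀) (h : ProfileAssumption r₀ r₁ γ a) : 0 < r₁ := hr₀.trans h.r₀_lt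

theorem one_le_re (h : ProfileAssumption r₀ r₁ γ a) {t : ℝ} (ht : 0 ≤ t) :
    1 ≤ (1 + γ * (t : ℂ)).re := by
  simpa using mul_nonneg h.γ_re ht

theorem one_le_norm (h : ProfileAssumption r₀ r₁ γ a) {t : ℝ} (ht : 0 ≤ t) :
    1 ≤ ‖1 + γ * (t : ℂ)‖ :=
  (h.one_le_re ht).trans (Complex.re_le_norm _)

theorem le_alpha (h : ProfileAssumption r₀ r₁ γ a) {r : ℝ} (hr : 0 ≤ r) : a r ≤ alpha a r := by
  rcases hr.eq_or_lt with rfl | hr'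
  · simp [alpha]
  have h1 : 0 ≤ deriv a r := by
    rw [← derivWithin_of_mem_nhds (Ici_mem_nhds hr')]
    exact h.monotone.derivWithin_nonneg
  have := mul_nonneg hr h1
  rw [alpha]
  linarith

theorem alpha_nonneg (h : ProfileAssumption r₀ r₁ γ a) {r : ℝ} (hr : 0 ≤ r) : 0 ≤ alpha a r :=
  (h.nonneg r hr).trans (h.le_alpha hr)

theorem one_le_norm_dTilde (h : ProfileAssumption r₀ r₁ γ a) {r : ℝ} (hr : 0 ≤ r) :
    1 ≤ ‖dTilde γ a r‖ := h.one_le_norm (h.nonneg r hr)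

theorem one_le_norm_dFun (h : ProfileAssumption r₀ r₁ γ a) {r : ℝ} (hr : 0 ≤ r) :
    1 ≤ ‖dFun γ a r‖ := h.one_le_norm (h.alpha_nonneg hr)

theorem dTilde_ne_zero (h : ProfileAssumption r₀ r₁ γ a) {r : ℝ} (hr : 0 ≤ r) :
    dTilde γ a r ≠ 0 := norm_pos_iff.1 (one_pos.trans_le (h.one_le_norm_dTilde hr))

theorem dFun_ne_zero (h : ProfileAssumption r₀ r₁ γ a) {r : ℝ} (hr : 0 ≤ r) :
    dFun γ a r ≠ 0 := norm_pos_iff.1 (one_pos.trans_le (h.one_le_norm_dFun hr))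

theorem exists_norm_le (h : ProfileAssumption r₀ r₁ γ a) :
    ∃ C, 1 ≤ C ∧ ∀ r, 0 ≤ r → ‖dTilde γ a r‖ ≤ C ∧ ‖dFun γ a r‖ ≤ C := by
  obtain ⟨C₁, h1⟩ := h.bounded
  obtain ⟨C₂, h2⟩ := h.alpha_bounded
  set M := max C₁ (max C₂ |alpha a r₁|)
  have key : ∀ t : ℝ, |t| ≤ M → ‖1 + γ * (t : ℂ)‖ ≤ 1 + ‖γ‖ * M := fun t ht => by
    refine (norm_add_le _ _).trans ?_
    rw [norm_one, norm_mul, Complex.norm_real, Real.norm_eq_abs]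
    gcongr
  have hM : 0 ≤ M := (abs_nonneg _).trans ((le_max_right _ _).trans (le_max_right _ _))
  refine ⟨1 + ‖γ‖ * M, by linarith [mul_nonneg (norm_nonneg γ) hM], fun r hr =>
    ⟨key _ ((h1 r hr).trans (le_max_left _ _)), key _ ?_⟩⟩
  by_cases hr1 : r = r₁
  · rw [hr1]; exact (le_max_right _ _).trans (le_max_right _ _)
  · exact (h2 r hr hr1).trans ((le_max_left _ _).trans (le_max_right _ _))

theorem dTilde_eq_one (h : ProfileAssumption r₀ r₁ γ a) {r : ℝ} (hr : 0 ≤ r) (hr1 : r ≤ r₁) :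
    dTilde γ a r = 1 := by simp [dTilde, h.eq_zero r hr hr1]

theorem dFun_eq_one (h : ProfileAssumption r₀ r₁ γ a) {r : ℝ} (hr : 0 ≤ r) (hr1 : r < r₁) :
    dFun γ a r = 1 := by
  rcases hr.eq_or_lt with rfl | hr'
  · simp [dFun, alpha, h.eq_zero 0 le_rfl hr1.le]
  have h1 : a =ᶠ[𝓝 r] fun _ => 0 := by
    filter_upwards [Ioo_mem_nhds hr' hr1] with s hs
    exact h.eq_zero s hs.1.le hs.2.le
  simp [dFun, alpha, h1.deriv_eq, h.eq_zero r hr hr1.le]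

theorem le_alphaHat (hr₀ : 0 < r₀) (h : ProfileAssumption r₀ r₁ γ a) {r : ℝ} (hr : 0 ≤ r) :
    a r ≤ alphaHat r₁ a r := by
  rw [alphaHat]
  split_ifs with h1
  · rw [h.eq_zero r hr h1]
    refine ge_of_tendsto (h.tendsto_alpha hr₀) ?_
    filter_upwards [self_mem_nhdsWithin] with s hs
    exact h.alpha_nonneg ((h.r₁_pos hr₀).trans hs).le
  · exact h.le_alpha hr

theorem dHat_ne_zero (hr₀ : 0 < r₀) (h : ProfileAssumption r₀ r₁ γ a) {r : ℝ} (hr : 0 ≤ r) :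
    dHat r₁ γ a r ≠ 0 :=
  norm_pos_iff.1 (one_pos.trans_le (h.one_le_norm ((h.nonneg r hr).trans (h.le_alphaHat hr₀ hr))))

theorem dHat_eq_dFun {r : ℝ} (hr : r₁ < r) : dHat r₁ γ a r = dFun γ a r := by
  rw [dHat, alphaHat, if_neg hr.not_ge, dFun]

/-- The argument of `1 + γ t` increases with `t`. -/
theorem im_phase_nonpos (h : ProfileAssumption r₀ r₁ γ a) {s t : ℝ} (hst : s ≤ t) :
    (phase (1 + γ * (s : ℂ)) * (starRingEnd ℂ) (phase (1 + γ * (t : ℂ)))).im ≤ 0 := by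
  have h1 : phase (1 + γ * (s : ℂ)) * (starRingEnd ℂ) (phase (1 + γ * (t : ℂ))) =
      ((1 + γ * (s : ℂ)) * (starRingEnd ℂ) (1 + γ * (t : ℂ))) /
        ((‖1 + γ * (s : ℂ)‖ * ‖1 + γ * (t : ℂ)‖ : ℝ) : ℂ) := by
    simp only [phase, map_div₀, Complex.conj_ofReal]
    push_cast
    rw [div_mul_div_comm]
  rw [h1, Complex.div_ofReal_im]
  refine div_nonpos_of_nonpos_of_nonneg ?_ (by positivity)
  simp
  nlinarith [mul_le_mul_of_nonneg_left hst h.γ_im.le]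

theorem contDiffAt (h : ProfileAssumption r₀ r₁ γ a) {r : ℝ} (hr : r₁ < r) : ContDiffAt ℝ 2 a r :=
  h.contDiff.contDiffAt (Ioi_mem_nhds hr)

theorem contDiffAt_alpha (h : ProfileAssumption r₀ r₁ γ a) {r : ℝ} (hr : r₁ < r) :
    ContDiffAt ℝ 1 (alpha a) r := by
  have h1 : ContDiffAt ℝ 1 (deriv a) r :=
    (h.contDiff.deriv_of_isOpen isOpen_Ioi (by norm_num)).contDiffAt (Ioi_mem_nhds hr)
  exact (contDiffAt_id.mul h1).add ((h.contDiffAt hr).of_le (by norm_num))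

theorem contDiffAt_dTilde (h : ProfileAssumption r₀ r₁ γ a) {r : ℝ} (hr : r₁ < r) :
    ContDiffAt ℝ 1 (dTilde γ a) r :=
  contDiffAt_const.add (contDiffAt_const.mul
    (Complex.ofRealCLM.contDiff.contDiffAt.comp r ((h.contDiffAt hr).of_le (by norm_num))))

theorem contDiffAt_dFun (h : ProfileAssumption r₀ r₁ γ a) {r : ℝ} (hr : r₁ < r) :
    ContDiffAt ℝ 1 (dFun γ a) r :=
  contDiffAt_const.add (contDiffAt_const.mul
    (Complex.ofRealCLM.contDiff.contDiffAt.comp r (h.contDiffAt_alpha hr)))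

theorem contDiffAt_phase_dTilde (hr₀ : 0 < r₀) (h : ProfileAssumption r₀ r₁ γ a) {r : ℝ}
    (hr : r₁ < r) : ContDiffAt ℝ 1 (fun r => phase (dTilde γ a r)) r :=
  (contDiffAt_phase (h.dTilde_ne_zero ((h.r₁_pos hr₀).trans hr).le)).comp r (h.contDiffAt_dTilde hr)

theorem contDiffAt_phase_dFun (hr₀ : 0 < r₀) (h : ProfileAssumption r₀ r₁ γ a) {r : ℝ}
    (hr : r₁ < r) : ContDiffAt ℝ 1 (fun r => phase (dFun γ a r)) r :=
  (contDiffAt_phase (h.dFun_ne_zero ((h.r₁_pos hr₀).trans hr).le)).comp r (h.contDiffAt_dFun hr)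

theorem norm_deriv_phase_le {g : ℝ → ℂ} {f : ℝ → ℝ} {f' r : ℝ} (hg : g = fun r => 1 + γ * (f r : ℂ))
    (hf : HasDerivAt f f' r) (h1 : 1 ≤ ‖g r‖) : ‖deriv (fun r => phase (g r)) r‖ ≤ 2 * (‖γ‖ * |f'|) := by
  have h2 : HasDerivAt g (γ * (f' : ℂ)) r := by
    rw [hg]
    exact (hf.ofReal_comp.const_mul γ).const_add 1
  obtain ⟨u', hu, hu'⟩ := exists_hasDerivAt_phase h2 (norm_pos_iff.1 (one_pos.trans_le h1))
  rw [hu.deriv]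
  refine hu'.trans ?_
  rw [norm_mul, Complex.norm_real, Real.norm_eq_abs]
  gcongr
  exact div_le_self zero_le_two h1

/-- The derivatives of the phases of `d̃` and `d` are bounded next to `r₁`. -/
theorem eventually_norm_deriv_phase_le (hr₀ : 0 < r₀) (h : ProfileAssumption r₀ r₁ γ a) :
    ∃ C, ∀ᶠ r in 𝓝[>] r₁, ‖deriv (fun r => phase (dTilde γ a r)) r‖ ≤ C ∧
      ‖deriv (fun r => phase (dFun γ a r)) r‖ ≤ C := by
  obtain ⟨l₁, h1⟩ := h.deriv_extends
  obtain ⟨l₂, h2⟩ := h.deriv2_extends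
  have hid : Tendsto (fun r : ℝ => r) (𝓝[>] r₁) (𝓝 r₁) := tendsto_id.mono_left nhdsWithin_le_nhds
  have h3 := (h1.abs).eventually_le_const (lt_add_one |l₁|)
  have h4 := ((hid.mul h2).add (h1.const_mul 2)).abs.eventually_le_const
    (lt_add_one |r₁ * l₂ + 2 * l₁|)
  refine ⟨max (2 * (‖γ‖ * (|l₁| + 1))) (2 * (‖γ‖ * (|r₁ * l₂ + 2 * l₁| + 1))), ?_⟩
  filter_upwards [h3, h4, self_mem_nhdsWithin] with r hr3 hr4 hr
  have hr0 : 0 ≤ r := ((h.r₁_pos hr₀).trans hr).le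
  have hd : HasDerivAt a (deriv a r) r :=
    ((h.contDiffAt hr).differentiableAt (by norm_num)).hasDerivAt
  have hdd : HasDerivAt (deriv a) (deriv (deriv a) r) r :=
    (((h.contDiff.deriv_of_isOpen (m := 1) isOpen_Ioi (by norm_num)).contDiffAt
      (Ioi_mem_nhds hr)).differentiableAt (by norm_num)).hasDerivAt
  have hal : HasDerivAt (alpha a) (r * deriv (deriv a) r + 2 * deriv a r) r := by
    have := ((hasDerivAt_id r).mul hdd).add hd
    refine this.congr_deriv ?_
    simp
    ring
  constructor
  · refine ((norm_deriv_phase_le rfl hd (h.one_le_norm_dTilde hr0)).trans ?_).trans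
      (le_max_left _ _)
    gcongr
  · refine ((norm_deriv_phase_le rfl hal (h.one_le_norm_dFun hr0)).trans ?_).trans
      (le_max_right _ _)
    gcongr

theorem re_phase_ge (h : ProfileAssumption r₀ r₁ γ a) {r : ℝ} (hr : 0 ≤ r) (hr1 : r ≠ r₁) :
    Real.cos (tauStar r₁ γ a) ≤
      (phase (dTilde γ a r) * (starRingEnd ℂ) (phase (dFun γ a r))).re := by
  rcases lt_or_gt_of_ne hr1 with h1 | h1
  · rw [h.dTilde_eq_one hr h1.le, h.dFun_eq_one hr h1]
    simpa [phase] using Real.cos_le_one _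
  · have h2 : |(dTilde γ a r / dFun γ a r).arg| ≤ tauStar r₁ γ a :=
      le_ciSup (f := fun r : Set.Ioi r₁ => |(dTilde γ a r / dFun γ a r).arg|)
        ⟨Real.pi, by rintro _ ⟨s, rfl⟩; exact Complex.abs_arg_le_pi _⟩ ⟨r, h1⟩
    have h3 : tauStar r₁ γ a ≤ Real.pi := by
      have : Nonempty (Set.Ioi r₁) := ⟨⟨r, h1⟩⟩
      exact ciSup_le fun s => Complex.abs_arg_le_pi _
    rw [← phase_div, ← cos_arg_eq_re_phase (div_ne_zero (h.dTilde_ne_zero hr) (h.dFun_ne_zero hr)),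
      ← Real.cos_abs (Complex.arg _)]
    exact Real.cos_le_cos_of_nonneg_of_le_pi (abs_nonneg _) h3 h2

end ProfileAssumption

/-- The phase of `d̃ / d` tends to `1` at infinity, so that the phases of `d̃` and `d` both tend to `d₀`. -/
theorem PhaseAssumption.tendsto_phase_dFun (h : ProfileAssumption r₀ r₁ γ a)
    (hp : PhaseAssumption γ a) : Tendsto (fun r => phase (dFun γ a r)) atTop (𝓝 (d0 γ a)) := by
  have h1 := h.tendsto_d0.div hp.ratio one_ne_zero
  rw [div_one] at h1
  refine h1.congr' ?_
  filter_upwards [eventually_ge_atTop 0] with r hr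
  have e1 : (‖dTilde γ a r‖ : ℂ) ≠ 0 := by exact_mod_cast norm_ne_zero_iff.2 (h.dTilde_ne_zero hr)
  have e2 : (‖dFun γ a r‖ : ℂ) ≠ 0 := by exact_mod_cast norm_ne_zero_iff.2 (h.dFun_ne_zero hr)
  have e3 := h.dTilde_ne_zero hr
  have e4 := h.dFun_ne_zero hr
  simp only [Pi.div_apply, phase]
  field_simp

theorem ProfileAssumption.norm_d0 (h : ProfileAssumption r₀ r₁ γ a) : ‖d0 γ a‖ = 1 := by
  refine tendsto_nhds_unique h.tendsto_d0.norm (tendsto_const_nhds.congr' ?_)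
  filter_upwards [eventually_ge_atTop 0] with r hr
  exact (norm_phase (h.dTilde_ne_zero hr)).symm

end Profile

/-! ### The symbol of the multiplication operator -/

section Symbol

open Complex (I)

/-- A function that is constant on `[0, r₁]` and continuously differentiable with bounded derivative
on `(r₁, ∞)` gives a radial multiplier. -/
theorem isMultiplier_radial {m : ℝ → ℂ} {r₁ B : ℝ} {C : NNReal} (hr₁ : 0 < r₁)
    (hconst : ∀ r, 0 ≤ r → r ≤ r₁ → m r = m r₁) (hcont : ContinuousWithinAt m (Set.Ioi r₁) r₁)
    (hC1 : ∀ r, r₁ < r → ContDiffAt ℝ 1 m r) (hb : ∀ r, r₁ < r → ‖deriv m r‖ ≤ C)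
    (hn : ∀ r, 0 ≤ r → ‖m r‖ ≤ B) : IsMultiplier (fun x : R3 => m ‖x‖) C B := by
  have hlip : LipschitzOnWith C m (Set.Ici r₁) := by
    have h1 : LipschitzOnWith C m (Set.Ioi r₁) :=
      (convex_Ioi r₁).lipschitzOnWith_of_nnnorm_deriv_le
        (fun r hr => (hC1 r hr).differentiableAt (by norm_num)) fun r hr => hb r hr
    rw [← closure_Ioi]
    refine h1.closure ?_
    rw [closure_Ioi]
    intro r hr
    rcases (Set.mem_Ici.1 hr).eq_or_lt with rfl | hr'
    · rwa [← continuousWithinAt_Ioi_iff_Ici]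
    · exact (hC1 r hr').continuousAt.continuousWithinAt
  have heq : ∀ x : R3, m ‖x‖ = m (max ‖x‖ r₁) := fun x => by
    rcases le_total ‖x‖ r₁ with h | h
    · rw [max_eq_right h, hconst _ (norm_nonneg _) h]
    · rw [max_eq_left h]
  refine ⟨LipschitzWith.of_dist_le_mul fun x y => ?_, fun x => hn _ (norm_nonneg _), ?_⟩
  · simp only [heq]
    refine (hlip.dist_le_mul _ (Set.mem_Ici.2 (le_max_right _ _)) _
      (Set.mem_Ici.2 (le_max_right _ _))).trans ?_
    gcongr
    rw [Real.dist_eq]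
    refine (abs_max_sub_max_le_abs _ _ _).trans ?_
    rw [dist_eq_norm]
    exact abs_norm_sub_norm_le x y
  · have hae : ∀ᵐ x : R3, x ∉ Metric.sphere (0 : R3) r₁ :=
      measure_eq_zero_iff_ae_notMem.1 (Measure.addHaar_sphere volume 0 r₁)
    filter_upwards [hae] with x hx
    have hx' : ‖x‖ ≠ r₁ := by simpa using hx
    have hcd : ContDiffAt ℝ 1 (fun x : R3 => m ‖x‖) x := by
      rcases lt_or_gt_of_ne hx' with h | h
      · refine (contDiffAt_const (c := m r₁)).congr_of_eventuallyEq ?_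
        filter_upwards [continuous_norm.continuousAt.eventually_lt_const h] with y hy
        exact hconst _ (norm_nonneg _) hy.le
      · exact (hC1 _ h).comp x (contDiffAt_norm ℝ (norm_pos_iff.1 (hr₁.trans h)))
    exact hcd.hasStrictFDerivAt (by norm_num)

theorem norm_grad_radial_le {m : ℝ → ℂ} {x : R3} (hx : x ≠ 0) (hm : DifferentiableAt ℝ m ‖x‖) :
    ‖grad (fun x : R3 => m ‖x‖) x‖ ≤ 2 * ‖deriv m ‖x‖‖ := by
  rw [grad_eq_vecOf]
  refine (norm_vecOf_le _).trans ?_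
  have h1 : HasFDerivAt (fun x : R3 => ‖x‖) (fderiv ℝ (fun x : R3 => ‖x‖) x) x :=
    ((contDiffAt_norm ℝ hx (n := 1)).differentiableAt (by norm_num)).hasFDerivAt
  have h2 : ‖fderiv ℝ (fun x : R3 => ‖x‖) x‖ ≤ 1 := by
    simpa using norm_fderiv_le_of_lipschitz ℝ (lipschitzWith_one_norm (E := R3)) (x₀ := x)
  have h3 : ‖fderiv ℝ (fun x : R3 => m ‖x‖) x‖ ≤ ‖deriv m ‖x‖‖ := by
    have h4 := hm.hasDerivAt.hasFDerivAt.comp x h1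
    rw [show (fun x : R3 => m ‖x‖) = m ∘ fun x : R3 => ‖x‖ from rfl, h4.fderiv]
    refine (ContinuousLinearMap.opNorm_comp_le _ _).trans ?_
    refine (mul_le_of_le_one_right (norm_nonneg _) h2).trans ?_
    refine ContinuousLinearMap.opNorm_le_bound _ (norm_nonneg _) fun t => ?_
    simp [mul_comm]
  linarith

theorem IsMultiplier.conj {f : R3 → ℂ} {K : NNReal} {B : ℝ} (hf : IsMultiplier f K B) :
    IsMultiplier (fun x => (starRingEnd ℂ) (f x)) K B := by
  refine ⟨LipschitzWith.of_dist_le_mul fun x y => ?_, fun x => ?_, ?_⟩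
  · rw [Complex.dist_conj_conj]
    exact hf.lipschitz.dist_le_mul x y
  · rw [Complex.norm_conj]
    exact hf.bound x
  · filter_upwards [hf.strict] with x hx
    have h1 := Complex.conjCLE.toContinuousLinearMap.hasStrictFDerivAt.comp x hx
    have h2 := h1.hasFDerivAt.fderiv
    rw [← h2] at h1
    exact h1

theorem exists_norm_le_of_continuousOn_Ioi {f : ℝ → ℂ} {r₁ C : ℝ}
    (hc : ContinuousOn f (Set.Ioi r₁)) (h1 : ∀ᶠ r in 𝓝[>] r₁, ‖f r‖ ≤ C)
    (h2 : ∀ᶠ r in atTop, ‖f r‖ ≤ C) : ∃ C' : NNReal, ∀ r, r₁ < r → ‖f r‖ ≤ C' := by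
  obtain ⟨b, hb, hb'⟩ := (mem_nhdsGT_iff_exists_Ioo_subset).1 h1
  obtain ⟨R, hR⟩ := eventually_atTop.1 h2
  obtain ⟨M, hM⟩ := isCompact_Icc.exists_bound_of_continuousOn
    (hc.mono fun r (hr : r ∈ Set.Icc b R) => (Set.mem_Ioi.1 hb).trans_le hr.1)
  refine ⟨(max C M).toNNReal, fun r hr => le_trans ?_ (Real.le_coe_toNNReal _)⟩
  rcases lt_or_ge r b with h | h
  · exact (hb' ⟨hr, h⟩ : ‖f r‖ ≤ C).trans (le_max_left _ _)
  rcases le_total r R with h' | h'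
  · exact (hM r ⟨h, h'⟩).trans (le_max_right _ _)
  · exact (hR r h').trans (le_max_left _ _)

variable {ς : Matrix (Fin 3) (Fin 3) ℝ} {r₀ r₁ : ℝ} {γ : ℂ} {a : ℝ → ℝ} {ω : ℂ}

/-- The constant `ς_min - (1 - cos τ_*) ς_max`, positive by the anisotropy condition. -/
def anisoConst (ς : Matrix (Fin 3) (Fin 3) ℝ) (r₁ : ℝ) (γ : ℂ) (a : ℝ → ℝ) : ℝ :=
  sMin ς - (1 - Real.cos (tauStar r₁ γ a)) * sMax ς

theorem anisoConst_pos (hς : ς.PosDef)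
    (haniso : 1 - sMin ς / sMax ς < Real.cos (tauStar r₁ γ a)) : 0 < anisoConst ς r₁ γ a := by
  have h := sMax_pos hς
  have h1 : 1 - Real.cos (tauStar r₁ γ a) < sMin ς / sMax ς := by linarith
  rw [lt_div_iff₀ h] at h1
  rw [anisoConst]
  linarith

/-- The sign with which `ψ̂` enters the symbol. -/
def symbolSign (γ : ℂ) (a : ℝ → ℝ) (ω : ℂ) : ℝ := if (-ω ^ 2 * d0 γ a ^ 2).arg ≤ 0 then 1 else -1

theorem symbolSign_sq : symbolSign γ a ω ^ 2 = 1 := by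
  rw [symbolSign]
  split_ifs <;> norm_num

theorem symbolT_eq_twist (hc : 0 < anisoConst ς r₁ γ a) (r : ℝ) :
    symbolT ς r₁ γ a ω r = twist (anisoConst ς r₁ γ a) (symbolSign γ a ω * sMax ς)
      (phase (dTilde γ a r)) (phase (dHat r₁ γ a r)) := by
  have h1 : psiHat ς r₁ γ a r = ((anisoConst ς r₁ γ a : ℂ) - I * ((sMax ς *
      (phase (dTilde γ a r) * (starRingEnd ℂ) (phase (dHat r₁ γ a r))).im : ℝ) : ℂ)).arg := by
    rw [psiHat, tauHat, sin_arg_eq_im_phase, phase_div]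
    rfl
  rw [symbolT, norm_div_conj, h1, exp_arg_mul_I (sub_I_mul_ne_zero hc _),
    exp_neg_arg_mul_I (sub_I_mul_ne_zero hc _), twist, symbolSign]
  congr 1
  split_ifs
  · rw [one_mul]
  · rw [← phase_conj (_ - _)]
    congr 1
    rw [map_sub, map_mul, Complex.conj_I, Complex.conj_ofReal, Complex.conj_ofReal]
    push_cast
    ring

/-- The part of the symbol outside of `B_{r₁}`, where `d̂ = d`. -/
theorem symbolT_eq_twist_dFun (hc : 0 < anisoConst ς r₁ γ a) {r : ℝ} (hr : r₁ < r) :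
    symbolT ς r₁ γ a ω r = twist (anisoConst ς r₁ γ a) (symbolSign γ a ω * sMax ς)
      (phase (dTilde γ a r)) (phase (dFun γ a r)) := by
  rw [symbolT_eq_twist hc, ProfileAssumption.dHat_eq_dFun hr]

theorem norm_symbolT (h : ProfileAssumption r₀ r₁ γ a) (hc : 0 < anisoConst ς r₁ γ a) {r : ℝ}
    (hr : 0 ≤ r) : ‖symbolT ς r₁ γ a ω r‖ = 1 := by
  rw [symbolT_eq_twist hc, norm_twist hc (norm_phase (h.dTilde_ne_zero hr))]

theorem contDiffAt_symbolT (hr₀ : 0 < r₀) (h : ProfileAssumption r₀ r₁ γ a)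
    (hc : 0 < anisoConst ς r₁ γ a) {r : ℝ} (hr : r₁ < r) :
    ContDiffAt ℝ 1 (symbolT ς r₁ γ a ω) r := by
  refine (contDiffAt_twist (s := symbolSign γ a ω * sMax ς) hc (h.contDiffAt_phase_dTilde hr₀ hr)
    (h.contDiffAt_phase_dFun hr₀ hr)).congr_of_eventuallyEq ?_
  filter_upwards [Ioi_mem_nhds hr] with s hs
  exact symbolT_eq_twist_dFun hc hs

theorem norm_deriv_symbolT_le (hr₀ : 0 < r₀) (h : ProfileAssumption r₀ r₁ γ a)
    (hc : 0 < anisoConst ς r₁ γ a) {r : ℝ} (hr : r₁ < r) :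
    ‖deriv (symbolT ς r₁ γ a ω) r‖ ≤
      (1 + 2 / anisoConst ς r₁ γ a * |symbolSign γ a ω * sMax ς|) *
        (‖deriv (fun r => phase (dTilde γ a r)) r‖ + ‖deriv (fun r => phase (dFun γ a r)) r‖) := by
  have h1 : symbolT ς r₁ γ a ω =ᶠ[𝓝 r] fun r => twist (anisoConst ς r₁ γ a)
      (symbolSign γ a ω * sMax ς) (phase (dTilde γ a r)) (phase (dFun γ a r)) := by
    filter_upwards [Ioi_mem_nhds hr] with s hs
    exact symbolT_eq_twist_dFun hc hs
  rw [h1.deriv_eq]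
  exact norm_deriv_twist_le hc
    ((h.contDiffAt_phase_dTilde hr₀ hr).differentiableAt (by norm_num)).hasDerivAt
    ((h.contDiffAt_phase_dFun hr₀ hr).differentiableAt (by norm_num)).hasDerivAt
    (norm_phase_le _) (norm_phase_le _)

theorem tendsto_deriv_symbolT (hr₀ : 0 < r₀) (h : ProfileAssumption r₀ r₁ γ a)
    (hp : PhaseAssumption γ a) (hc : 0 < anisoConst ς r₁ γ a) :
    Tendsto (fun r => ‖deriv (symbolT ς r₁ γ a ω) r‖) atTop (𝓝 0) := by
  have h1 := (hp.deriv_dTilde.norm.add hp.deriv_dFun.norm).const_mul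
    (1 + 2 / anisoConst ς r₁ γ a * |symbolSign γ a ω * sMax ς|)
  simp only [norm_zero, add_zero, mul_zero] at h1
  refine squeeze_zero' (Eventually.of_forall fun _ => norm_nonneg _) ?_ h1
  filter_upwards [eventually_gt_atTop r₁] with r hr
  exact norm_deriv_symbolT_le hr₀ h hc hr

theorem continuousWithinAt_symbolT (hr₀ : 0 < r₀) (h : ProfileAssumption r₀ r₁ γ a)
    (hc : 0 < anisoConst ς r₁ γ a) :
    ContinuousWithinAt (symbolT ς r₁ γ a ω) (Set.Ioi r₁) r₁ := by
  have hr₁ := h.r₁_pos hr₀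
  have h1 : Tendsto (dTilde γ a) (𝓝[>] r₁) (𝓝 (dTilde γ a r₁)) := by
    refine tendsto_const_nhds.add (tendsto_const_nhds.mul
      ((Complex.continuous_ofReal.tendsto _).comp ?_))
    exact (h.continuous r₁ hr₁.le).mono_left (nhdsWithin_mono _ fun x hx => (hr₁.trans hx).le)
  have h2 : Tendsto (dHat r₁ γ a) (𝓝[>] r₁) (𝓝 (dHat r₁ γ a r₁)) := by
    refine tendsto_const_nhds.add (tendsto_const_nhds.mul
      ((Complex.continuous_ofReal.tendsto _).comp ?_))
    rw [alphaHat, if_pos le_rfl]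
    refine (h.tendsto_alpha hr₀).congr' ?_
    filter_upwards [self_mem_nhdsWithin] with s hs
    rw [alphaHat, if_neg (not_le.2 hs)]
  have h3 := ((continuousAt_phase (h.dTilde_ne_zero hr₁.le)).tendsto.comp h1).prodMk_nhds
    ((continuousAt_phase (h.dHat_ne_zero hr₀ hr₁.le)).tendsto.comp h2)
  have h4 := (continuousAt_twist (s := symbolSign γ a ω * sMax ς) hc _).tendsto.comp h3
  rw [ContinuousWithinAt, symbolT_eq_twist hc]
  exact h4.congr fun r => (symbolT_eq_twist hc r).symm

theorem exists_isMultiplier_symbolT (hr₀ : 0 < r₀) (h : ProfileAssumption r₀ r₁ γ a)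
    (hp : PhaseAssumption γ a) (hc : 0 < anisoConst ς r₁ γ a) :
    ∃ K, IsMultiplier (fun x : R3 => symbolT ς r₁ γ a ω ‖x‖) K 1 := by
  set C₀ := 1 + 2 / anisoConst ς r₁ γ a * |symbolSign γ a ω * sMax ς| with hC₀
  have hC₀' : 0 ≤ C₀ := by positivity
  obtain ⟨C, hC⟩ := h.eventually_norm_deriv_phase_le hr₀
  have hc1 : ContinuousOn (deriv (symbolT ς r₁ γ a ω)) (Set.Ioi r₁) := by
    have h1 : ContDiffOn ℝ 1 (symbolT ς r₁ γ a ω) (Set.Ioi r₁) := fun r hr =>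
      (contDiffAt_symbolT hr₀ h hc hr).contDiffWithinAt
    exact h1.continuousOn_deriv_of_isOpen isOpen_Ioi le_rfl
  obtain ⟨K, hK⟩ := exists_norm_le_of_continuousOn_Ioi (C := max (C₀ * (C + C)) 1) hc1 (by
      filter_upwards [hC, self_mem_nhdsWithin] with r hr hr'
      refine (norm_deriv_symbolT_le hr₀ h hc hr').trans (le_trans ?_ (le_max_left _ _))
      gcongr
      exacts [hr.1, hr.2]) (by
      filter_upwards [(tendsto_deriv_symbolT hr₀ h hp hc).eventually_le_const one_pos] with r hr
      exact hr.trans (le_max_right _ _))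
  refine ⟨K, isMultiplier_radial (h.r₁_pos hr₀) (fun r hr hr1 => ?_)
    (continuousWithinAt_symbolT hr₀ h hc) (fun r hr => contDiffAt_symbolT hr₀ h hc hr) hK
    fun r hr => (norm_symbolT h hc hr).le⟩
  rw [symbolT_eq_twist hc, symbolT_eq_twist hc, h.dTilde_eq_one hr hr1,
    h.dTilde_eq_one (h.r₁_pos hr₀).le le_rfl, dHat, dHat, alphaHat, alphaHat, if_pos hr1,
    if_pos le_rfl]

end Symbol

/-! ### The operator of the form -/

section Operator

open Complex (I)

variable {Ω : Set R3} {ς : Matrix (Fin 3) (Fin 3) ℝ} {r₀ r₁ : ℝ} {γ : ℂ} {a : ℝ → ℝ} {ω : ℂ}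

theorem ProfileAssumption.measurable_dTilde (h : ProfileAssumption r₀ r₁ γ a) :
    Measurable fun x : R3 => dTilde γ a ‖x‖ := by
  have h1 : Measurable fun x : R3 => a ‖x‖ :=
    (h.continuous.comp_continuous continuous_norm fun x => norm_nonneg x).measurable
  exact ((Complex.measurable_ofReal.comp h1).const_mul γ).const_add 1

theorem ProfileAssumption.measurable_dFun (h : ProfileAssumption r₀ r₁ γ a) :
    Measurable fun x : R3 => dFun γ a ‖x‖ := by
  have h1 : Measurable fun x : R3 => a ‖x‖ :=
    (h.continuous.comp_continuous continuous_norm fun x => norm_nonneg x).measurable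
  have h2 : Measurable fun x : R3 => deriv a ‖x‖ := (measurable_deriv a).comp measurable_norm
  exact ((Complex.measurable_ofReal.comp ((measurable_norm.mul h2).add h1)).const_mul γ).const_add 1

theorem sigmaOp_eq_sum (x : R3) : sigmaOp ς γ a x = ∑ i, ∑ j, sigmaTilde ς γ a x i j •
    Matrix.toEuclideanCLM (n := Fin 3) (𝕜 := ℂ) (Matrix.single i j 1) := by
  rw [sigmaOp]
  conv_lhs => rw [Matrix.matrix_eq_sum_single (sigmaTilde ς γ a x)]
  simp only [map_sum]
  refine Finset.sum_congr rfl fun i _ => Finset.sum_congr rfl fun j _ => ?_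
  rw [← map_smul, Matrix.smul_single, smul_eq_mul, mul_one]

theorem ProfileAssumption.stronglyMeasurable_sigmaOp (h : ProfileAssumption r₀ r₁ γ a) :
    StronglyMeasurable (sigmaOp ς γ a) := by
  have hD := h.measurable_dTilde
  have hd := h.measurable_dFun
  have hF : ∀ i j, Measurable fun x : R3 => frameMatrix γ a x i j := fun i j => by
    simp only [frameMatrix, radialProj, Matrix.add_apply, Matrix.smul_apply, Matrix.sub_apply,
      Matrix.of_apply, smul_eq_mul]
    fun_prop
  have hS : ∀ i j, Measurable fun x : R3 => sigmaTilde ς γ a x i j := fun i j => by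
    simp only [sigmaTilde, Matrix.smul_apply, Matrix.mul_apply, smul_eq_mul]
    fun_prop
  simp only [funext sigmaOp_eq_sum]
  exact Finset.stronglyMeasurable_fun_sum _ fun i _ => Finset.stronglyMeasurable_fun_sum _
    fun j _ => (hS i j).stronglyMeasurable.smul_const _

theorem ProfileAssumption.exists_norm_sigmaOp_le (ς : Matrix (Fin 3) (Fin 3) ℝ)
    (h : ProfileAssumption r₀ r₁ γ a) : ∃ S, 0 < S ∧ ∀ x, ‖sigmaOp ς γ a x‖ ≤ S := by
  obtain ⟨C, hC1, hC⟩ := h.exists_norm_le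
  refine ⟨(3 * C ^ 2) ^ 2 * ‖complexify ς‖ + 1, by positivity, fun x => ?_⟩
  have h1 := norm_sigmaOp_le (ς := ς) x (h.one_le_norm_dTilde (norm_nonneg x))
    (h.one_le_norm_dFun (norm_nonneg x)) (hC _ (norm_nonneg x)).1 (hC _ (norm_nonneg x)).2
  linarith

/-- A bounded form on `L² × L²` restricts to a form on `H¹₀(Ω)` that is given by an operator. -/
theorem exists_inner_eq_inner_add (b : Lp ℂ 2 (volume.restrict Ω) →L[ℂ] Lp ℂ 2 (volume.restrict Ω))
    (s : Lp C3 2 (volume.restrict Ω) →L[ℂ] Lp C3 2 (volume.restrict Ω)) :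
    ∃ A : H10 Ω →L[ℂ] H10 Ω, ∀ u u' : H10 Ω, inner ℂ u' (A u) =
      inner ℂ (u' : L2Pair Ω).fst (b (u : L2Pair Ω).fst) +
        inner ℂ (u' : L2Pair Ω).snd (s (u : L2Pair Ω).snd) := by
  refine ⟨ContinuousLinearMap.adjoint (H10 Ω).subtypeL ∘L diagOp b s 0 ∘L (H10 Ω).subtypeL,
    fun u u' => ?_⟩
  rw [ContinuousLinearMap.comp_apply, ContinuousLinearMap.adjoint_inner_right,
    WithLp.prod_inner_apply]
  have h1 : s (u : L2Pair Ω).snd + 0 = s (u : L2Pair Ω).snd := add_zero _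
  rw [← h1]
  rfl

set_option maxHeartbeats 1000000 in
/-- In the form, `-ω² d̃² d` and `ς̃` act as bounded multiplication operators. -/
theorem ProfileAssumption.exists_isOperatorA (h : ProfileAssumption r₀ r₁ γ a) :
    ∃ A : H10 Ω →L[ℂ] H10 Ω, IsOperatorA ς γ a ω A := by
  obtain ⟨C, hC1, hC⟩ := h.exists_norm_le
  obtain ⟨S, hS, hS'⟩ := h.exists_norm_sigmaOp_le ς
  have hΦ : AEStronglyMeasurable (fun x : R3 => (dTilde γ a ‖x‖ ^ 2 * dFun γ a ‖x‖) •
      ContinuousLinearMap.id ℂ ℂ) (volume.restrict Ω) :=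
    (((h.measurable_dTilde.pow_const 2).mul h.measurable_dFun).stronglyMeasurable.smul_const
      (ContinuousLinearMap.id ℂ ℂ)).aestronglyMeasurable
  have hΦC : ∀ x : R3, ‖(dTilde γ a ‖x‖ ^ 2 * dFun γ a ‖x‖) • ContinuousLinearMap.id ℂ ℂ‖ ≤
      C ^ 2 * C := fun x => by
    have h1 := hC _ (norm_nonneg x)
    rw [norm_smul, ContinuousLinearMap.norm_id, mul_one, norm_mul, norm_pow]
    gcongr
    exacts [h1.1, h1.2]
  have hsig : AEStronglyMeasurable (sigmaOp ς γ a) (volume.restrict Ω) :=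
    h.stronglyMeasurable_sigmaOp.aestronglyMeasurable
  obtain ⟨b, hb⟩ : ∃ b : Lp ℂ 2 (volume.restrict Ω) →L[ℂ] Lp ℂ 2 (volume.restrict Ω),
      ∀ u, b u =ᵐ[volume.restrict Ω] fun x => (dTilde γ a ‖x‖ ^ 2 * dFun γ a ‖x‖) * u x :=
    ⟨_, coeFn_mulLp _ hΦ _ hΦC⟩
  obtain ⟨s, hs⟩ : ∃ s : Lp C3 2 (volume.restrict Ω) →L[ℂ] Lp C3 2 (volume.restrict Ω),
      ∀ u, s u =ᵐ[volume.restrict Ω] fun x => sigmaOp ς γ a x (u x) :=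
    ⟨_, coeFn_mulLp _ hsig S hS'⟩
  obtain ⟨A, hA⟩ := exists_inner_eq_inner_add ((-ω ^ 2) • b) s
  refine ⟨A, fun u u' => ?_⟩
  have hA' := hA u u'
  rw [_root_.smul_apply, inner_smul_right, L2.inner_def, L2.inner_def] at hA'
  have e1 : (fun x => inner ℂ ((u' : L2Pair Ω).snd x) (s (u : L2Pair Ω).snd x))
      =ᵐ[volume.restrict Ω] stiffness ς γ a u u' := by
    filter_upwards [hs (u : L2Pair Ω).snd] with x hx
    rw [hx]
    rfl
  have e2 : (fun x => inner ℂ ((u' : L2Pair Ω).fst x) (b (u : L2Pair Ω).fst x))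
      =ᵐ[volume.restrict Ω] massTerm γ a u u' := by
    filter_upwards [hb (u : L2Pair Ω).fst] with x hx
    rw [hx, RCLike.inner_apply]
    rfl
  rw [integral_congr_ae e1, integral_congr_ae e2] at hA'
  refine ⟨(L2.integrable_inner (𝕜 := ℂ) _ _).congr e1, (L2.integrable_inner (𝕜 := ℂ) _ _).congr e2,
    ?_⟩
  rw [hA', form]
  ring

end Operator

/-! ### The Gårding inequality -/

section Garding

open Complex (I)

variable {Ω : Set R3} {ς : Matrix (Fin 3) (Fin 3) ℝ} {r₀ r₁ : ℝ} {γ : ℂ} {a : ℝ → ℝ} {ω : ℂ}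

/-- The factor `κ + iσ` rotates `-ω² d₀²` into the right half plane: that number is the square of a
number with nonvanishing real part, and `σ` has the sign opposite to that of its
imaginary part, if this is not zero. -/
theorem exists_rotation (hω : ω ∈ Lam γ a) {κ₀ : ℝ} (hκ₀ : 0 < κ₀) :
    ∃ κ, 0 < κ ∧ κ ≤ κ₀ ∧
      0 < (((κ : ℂ) + I * (symbolSign γ a ω : ℂ)) * (-ω ^ 2 * d0 γ a ^ 2)).re := by
  set μ := -ω ^ 2 * d0 γ a ^ 2 with hμ
  set σ := symbolSign γ a ω with hσ
  have hre : ∀ κ : ℝ, (((κ : ℂ) + I * (σ : ℂ)) * μ).re = κ * μ.re - σ * μ.im := fun κ => by simp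
  have hsign : σ * μ.im ≤ 0 := by
    rw [hσ, symbolSign, ← hμ]
    split_ifs with h1
    · rw [one_mul]
      by_contra! h2
      have h3 := Complex.arg_nonneg_iff.2 h2.le
      have h4 := Complex.arg_eq_zero_iff.1 (le_antisymm h1 h3)
      exact h2.ne' h4.2
    · have := Complex.arg_nonneg_iff.1 (not_le.1 h1).le
      linarith
  rcases hsign.lt_or_eq with h1 | h1
  · refine ⟨min κ₀ (-(σ * μ.im) / (2 * (|μ.re| + 1))), lt_min hκ₀ (by
      apply div_pos <;> [linarith; positivity]), min_le_left _ _, ?_⟩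
    rw [hre]
    set κ := min κ₀ (-(σ * μ.im) / (2 * (|μ.re| + 1))) with hκ
    have hκ1 : κ ≤ -(σ * μ.im) / (2 * (|μ.re| + 1)) := min_le_right _ _
    have hκ0 : 0 < κ := lt_min hκ₀ (by apply div_pos <;> [linarith; positivity])
    rw [le_div_iff₀ (by positivity)] at hκ1
    have h2 : κ * -|μ.re| ≤ κ * μ.re := mul_le_mul_of_nonneg_left (neg_abs_le _) hκ0.le
    nlinarith
  · refine ⟨κ₀, hκ₀, le_rfl, ?_⟩
    have hσ0 : σ ≠ 0 := by
      intro h2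
      have := symbolSign_sq (γ := γ) (a := a) (ω := ω)
      rw [← hσ, h2] at this
      norm_num at this
    have him : μ.im = 0 := (mul_eq_zero.1 h1).resolve_left hσ0
    have hsq : μ = (I * ω * d0 γ a) ^ 2 := by
      rw [hμ, mul_pow, mul_pow, Complex.I_sq]
      ring
    have hw : (I * ω * d0 γ a).re ≠ 0 := hω
    set w := I * ω * d0 γ a
    have him' : w.im = 0 := by
      have : μ.im = 2 * w.re * w.im := by rw [hsq, pow_two, Complex.mul_im]; ring
      rw [him] at this
      simpa [hw] using this.symm
    have hre' : μ.re = w.re ^ 2 := by rw [hsq, pow_two, Complex.mul_re, him']; ring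
    rw [hre, h1, hre', sub_zero]
    positivity

/-- The coercivity of the principal part, pointwise off the sphere of radius `r₁`. In the ball inside
that sphere `d̃ = d = 1`, while the symbol there is formed with `d̂ = d(r₁+)`; this only turns the
positive values of the form by an angle of the favourable sign. -/
theorem le_re_mul_inner_sigmaOp (hr₀ : 0 < r₀) (hς : ς.PosDef) (h : ProfileAssumption r₀ r₁ γ a)
    (hc : 0 < anisoConst ς r₁ γ a) {κ C : ℝ} (hκ : 0 < κ) (hκ' : κ * sMax ς ≤ anisoConst ς r₁ γ a)
    {x : R3} (hC : ‖dFun γ a ‖x‖‖ ≤ C) (hx : ‖x‖ ≠ r₁) (ξ : C3) :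
    κ * anisoConst ς r₁ γ a / C * ‖ξ‖ ^ 2 ≤ (((κ : ℂ) + I * (symbolSign γ a ω : ℂ)) *
      inner ℂ (symbolT ς r₁ γ a ω ‖x‖ • ξ) (sigmaOp ς γ a x ξ)).re := by
  have hx0 := norm_nonneg x
  have hD := h.dTilde_ne_zero hx0
  have hd := h.dFun_ne_zero hx0
  have hs := sMax_pos hς
  obtain ⟨pp, qq, g, A, B, hA, hB, hAB, hpp, hqq, hppA, hqqB, hform, hin⟩ :=
    exists_inner_sigmaOp_eq hς x hD hd ξ
  set t := (phase (dTilde γ a ‖x‖) * (starRingEnd ℂ) (phase (dHat r₁ γ a ‖x‖))).im with ht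
  have ht0 : t ≤ 0 := h.im_phase_nonpos (h.le_alphaHat hr₀ hx0)
  have ht1 : -t ≤ 1 := by
    have h1 : |t| ≤ 1 := by
      refine (Complex.abs_im_le_norm _).trans_eq ?_
      rw [norm_mul, Complex.norm_conj, norm_phase hD, norm_phase (h.dHat_ne_zero hr₀ hx0), one_mul]
    linarith [neg_abs_le t]
  have htw : |(phase (dTilde γ a ‖x‖) * (starRingEnd ℂ) (phase (dFun γ a ‖x‖))).im| ≤ -t := by
    rcases lt_or_gt_of_ne hx with h1 | h1
    · rw [h.dTilde_eq_one hx0 h1.le, h.dFun_eq_one hx0 h1]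
      simpa [phase] using ht0
    · rw [← ProfileAssumption.dHat_eq_dFun h1, ← ht, abs_of_nonpos ht0]
  have hκt : κ * (sMax ς * -t) ≤ anisoConst ς r₁ γ a := by
    refine le_trans ?_ hκ'
    have : sMax ς * -t ≤ sMax ς := mul_le_of_le_one_right hs.le ht1
    gcongr
  have key := le_re_rotation_mul_form hD hd hA hB hpp hqq hs.le hppA hqqB hform
    (rfl : anisoConst ς r₁ γ a = _) hc
    symbolSign_sq hκ.le (h.re_phase_ge hx0 hx) htw hκt (σ := symbolSign γ a ω)
  rw [inner_smul_left, hin, symbolT_eq_twist hc, twist, ← ht, ← mul_assoc]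
  refine le_trans ?_ key
  have hD1 := h.one_le_norm_dTilde hx0
  have hd1 := h.one_le_norm_dFun hx0
  have h1 : A ≤ ‖dTilde γ a ‖x‖‖ ^ 2 * A := le_mul_of_one_le_left hA (one_le_pow₀ hD1)
  have h2 : B ≤ ‖dFun γ a ‖x‖‖ ^ 2 * B := le_mul_of_one_le_left hB (one_le_pow₀ hd1)
  rw [← hAB, div_mul_eq_mul_div]
  have h3 := hd1.trans' one_pos.le
  have h4 : 0 < κ * anisoConst ς r₁ γ a := mul_pos hκ hc
  have h5 : A + B ≤ ‖dTilde γ a ‖x‖‖ ^ 2 * A + ‖dFun γ a ‖x‖‖ ^ 2 * B := by linarith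
  refine div_le_div₀ (by positivity) ?_ (by linarith) hC
  gcongr

/-- The mass term is coercive near infinity, where the phases of `d̃`, `d` and of the symbol tend to
`d₀`. -/
theorem eventually_le_re_mass (h : ProfileAssumption r₀ r₁ γ a) (hp : PhaseAssumption γ a)
    (hc : 0 < anisoConst ς r₁ γ a) {e : ℂ} {q : ℝ} (hq0 : 0 < q)
    (hq : q < (e * (-ω ^ 2 * d0 γ a ^ 2)).re) : ∀ᶠ r in atTop,
      q ≤ (e * (-ω ^ 2 * (dTilde γ a r ^ 2 * dFun γ a r *
        (starRingEnd ℂ) (symbolT ς r₁ γ a ω r)))).re := by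
  have hD : Tendsto (fun r => phase (dTilde γ a r)) atTop (𝓝 (d0 γ a)) := h.tendsto_d0
  have hd := PhaseAssumption.tendsto_phase_dFun h hp
  have hdd : d0 γ a * (starRingEnd ℂ) (d0 γ a) = 1 := by
    rw [Complex.mul_conj, Complex.normSq_eq_norm_sq, h.norm_d0]
    simp
  have hm : Tendsto (symbolT ς r₁ γ a ω) atTop (𝓝 (d0 γ a)) := by
    have h1 := (continuousAt_twist (s := symbolSign γ a ω * sMax ς) hc
      (d0 γ a, d0 γ a)).tendsto.comp (hD.prodMk_nhds hd)
    have h2 : twist (anisoConst ς r₁ γ a) (symbolSign γ a ω * sMax ς) (d0 γ a) (d0 γ a)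
        = d0 γ a := by
      have h3 : phase (anisoConst ς r₁ γ a : ℂ) = 1 := by
        rw [phase, Complex.norm_of_nonneg hc.le, div_self]
        exact_mod_cast hc.ne'
      simp [twist, hdd, h3]
    simp only [h2] at h1
    refine h1.congr' ?_
    filter_upwards [eventually_gt_atTop r₁] with r hr
    exact (symbolT_eq_twist_dFun hc hr).symm
  have hlim := ((((hD.pow 2).mul hd).mul ((Complex.continuous_conj.tendsto _).comp hm)).const_mul
    (-ω ^ 2)).const_mul e
  have heq : e * (-ω ^ 2 * (d0 γ a ^ 2 * d0 γ a * (starRingEnd ℂ) (d0 γ a)))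
      = e * (-ω ^ 2 * d0 γ a ^ 2) := by rw [mul_assoc (d0 γ a ^ 2), hdd, mul_one]
  rw [heq] at hlim
  filter_upwards [((Complex.continuous_re.tendsto _).comp hlim).eventually_const_lt hq,
    eventually_ge_atTop 0] with r hr hr0
  set z := e * (-ω ^ 2 * (phase (dTilde γ a r) ^ 2 * phase (dFun γ a r) *
    (starRingEnd ℂ) (symbolT ς r₁ γ a ω r)))
  have hr' : q < z.re := hr
  have hz : e * (-ω ^ 2 * (dTilde γ a r ^ 2 * dFun γ a r *
      (starRingEnd ℂ) (symbolT ς r₁ γ a ω r)))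
      = ((‖dTilde γ a r‖ ^ 2 * ‖dFun γ a r‖ : ℝ) : ℂ) * z := by
    conv_lhs => rw [← norm_mul_phase (dTilde γ a r), ← norm_mul_phase (dFun γ a r)]
    push_cast
    ring
  rw [hz, Complex.re_ofReal_mul]
  refine hr'.le.trans (le_mul_of_one_le_left (hq0.trans hr').le ?_)
  exact one_le_mul_of_one_le_of_one_le (one_le_pow₀ (h.one_le_norm_dTilde hr0))
    (h.one_le_norm_dFun hr0)

/-- The integrand of `(κ + iσ) a(ω; u, T u)` is bounded below, up to a multiple of `|u|²` on a
ball. The gradient of the symbol produces a cross term, which is absorbed by Young's inequality: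
near infinity because that gradient tends to zero. -/
theorem exists_pointwise_garding (hr₀ : 0 < r₀) (hς : ς.PosDef)
    (h : ProfileAssumption r₀ r₁ γ a) (hp : PhaseAssumption γ a)
    (hc : 0 < anisoConst ς r₁ γ a) (hω : ω ∈ Lam γ a) : ∃ (e : ℂ) (c C R : ℝ), e ≠ 0 ∧ 0 < c ∧
      0 < C ∧ ∀ x : R3, ‖x‖ ≠ r₁ → ∀ (v : ℂ) (ξ : C3),
        c * (‖v‖ ^ 2 + ‖ξ‖ ^ 2) - C * (Metric.ball (0 : R3) R).indicator (fun _ => ‖v‖ ^ 2) x ≤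
          (e * (inner ℂ (symbolT ς r₁ γ a ω ‖x‖ • ξ +
              v • grad (fun x : R3 => symbolT ς r₁ γ a ω ‖x‖) x) (sigmaOp ς γ a x ξ) -
            ω ^ 2 * (dTilde γ a ‖x‖ ^ 2 * dFun γ a ‖x‖ * v *
              (starRingEnd ℂ) (symbolT ς r₁ γ a ω ‖x‖ * v)))).re := by
  have hs := sMax_pos hς
  obtain ⟨κ, hκ, hκ', hrot⟩ := exists_rotation hω (div_pos hc hs)
  rw [le_div_iff₀ hs] at hκ'
  set e := (κ : ℂ) + I * (symbolSign γ a ω : ℂ) with he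
  have he0 : e ≠ 0 := by
    intro h0
    have := congrArg Complex.re h0
    simp [he] at this
    exact hκ.ne' this
  set q := (e * (-ω ^ 2 * d0 γ a ^ 2)).re / 2 with hq
  have hq0 : 0 < q := by positivity
  obtain ⟨D, hD1, hD⟩ := h.exists_norm_le
  obtain ⟨S, hS, hS'⟩ := h.exists_norm_sigmaOp_le ς
  obtain ⟨K, hK⟩ := exists_isMultiplier_symbolT (ω := ω) hr₀ h hp hc
  set k := κ * anisoConst ς r₁ γ a / D with hk
  have hk0 : 0 < k := by positivity
  have he' : 0 < ‖e‖ := norm_pos_iff.2 he0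
  -- `δ` bounds the gradient of the symbol near infinity
  set δ := min 1 (k * q / (‖e‖ * S) ^ 2) with hδ
  have hδ0 : 0 < δ := lt_min one_pos (by positivity)
  have hδq : (‖e‖ * S * δ) ^ 2 ≤ k * q := by
    have h1 : δ ^ 2 ≤ k * q / (‖e‖ * S) ^ 2 := by
      rw [pow_two]
      exact (mul_le_of_le_one_left hδ0.le (min_le_left _ _)).trans (min_le_right _ _)
    rw [le_div_iff₀ (by positivity)] at h1
    nlinarith
  obtain ⟨R, hR⟩ := eventually_atTop.1 ((eventually_le_re_mass h hp hc hq0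
    (half_lt_self hrot)).and (((tendsto_deriv_symbolT (ω := ω) hr₀ h hp hc).eventually_le_const
      (half_pos hδ0)).and (eventually_gt_atTop r₁)))
  set M := ‖e‖ * (‖ω‖ ^ 2 * (D ^ 2 * D)) with hM
  set L := (‖e‖ * S * (2 * K)) ^ 2 / (2 * k) with hL
  refine ⟨e, min (k / 2) (q / 2), M + L + q / 2, R, he0, by positivity, by positivity,
    fun x hx v ξ => ?_⟩
  have hx0 := norm_nonneg x
  set m := symbolT ς r₁ γ a ω ‖x‖ with hm
  set G := grad (fun x : R3 => symbolT ς r₁ γ a ω ‖x‖) x with hG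
  have h1 := le_re_mul_inner_sigmaOp (ω := ω) hr₀ hς h hc hκ hκ' (hD _ hx0).2 hx ξ
  rw [← hm, ← he, ← hk] at h1
  have h2 : -(‖e‖ * S * ‖G‖ * ‖v‖ * ‖ξ‖) ≤ (e * inner ℂ (v • G) (sigmaOp ς γ a x ξ)).re := by
    refine neg_le_of_neg_le (((neg_le_abs _).trans (Complex.abs_re_le_norm _)).trans ?_)
    rw [norm_mul]
    have h3 : ‖inner ℂ (v • G) (sigmaOp ς γ a x ξ)‖ ≤ (‖v‖ * ‖G‖) * (S * ‖ξ‖) := by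
      refine (norm_inner_le_norm _ _).trans ?_
      rw [norm_smul]
      gcongr
      exact ((sigmaOp ς γ a x).le_opNorm ξ).trans (by gcongr; exact hS' x)
    calc ‖e‖ * ‖inner ℂ (v • G) (sigmaOp ς γ a x ξ)‖ ≤ ‖e‖ * ((‖v‖ * ‖G‖) * (S * ‖ξ‖)) := by gcongr
      _ = _ := by ring
  set y := e * (-ω ^ 2 * (dTilde γ a ‖x‖ ^ 2 * dFun γ a ‖x‖ * (starRingEnd ℂ) m)) with hy
  have h3 : e * (inner ℂ (m • ξ + v • G) (sigmaOp ς γ a x ξ) -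
      ω ^ 2 * (dTilde γ a ‖x‖ ^ 2 * dFun γ a ‖x‖ * v * (starRingEnd ℂ) (m * v))) =
      e * inner ℂ (m • ξ) (sigmaOp ς γ a x ξ) + e * inner ℂ (v • G) (sigmaOp ς γ a x ξ) +
        ((‖v‖ ^ 2 : ℝ) : ℂ) * y := by
    have h4 : v * (starRingEnd ℂ) v = ((‖v‖ ^ 2 : ℝ) : ℂ) := by
      rw [Complex.mul_conj, Complex.normSq_eq_norm_sq]
    rw [← h4, inner_add_left, map_mul, hy]
    ring
  rw [h3, Complex.add_re, Complex.add_re, Complex.re_ofReal_mul]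
  have young : ∀ g : ℝ, 0 ≤ g → ‖G‖ ≤ g → ‖e‖ * S * ‖G‖ * ‖v‖ * ‖ξ‖ ≤
      k / 2 * ‖ξ‖ ^ 2 + (‖e‖ * S * g) ^ 2 / (2 * k) * ‖v‖ ^ 2 := fun g hg hGg => by
    have h4 : ‖e‖ * S * ‖G‖ * ‖v‖ * ‖ξ‖ ≤ (‖e‖ * S * g * ‖v‖) * ‖ξ‖ := by gcongr
    refine h4.trans ?_
    have h5 : k / 2 * ‖ξ‖ ^ 2 + (‖e‖ * S * g) ^ 2 / (2 * k) * ‖v‖ ^ 2 -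
        (‖e‖ * S * g * ‖v‖) * ‖ξ‖ = (k * ‖ξ‖ - ‖e‖ * S * g * ‖v‖) ^ 2 / (2 * k) := by
      field_simp
      ring
    have h6 : 0 ≤ (k * ‖ξ‖ - ‖e‖ * S * g * ‖v‖) ^ 2 / (2 * k) := by positivity
    linarith
  have hmin1 : min (k / 2) (q / 2) * ‖ξ‖ ^ 2 ≤ k / 2 * ‖ξ‖ ^ 2 := by
    gcongr
    exact min_le_left _ _
  have hmin2 : min (k / 2) (q / 2) * ‖v‖ ^ 2 ≤ q / 2 * ‖v‖ ^ 2 := by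
    gcongr
    exact min_le_right _ _
  by_cases hxR : x ∈ Metric.ball (0 : R3) R
  · rw [Set.indicator_of_mem hxR]
    have h4 := young (2 * K) (by positivity) (hK.norm_grad_le x)
    rw [← hL] at h4
    have h5 : -M * ‖v‖ ^ 2 ≤ ‖v‖ ^ 2 * y.re := by
      have h6 : ‖y‖ ≤ M := by
        rw [hM, hy, norm_mul, norm_mul, norm_mul, norm_mul, norm_neg, norm_pow, norm_pow,
          Complex.norm_conj, hm, norm_symbolT h hc hx0, mul_one]
        have := hD _ hx0
        gcongr
        exacts [this.1, this.2]
      have h7 : -M ≤ y.re := by linarith [neg_abs_le y.re, Complex.abs_re_le_norm y]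
      rw [mul_comm (‖v‖ ^ 2)]
      exact mul_le_mul_of_nonneg_right h7 (by positivity)
    linarith
  · rw [Set.indicator_of_notMem hxR, mul_zero, sub_zero]
    have hRx : R ≤ ‖x‖ := by simpa using hxR
    obtain ⟨hR1, hR2, hR3⟩ := hR _ hRx
    have h4 := young δ hδ0.le (by
      refine (norm_grad_radial_le (norm_pos_iff.1 ((h.r₁_pos hr₀).trans hR3))
        ((contDiffAt_symbolT hr₀ h hc hR3).differentiableAt (by norm_num))).trans ?_
      linarith)
    have h5 : (‖e‖ * S * δ) ^ 2 / (2 * k) * ‖v‖ ^ 2 ≤ q / 2 * ‖v‖ ^ 2 := by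
      refine mul_le_mul_of_nonneg_right ?_ (by positivity)
      rw [div_le_iff₀ (by positivity)]
      linarith
    have h6 : q * ‖v‖ ^ 2 ≤ ‖v‖ ^ 2 * y.re := by
      rw [mul_comm (‖v‖ ^ 2)]
      gcongr
    linarith

theorem norm_sq_eq_integral_add (u : H10 Ω) :
    ‖u‖ ^ 2 = ∫ x in Ω, (‖valFn u x‖ ^ 2 + ‖gradFn u x‖ ^ 2) := by
  have h1 : ‖u‖ ^ 2 = ‖(u : L2Pair Ω).fst‖ ^ 2 + ‖(u : L2Pair Ω).snd‖ ^ 2 :=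
    WithLp.prod_norm_sq_eq_of_L2 (u : L2Pair Ω)
  rw [h1, norm_sq_eq_integral, norm_sq_eq_integral, ← integral_add]
  · rfl
  · exact (Lp.memLp _).integrable_norm_pow (by norm_num)
  · exact (Lp.memLp _).integrable_norm_pow (by norm_num)

theorem re_mul_integral_sub {X : Type*} [MeasurableSpace X] {μ : Measure X} {f g : X → ℂ}
    (hf : Integrable f μ) (hg : Integrable g μ) (e w : ℂ) :
    (e * ((∫ x, f x ∂μ) - w * ∫ x, g x ∂μ)).re = ∫ x, (e * (f x - w * g x)).re ∂μ := by
  rw [← integral_const_mul, ← integral_sub hf (hg.const_mul w), ← integral_const_mul]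
  exact (integral_re ((hf.sub (hg.const_mul w)).const_mul e)).symm

set_option maxHeartbeats 1000000 in
/-- The Gårding inequality for `T(ω)^* A(ω)`, rotated by a constant. -/
theorem exists_garding (hr₀ : 0 < r₀) (hς : ς.PosDef)
    (h : ProfileAssumption r₀ r₁ γ a) (hp : PhaseAssumption γ a)
    (hc : 0 < anisoConst ς r₁ γ a) (hω : ω ∈ Lam γ a) {K : NNReal}
    (hK : IsMultiplier (fun x : R3 => symbolT ς r₁ γ a ω ‖x‖) K 1) {A : H10 Ω →L[ℂ] H10 Ω}
    (hA : IsOperatorA ς γ a ω A) : ∃ (e : ℂ) (c C R : ℝ), e ≠ 0 ∧ 0 < c ∧ 0 < C ∧ ∀ u : H10 Ω,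
      c * ‖u‖ ^ 2 - C * ∫ x in Ω, (Metric.ball 0 R).indicator (fun x => ‖valFn u x‖ ^ 2) x ≤
        (e * inner ℂ (hK.op u) (A u)).re := by
  obtain ⟨e, c, C, R, he, hc', hC, hpt⟩ := exists_pointwise_garding hr₀ hς h hp hc hω
  refine ⟨e, c, C, R, he, hc', hC, fun u => ?_⟩
  obtain ⟨h1, h2, h3⟩ := hA u (hK.op u)
  have hv : Integrable (fun x => ‖valFn u x‖ ^ 2) (volume.restrict Ω) :=
    (Lp.memLp _).integrable_norm_pow (by norm_num)
  have hg : Integrable (fun x => ‖gradFn u x‖ ^ 2) (volume.restrict Ω) :=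
    (Lp.memLp _).integrable_norm_pow (by norm_num)
  have hi := hv.indicator (s := Metric.ball (0 : R3) R) measurableSet_ball
  have hint : Integrable (fun x => (e * (stiffness ς γ a u (hK.op u) x -
      ω ^ 2 * massTerm γ a u (hK.op u) x)).re) (volume.restrict Ω) :=
    (Integrable.const_mul (Integrable.sub h1 (Integrable.const_mul h2 _)) e).re
  have e1 : (e * inner ℂ (hK.op u) (A u)).re = ∫ x in Ω, (e * (stiffness ς γ a u (hK.op u) x -
      ω ^ 2 * massTerm γ a u (hK.op u) x)).re := by
    rw [h3, form]
    exact re_mul_integral_sub h1 h2 e (ω ^ 2)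
  have hvg : Integrable (fun x => c * (‖valFn u x‖ ^ 2 + ‖gradFn u x‖ ^ 2))
      (volume.restrict Ω) := (hv.add hg).const_mul c
  have hi' : Integrable (fun x => C * (Metric.ball (0 : R3) R).indicator
      (fun x => ‖valFn u x‖ ^ 2) x) (volume.restrict Ω) := hi.const_mul C
  have e2 : c * ‖u‖ ^ 2 - C * ∫ x in Ω, (Metric.ball 0 R).indicator (fun x => ‖valFn u x‖ ^ 2) x =
      ∫ x in Ω, (c * (‖valFn u x‖ ^ 2 + ‖gradFn u x‖ ^ 2) -
        C * (Metric.ball (0 : R3) R).indicator (fun x => ‖valFn u x‖ ^ 2) x) := by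
    rw [integral_sub hvg hi', integral_const_mul, integral_const_mul, norm_sq_eq_integral_add]
  rw [e1, e2]
  refine integral_mono_ae (hvg.sub hi') hint ?_
  have hae : ∀ᵐ x : R3, x ∉ Metric.sphere (0 : R3) r₁ :=
    measure_eq_zero_iff_ae_notMem.1 (Measure.addHaar_sphere volume 0 r₁)
  filter_upwards [ae_restrict_of_ae hae, hK.valFn_op u, hK.gradFn_op u] with x hx h4 h5
  have h6 := hpt x (by simpa using hx) (valFn u x) (gradFn u x)
  rw [← h4, ← h5] at h6
  by_cases hxR : x ∈ Metric.ball (0 : R3) R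
  · simp only [Set.indicator_of_mem hxR] at h6 ⊢
    exact h6
  · simp only [Set.indicator_of_notMem hxR] at h6 ⊢
    exact h6

end Garding

end AnisoPML

end

theorem theorem3p5 (Ω : Set AnisoPML.R3) (hΩ : IsOpen Ω)
    (r₀ r₁ : ℝ) (hr₀ : 0 < r₀) (hΩc : Ωᶜ ⊆ Metric.ball (0 : AnisoPML.R3) r₀)
    (ς : Matrix (Fin 3) (Fin 3) ℝ) (hς : ς.PosDef)
    (γ : ℂ) (a : ℝ → ℝ)
    (hprofile : AnisoPML.ProfileAssumption r₀ r₁ γ a)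
    (hphase : AnisoPML.PhaseAssumption γ a)
    (haniso : 1 - AnisoPML.sMin ς / AnisoPML.sMax ς < Real.cos (AnisoPML.tauStar r₁ γ a))
    (ω : ℂ) (hω : ω ∈ AnisoPML.Lam γ a) :
    (∀ r : ℝ, 0 ≤ r → ‖AnisoPML.symbolT ς r₁ γ a ω r‖ = 1) ∧
    ∃ A T : AnisoPML.H10 Ω →L[ℂ] AnisoPML.H10 Ω,
      AnisoPML.IsOperatorA ς γ a ω A ∧
      AnisoPML.IsRadialMultiplication (AnisoPML.symbolT ς r₁ γ a ω) T ∧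
      AnisoPML.IsWeaklyCoercive T A ∧
      AnisoPML.IsFredholmIndexZero A := by
  have hc := AnisoPML.anisoConst_pos hς haniso
  have hnorm : ∀ r : ℝ, 0 ≤ r → ‖AnisoPML.symbolT ς r₁ γ a ω r‖ = 1 := fun r hr =>
    AnisoPML.norm_symbolT hprofile hc hr
  obtain ⟨K, hK⟩ := AnisoPML.exists_isMultiplier_symbolT (ω := ω) hr₀ hprofile hphase hc
  obtain ⟨A, hA⟩ := hprofile.exists_isOperatorA (Ω := Ω) (ς := ς) (ω := ω)
  obtain ⟨e, c, C, R, he, hc', hC, hG⟩ :=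
    AnisoPML.exists_garding hr₀ hς hprofile hphase hc hω hK hA
  obtain ⟨N, G, hN⟩ := AnisoPML.exists_finiteRank_control hΩ.measurableSet R
    (ε := c / (2 * C)) (by positivity)
  -- `|m| = 1`, so that multiplication by `conj m` inverts multiplication by `m`
  have hT : IsUnit (hK.op (Ω := Ω)) := hK.isUnit_op hK.conj fun x => by
    rw [Complex.mul_conj, Complex.normSq_eq_norm_sq, hnorm _ (norm_nonneg x)]
    norm_num
  refine ⟨hnorm, A, hK.op, hA, hK.valFn_op, ?_⟩
  refine AnisoPML.isWeaklyCoercive_and_isFredholmIndexZero _ A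
    (G ∘L WithLp.fstL 2 ℂ _ _ ∘L (AnisoPML.H10 Ω).subtypeL) hT he (half_pos hc') (C := C)
    fun u => le_trans ?_ (hG u)
  have h1 := mul_le_mul_of_nonneg_left (hN u) hC.le
  have h2 : C * (c / (2 * C) * ‖u‖ ^ 2) = c / 2 * ‖u‖ ^ 2 := by
    field_simp
  change c / 2 * ‖u‖ ^ 2 - C * ‖G (u : AnisoPML.L2Pair Ω).fst‖ ^ 2 ≤ _
  linarith
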